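/- **Theorem 3 (uniform rates of the second-stage marginal-integration estimators).** *Model.* Consider a triangular array of networks. In each row there are $N$ agents with a nonrandom adjacency matrix $(A_{i,j})$ with zero diagonal, reference groups $\mathcal P_i=\{j:A_{i,j}=1\}$, $\overline{\mathcal P}_i=\{i\}\cup\mathcal P_i$, and weights with $a_{i,j}>0$ iff $j\in\mathcal P_i$ and $\sum_{j\in\mathcal P_i}a_{i,j}=1$; the sample consists of the first $n\le N$ agents, and $n\to\infty$ along the array. For each agent let $$T_i=\pi(X_i,Z_i)+\eta(U_i)\in\mathcal T,\qquad S_i=m_i\Big(\sum_{j\in\mathcal P_i}a_{i,j}T_j\Big),$$ with $X_i\in\mathbb R^{d_x}$, $Z_i\in\mathbb R^{d_z}$, $\mathcal T$ a compact interval, $m_i$ strictly increasing and continuous on $\mathcal T$, $\eta$ continuous and strictly increasing on $[0,1]$, and $U_i$ uniform on $[0,1]$ conditionally on $X_{\overline{\mathcal P}_i}$. Let $V_i\in[0,1]$ be the unique solution of $\eta(V_i)=\sum_{j\in\mathcal P_i}a_{i,j}\eta(U_j)$. For the sampled agents $S_i\in\mathcal S$, a compact interval, and $$Y_i=X_i^\top\beta(T_i,S_i)+g(T_i,S_i)\,\epsilon_i,\qquad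 i=1,\dots,n .$$ Assume that $(Z_{\overline{\mathcal P}_i},X_{\overline{\mathcal P}_i})$ is independent of $(U_{\overline{\mathcal P}_i},\epsilon_i)$ for all $i$, that $(U_i,V_i)$, $i\le n$, have a common law, that $E[\epsilon_i\mid U_i,V_i]=\lambda(U_i,V_i)$ and $E[\epsilon_i]=0$ for $i\le n$, and that $\int_{\mathcal{TS}}g=1$. The functions $\beta,g,\lambda$ do not vary along the array. $(U,V)$ denotes a pair with the common law of $(U_i,V_i)$. *Estimators.* $\hat U_i,\hat V_i\in[0,1]$ are estimates of $U_i,V_i$ that are measurable functions of the treatment-equation data $\{(T_j,X_j,Z_j)\}_{j\le N}$. Let $P_{TS}=P_T\otimes P_S$ and $P_{UV}=P_U\otimes P_V$ be tensor products of bases with $K_T,K_S,K_U,K_V$ elements, which may depend on the row; $K_{TS}=K_TK_S$, $K_{UV}=K_UK_V$; $\kappa_n\to\infty$ with $K_{TS}\asymp\kappa_n$ and $K_{UV}\asymp\kappa_n$. Put $\overline P_{UV}=P_{UV}-E[P_{UV}(U,V)]$, $\hat P_{UV}=P_{UV}-\frac1n\sum_{i\le n}P_{UV}(\hat U_i,\hat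 V_i)$, $$\Pi_i=\big(X_i\otimes P_{TS}(T_i,S_i),\;P_{TS}(T_i,S_i)\otimes\overline P_{UV}(U_i,V_i)\big),\qquad \hat\Pi_i=\big(X_i\otimes P_{TS}(T_i,S_i),\;P_{TS}(T_i,S_i)\otimes\hat P_{UV}(\hat U_i,\hat V_i)\big),$$ and let $\mathbf\Pi_n,\hat{\mathbf\Pi}_n$ be the matrices with these rows. With $\tau_n\ge0$, $\tau_n\to0$, and symmetric positive semidefinite $\mathbf D$ with $\rho_{\max}(\mathbf D)=O(1)$, let $$\hat\theta_n=(\hat\theta_{n,\beta},\hat\theta_{n,g\lambda})=[\hat{\mathbf\Pi}_n^\top\hat{\mathbf\Pi}_n+\tau_n n\mathbf D]^{-1}\hat{\mathbf\Pi}_n^\top \mathbf Y_n ,$$ $$\hat\lambda_n(u,v)=\int_{\mathcal{TS}}[P_{TS}(t,s)\otimes\hat P_{UV}(u,v)]^\top\hat\theta_{n,g\lambda}\,dt\,ds,\qquad \hat g_n(t,s)=\int_{[0,1]^2}[P_{TS}(t,s)\otimes\hat P_{UV}(u,v)]^\top\hat\theta_{n,g\lambda}\;\frac{\hat\lambda_n(u,v)}{\int_{[0,1]^2}\hat\lambda_n^2}\,du\,dv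 .$$ *Assumptions.* Constants and $O(\cdot)$ bounds are uniform along the array. 1. (Locations.) Agents are located in $\mathbb R^d$ at mutual Euclidean distances $\Delta(i,j)\ge1$, and for some integer $\overline\Delta\ge0$, $A_{i,j}=0$ whenever $\Delta(i,j)>\overline\Delta$. 2. (Mixing.) The field $(X_i,Z_i,\epsilon_i,U_i)$ is $\alpha$-mixing: with $\alpha(k,l,r)$ the supremum of $|\Pr(A\cap B)-\Pr(A)\Pr(B)|$ over all rows and over events $A,B$ generated by at most $k$, respectively $l$, agents at distance at least $r$ from each other, $\alpha(k,l,r)\to0$ as $r\to\infty$ and $\alpha(k,l,r)\le(k+l)^{\vartheta}\hat\alpha(r)$, where $\vartheta\ge0$ and $\sum_{r\ge1}(r+2\overline\Delta)^{d-1}\hat\alpha(r)<\infty$. Moreover $\sup_i\|X_i\|<\infty$. 3. (Errors.) With $\mathcal F_N=\sigma\{(X_i,Z_i,U_i):i\le N\}$: $\sup_iE[\epsilon_i^4\mid\mathcal F_N]<\infty$; $E[\epsilon_i\mid\mathcal F_N]=E[\epsilon_i\mid U_i,V_i]$ for all $i$; and $\epsilon_1,\dots,\epsilon_N$ are mutually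 independent conditionally on $\mathcal F_N$. 4. (Bases.) (i) The basis functions are uniformly bounded on $\mathcal T,\mathcal S,[0,1],[0,1]$. (ii) $P_U,P_V$ are differentiable with $\sup_u\|\partial P_U(u)\|\le\zeta_U$, $\sup_v\|\partial P_V(v)\|\le\zeta_V$. (iii) $\int_{[0,1]^2}\lambda^2>0$, $\|\int_{\mathcal{TS}}P_{TS}\|=O(1)$, and $\|\int_{[0,1]^2}\overline P_{UV}\,\omega\|=O(1)$ with $\omega=\lambda/\int_{[0,1]^2}\lambda^2$. (iv), (v) $P_{UV}$ is Lipschitz on $[0,1]^2$ with constant $cK_{UV}^{\xi_1}$, and $P_{TS}$ is Lipschitz on $\mathcal{TS}$ with constant $cK_{TS}^{\xi_2}$, for some $c,\xi_1,\xi_2>0$. 5. (Eigenvalues.) For some $0<c_1<c_2$, all eigenvalues of $E[\mathbf\Pi_n^\top\mathbf\Pi_n/n]$ lie in $(c_1,c_2)$ for all large $n$. 6. (Approximation.) On $\mathcal{TS}$ the $\beta_l$ are $C^2$ and $g$ is $C^1$, on $[0,1]^2$ $\lambda$ is $C^1$, and for vectors $\theta^*_{\beta_l},\theta^*_g,\theta^*_\lambda$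 and constants $\mu_\beta,\mu_g,\mu_\lambda>0$: $\sup_{\mathcal{TS}}|\beta_l-P_{TS}^\top\theta^*_{\beta_l}|=O(K_{TS}^{-\mu_\beta})$, $\sup_{\mathcal{TS}}|g-P_{TS}^\top\theta_g^*|=O(K_{TS}^{-\mu_g})$, $\sup_{[0,1]^2}|\lambda-\overline P_{UV}^\top\theta_\lambda^*|=O(K_{UV}^{-\mu_\lambda})$. 7. (Control variables.) For some $\nu\in(0,1/2]$, $\sup_i|\hat U_i-U_i|=O_P(n^{-\nu})$ and $\sup_i|\hat V_i-V_i|=O_P(n^{-\nu})$. 8. (Growth.) $\kappa_n^4/n\to0$, $\zeta_\dagger\sqrt{\kappa_n}\,n^{-\nu}\to0$ with $\zeta_\dagger=\zeta_U\sqrt{K_V}+\zeta_V\sqrt{K_U}$, and $\kappa_n^4\ln\kappa_n/n\to0$. *Conclusion.* Let $b_\mu=K_{TS}^{-\mu_\beta}+K_{TS}^{-\mu_g}+K_{UV}^{-\mu_\lambda}$ and $\tau_n^*=\tau_n\sqrt{\theta^{*\top}\mathbf D\theta^*}$ with $\theta^*=(\theta_\beta^*,\theta_g^*\otimes\theta_\lambda^*)$.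 Then (i) $\displaystyle\sup_{(u,v)\in[0,1]^2}|\hat\lambda_n(u,v)-\lambda(u,v)|=O_P\Big(\sqrt{\tfrac{\kappa_n\ln\kappa_n}{n}}+\sqrt{\kappa_n}\,(b_\mu+\tau_n^*+n^{-\nu})\Big).$ (ii) If in addition $(U,V)$ has a density on $[0,1]^2$ bounded below by a positive constant, $\rho_{\max}(E[\overline P_{UV}(U,V)\overline P_{UV}(U,V)^\top])<c$ for a constant $c$, $\zeta_\dagger\kappa_nn^{-\nu}=O(1)$, and $\kappa_n^{3/2}(b_\mu+\tau_n^*+n^{-\nu})=O(1)$, then $$\sup_{(t,s)\in\mathcal{TS}}|\hat g_n(t,s)-g(t,s)|=O_P\Big(\sqrt{\tfrac{\kappa_n\ln\kappa_n}{n}}+\sqrt{\kappa_n}\,(b_\mu+\tau_n^*+n^{-\nu})\Big).$$ -/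

import Mathlib

open MeasureTheory ProbabilityTheory Filter Topology Set
open scoped ENNReal Matrix

noncomputable section

namespace Spillover

/-- Euclidean norm of a finite real vector (for a vector it is also the Frobenius norm). -/
def eucl {ι : Type*} [Fintype ι] (v : ι → ℝ) : ℝ := ‖(WithLp.toLp 2 v : EuclideanSpace ℝ ι)‖

/-- The closed unit square. -/
def unitSq : Set (ℝ × ℝ) := Icc (0 : ℝ) 1 ×ˢ Icc (0 : ℝ) 1

/-- Stochastic boundedness `X k = O_P(r k)` as `k → ∞`, where the `k`-th variable lives on its own
probability space and takes values in `[0, ∞]`. -/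
def IsBigOP {Ω : ℕ → Type*} [∀ k, MeasurableSpace (Ω k)] (P : ∀ k, Measure (Ω k))
    (X : ∀ k, Ω k → ℝ≥0∞) (r : ℕ → ℝ) : Prop :=
  ∀ δ : ℝ, 0 < δ → ∃ M : ℝ, 0 < M ∧
    ∀ᶠ k in atTop, P k {ω | ENNReal.ofReal (M * r k) < X k ω} ≤ ENNReal.ofReal δ

/-- The `α`-mixing coefficient between two sub-`σ`-algebras. -/
def alphaDep {Ω : Type*} [MeasurableSpace Ω] (P : Measure Ω) (m₁ m₂ : MeasurableSpace Ω) : ℝ :=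
  sSup {x : ℝ | ∃ A B : Set Ω, MeasurableSet[m₁] A ∧ MeasurableSet[m₂] B ∧
    x = |P.real (A ∩ B) - P.real A * P.real B|}

/-- (Mutual) conditional independence of a family of real random variables given a
sub-`σ`-algebra, through conditional probabilities of cylinder events. -/
def CondIndepFamily {Ω ι : Type*} [MeasurableSpace Ω] (P : Measure Ω) (m : MeasurableSpace Ω)
    (f : ι → Ω → ℝ) : Prop :=
  ∀ (s : Finset ι) (B : ι → Set ℝ), (∀ i, MeasurableSet (B i)) →
    P⟦⋂ i ∈ s, f i ⁻¹' B i | m⟧ =ᵐ[P] ∏ i ∈ s, P⟦f i ⁻¹' B i | m⟧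

/-- All primitive objects of the model and of the estimation procedure, along a sequence of
networks indexed by `k` (a triangular array). No property is imposed here apart from the
subsample being part of the population. -/
structure Setup (dx dz d : ℕ) (Ω : ℕ → Type*) [∀ k, MeasurableSpace (Ω k)] where
  /-- probability measure of the `k`-th row -/
  P : ∀ k, Measure (Ω k)
  /-- number of agents of the `k`-th network -/
  popSize : ℕ → ℕ
  /-- size of the subsample, which consists of the first `n k` agents -/
  n : ℕ → ℕ
  n_le : ∀ k, n k ≤ popSize k
  /-- location of the agents in the latent space -/
  loc : ∀ k, Fin (popSize k) → EuclideanSpace ℝ (Fin d)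
  /-- adjacency matrix: `adj k i j` says that `j` affects `i` -/
  adj : ∀ k, Fin (popSize k) → Fin (popSize k) → Bool
  /-- weights `a_{i,j}` -/
  wt : ∀ k, Fin (popSize k) → Fin (popSize k) → ℝ
  /-- the transformations `m_i` in the exposure mapping -/
  m : ∀ k, Fin (popSize k) → ℝ → ℝ
  /-- covariates -/
  X : ∀ k, Fin (popSize k) → Ω k → (Fin dx → ℝ)
  /-- instruments -/
  Z : ∀ k, Fin (popSize k) → Ω k → (Fin dz → ℝ)
  /-- unobservable of the treatment equation -/
  U : ∀ k, Fin (popSize k) → Ω k → ℝ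
  /-- unobservable of the outcome equation -/
  eps : ∀ k, Fin (popSize k) → Ω k → ℝ
  /-- the function `π` of the treatment equation -/
  treat : ∀ _ : ℕ, (Fin dx → ℝ) → (Fin dz → ℝ) → ℝ
  /-- the function `η` of the treatment equation -/
  eta : ∀ _ : ℕ, ℝ → ℝ
  /-- endpoints of the treatment interval `𝒯` -/
  tlo : ℝ
  thi : ℝ
  /-- endpoints of the exposure interval `𝒮` -/
  slo : ℝ
  shi : ℝ
  /-- coefficient functions `β_l` -/
  beta : Fin dx → ℝ → ℝ → ℝ
  /-- the function `g` -/
  g : ℝ → ℝ → ℝ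
  /-- the function `λ` -/
  lam : ℝ → ℝ → ℝ
  /-- common law of `(U_i, V_i)` in the subsample -/
  Q : ℕ → Measure (ℝ × ℝ)
  /-- estimated control variables -/
  Uhat : ∀ k, Fin (popSize k) → Ω k → ℝ
  Vhat : ∀ k, Fin (popSize k) → Ω k → ℝ
  /-- numbers of basis functions -/
  KT : ℕ → ℕ
  KS : ℕ → ℕ
  KU : ℕ → ℕ
  KV : ℕ → ℕ
  /-- basis functions (they may depend on the row, as B-splines do) -/
  pT : ∀ k, Fin (KT k) → ℝ → ℝ
  pS : ∀ k, Fin (KS k) → ℝ → ℝ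
  pU : ∀ k, Fin (KU k) → ℝ → ℝ
  pV : ∀ k, Fin (KV k) → ℝ → ℝ
  /-- common growth rate of `K_T K_S` and `K_U K_V` -/
  kap : ℕ → ℝ
  /-- penalty level and penalty matrix -/
  tau : ℕ → ℝ
  D : ∀ k, Matrix ((Fin dx × (Fin (KT k) × Fin (KS k))) ⊕
      ((Fin (KT k) × Fin (KS k)) × (Fin (KU k) × Fin (KV k))))
    ((Fin dx × (Fin (KT k) × Fin (KS k))) ⊕
      ((Fin (KT k) × Fin (KS k)) × (Fin (KU k) × Fin (KV k)))) ℝ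
  /-- bounds for the derivatives of the bases -/
  zetaU : ℕ → ℝ
  zetaV : ℕ → ℝ
  /-- approximating coefficient vectors and approximation exponents -/
  thBeta : ∀ k, Fin dx → Fin (KT k) × Fin (KS k) → ℝ
  thG : ∀ k, Fin (KT k) × Fin (KS k) → ℝ
  thLam : ∀ k, Fin (KU k) × Fin (KV k) → ℝ
  muBeta : ℝ
  muG : ℝ
  muLam : ℝ
  /-- rate exponent of the estimated control variables -/
  nu : ℝ
  /-- threshold distance for links -/
  Dbar : ℕ

namespace Setup

variable {dx dz d : ℕ} {Ω : ℕ → Type*} [∀ k, MeasurableSpace (Ω k)] (M : Setup dx dz d Ω)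

/-! ### The model -/

/-- The reference group of agent `i`. -/
def peers (k : ℕ) (i : Fin (M.popSize k)) : Finset (Fin (M.popSize k)) :=
  Finset.univ.filter fun j => M.adj k i j = true

/-- Agent `i` together with its reference group. -/
abbrev Closed (k : ℕ) (i : Fin (M.popSize k)) : Type :=
  {j : Fin (M.popSize k) // j = i ∨ j ∈ M.peers k i}

/-- The `i`-th member of the subsample as an agent. -/
def sub (k : ℕ) (i : Fin (M.n k)) : Fin (M.popSize k) := Fin.castLE (M.n_le k) i

/-- Treatment `T_i = π(X_i, Z_i) + η(U_i)`. -/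
def T (k : ℕ) (i : Fin (M.popSize k)) (ω : Ω k) : ℝ :=
  M.treat k (M.X k i ω) (M.Z k i ω) + M.eta k (M.U k i ω)

/-- Spillover exposure `S_i = m_i(∑_{j ∈ 𝒫_i} a_{ij} T_j)`. -/
def S (k : ℕ) (i : Fin (M.popSize k)) (ω : Ω k) : ℝ :=
  M.m k i (∑ j ∈ M.peers k i, M.wt k i j * M.T k j ω)

/-- The control variable `V_i`: the solution `v ∈ [0,1]` of `η(v) = ∑_{j ∈ 𝒫_i} a_{ij} η(U_j)`
(it exists and is unique as `η` is continuous and strictly increasing on `[0,1]`). -/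
def V (k : ℕ) (i : Fin (M.popSize k)) (ω : Ω k) : ℝ :=
  Function.invFunOn (M.eta k) (Icc 0 1) (∑ j ∈ M.peers k i, M.wt k i j * M.eta k (M.U k j ω))

/-- Outcome `Y_i = X_iᵀ β(T_i, S_i) + g(T_i, S_i) ε_i`. -/
def Y (k : ℕ) (i : Fin (M.n k)) (ω : Ω k) : ℝ :=
  (∑ l, M.X k (M.sub k i) ω l * M.beta l (M.T k (M.sub k i) ω) (M.S k (M.sub k i) ω)) +
    M.g (M.T k (M.sub k i) ω) (M.S k (M.sub k i) ω) * M.eps k (M.sub k i) ω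

/-- The rectangle `𝒯𝒮`. -/
def rect : Set (ℝ × ℝ) := Icc M.tlo M.thi ×ˢ Icc M.slo M.shi

/-- `σ`-algebra generated by all `(X_i, Z_i, U_i)`. -/
@[reducible] def sigmaF (k : ℕ) : MeasurableSpace (Ω k) :=
  ⨆ i, MeasurableSpace.comap (fun ω => (M.X k i ω, M.Z k i ω, M.U k i ω)) inferInstance

/-- `σ`-algebra generated by the data `(T_i, X_i, Z_i)` on the treatment equation. -/
@[reducible] def sigmaObs (k : ℕ) : MeasurableSpace (Ω k) :=
  ⨆ i, MeasurableSpace.comap (fun ω => (M.T k i ω, M.X k i ω, M.Z k i ω)) inferInstance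

/-- `σ`-algebra generated by `(U_i, V_i)`. -/
@[reducible] def sigmaUV (k : ℕ) (i : Fin (M.popSize k)) : MeasurableSpace (Ω k) :=
  MeasurableSpace.comap (fun ω => (M.U k i ω, M.V k i ω)) inferInstance

/-- `σ`-algebra generated by the covariates of `i` and of its reference group. -/
@[reducible] def sigmaX (k : ℕ) (i : Fin (M.popSize k)) : MeasurableSpace (Ω k) :=
  MeasurableSpace.comap (fun ω (j : M.Closed k i) => M.X k j ω) inferInstance

/-! ### Mixing -/

/-- `σ`-algebra generated by `(X_i, Z_i, ε_i, U_i)`, `i ∈ K`. -/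
@[reducible] def sigmaField (k : ℕ) (K : Finset (Fin (M.popSize k))) : MeasurableSpace (Ω k) :=
  ⨆ i ∈ K, MeasurableSpace.comap
    (fun ω => (M.X k i ω, M.Z k i ω, M.eps k i ω, M.U k i ω)) inferInstance

/-- The mixing coefficient `α(a, b, r)` of the random field `(X_i, Z_i, ε_i, U_i)`. -/
def mixCoeff (a b r : ℕ) : ℝ :=
  sSup {x : ℝ | ∃ (k : ℕ) (K L : Finset (Fin (M.popSize k))), K.card ≤ a ∧ L.card ≤ b ∧
    (∀ i ∈ K, ∀ j ∈ L, (r : ℝ) ≤ dist (M.loc k i) (M.loc k j)) ∧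
    x = alphaDep (M.P k) (M.sigmaField k K) (M.sigmaField k L)}

/-! ### Series terms -/

/-- Index set of `P_{TS}`. -/
abbrev IdxTS (k : ℕ) : Type := Fin (M.KT k) × Fin (M.KS k)

/-- Index set of `P_{UV}`. -/
abbrev IdxUV (k : ℕ) : Type := Fin (M.KU k) × Fin (M.KV k)

/-- Index set of the full coefficient vector. -/
abbrev Idx (k : ℕ) : Type := (Fin dx × M.IdxTS k) ⊕ (M.IdxTS k × M.IdxUV k)

/-- `K_{TS}`. -/
def KTS (k : ℕ) : ℕ := M.KT k * M.KS k

/-- `K_{UV}`. -/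
def KUV (k : ℕ) : ℕ := M.KU k * M.KV k

/-- `P_{TS}(t, s) = P_T(t) ⊗ P_S(s)`. -/
def PTS (k : ℕ) (t s : ℝ) : M.IdxTS k → ℝ := fun a => M.pT k a.1 t * M.pS k a.2 s

/-- `P_{UV}(u, v) = P_U(u) ⊗ P_V(v)`. -/
def PUV (k : ℕ) (u v : ℝ) : M.IdxUV k → ℝ := fun b => M.pU k b.1 u * M.pV k b.2 v

/-- `P_{UV}` centred at its true mean. -/
def PUVbar (k : ℕ) (u v : ℝ) : M.IdxUV k → ℝ :=
  fun b => M.PUV k u v b - ∫ p, M.PUV k p.1 p.2 b ∂(M.Q k)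

/-- `P_{UV}` centred at its estimated mean. -/
def PUVhat (k : ℕ) (ω : Ω k) (u v : ℝ) : M.IdxUV k → ℝ :=
  fun b => M.PUV k u v b - (1 / (M.n k : ℝ)) *
    ∑ i, M.PUV k (M.Uhat k (M.sub k i) ω) (M.Vhat k (M.sub k i) ω) b

/-- `P_{TS}^* = ∫_{𝒯𝒮} P_{TS}`. -/
def PTSstar (k : ℕ) : M.IdxTS k → ℝ := fun a => ∫ p in M.rect, M.PTS k p.1 p.2 a

/-- The weight `ω(u, v) = λ(u, v) / ∫∫ λ²`. -/
def omega (u v : ℝ) : ℝ := M.lam u v / ∫ p in unitSq, M.lam p.1 p.2 ^ 2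

/-- `∫∫ P̄_{UV} ω`. -/
def PUVbarStar (k : ℕ) : M.IdxUV k → ℝ :=
  fun b => ∫ p in unitSq, M.PUVbar k p.1 p.2 b * M.omega p.1 p.2

/-- The regressor vector `Π_i` with the true control variables and the true mean. -/
def Reg (k : ℕ) (ω : Ω k) (i : Fin (M.n k)) : M.Idx k → ℝ :=
  Sum.elim
    (fun c => M.X k (M.sub k i) ω c.1 *
      M.PTS k (M.T k (M.sub k i) ω) (M.S k (M.sub k i) ω) c.2)
    (fun c => M.PTS k (M.T k (M.sub k i) ω) (M.S k (M.sub k i) ω) c.1 *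
      M.PUVbar k (M.U k (M.sub k i) ω) (M.V k (M.sub k i) ω) c.2)

/-- The feasible regressor matrix, with rows `Π̂_i`. -/
def RegHat (k : ℕ) (ω : Ω k) : Matrix (Fin (M.n k)) (M.Idx k) ℝ :=
  Matrix.of fun i => Sum.elim
    (fun c => M.X k (M.sub k i) ω c.1 *
      M.PTS k (M.T k (M.sub k i) ω) (M.S k (M.sub k i) ω) c.2)
    (fun c => M.PTS k (M.T k (M.sub k i) ω) (M.S k (M.sub k i) ω) c.1 *
      M.PUVhat k ω (M.Uhat k (M.sub k i) ω) (M.Vhat k (M.sub k i) ω) c.2)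

/-- `E[Πᵀ Π / n]`. -/
def gram (k : ℕ) : Matrix (M.Idx k) (M.Idx k) ℝ :=
  Matrix.of fun a b =>
    ∫ ω, (1 / (M.n k : ℝ)) * ∑ i, M.Reg k ω i a * M.Reg k ω i b ∂(M.P k)

/-- `E[P̄_{UV}(U, V) P̄_{UV}(U, V)ᵀ]`. -/
def gramUV (k : ℕ) : Matrix (M.IdxUV k) (M.IdxUV k) ℝ :=
  Matrix.of fun a b => ∫ p, M.PUVbar k p.1 p.2 a * M.PUVbar k p.1 p.2 b ∂(M.Q k)

/-! ### The estimators -/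

/-- The penalized least squares coefficient
`[Π̂ᵀ Π̂ + τ n D]⁻¹ Π̂ᵀ Y`. -/
def thetaHat (k : ℕ) (ω : Ω k) : M.Idx k → ℝ :=
  ((M.RegHat k ω)ᵀ * M.RegHat k ω + (M.tau k * (M.n k : ℝ)) • (M.D k : Matrix (M.Idx k) (M.Idx k) ℝ))⁻¹
    *ᵥ ((M.RegHat k ω)ᵀ *ᵥ fun i => M.Y k i ω)

/-- First-stage estimator of `g(t, s) λ(u, v)`. -/
def glHat (k : ℕ) (ω : Ω k) (t s u v : ℝ) : ℝ :=
  ∑ a : M.IdxTS k, ∑ b : M.IdxUV k,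
    M.PTS k t s a * M.PUVhat k ω u v b * M.thetaHat k ω (Sum.inr (a, b))

/-- Second-stage estimator of `λ`. -/
def lamHat (k : ℕ) (ω : Ω k) (u v : ℝ) : ℝ := ∫ p in M.rect, M.glHat k ω p.1 p.2 u v

/-- Estimated weight `λ̂(u, v) / ∫∫ λ̂²`. -/
def omegaHat (k : ℕ) (ω : Ω k) (u v : ℝ) : ℝ :=
  M.lamHat k ω u v / ∫ p in unitSq, M.lamHat k ω p.1 p.2 ^ 2

/-- Second-stage estimator of `g`. -/
def gHat (k : ℕ) (ω : Ω k) (t s : ℝ) : ℝ :=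
  ∫ p in unitSq, M.glHat k ω t s p.1 p.2 * M.omegaHat k ω p.1 p.2

/-! ### Rates -/

/-- The pseudo-true coefficient vector `θ* = (θ_β*, θ_g* ⊗ θ_λ*)`. -/
def thetaStar (k : ℕ) : M.Idx k → ℝ :=
  Sum.elim (fun c => M.thBeta k c.1 c.2) (fun c => M.thG k c.1 * M.thLam k c.2)

/-- `b_μ`. -/
def bmu (k : ℕ) : ℝ :=
  (M.KTS k : ℝ) ^ (-M.muBeta) + (M.KTS k : ℝ) ^ (-M.muG) + (M.KUV k : ℝ) ^ (-M.muLam)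

/-- `τ_n^* = τ_n √(θ*ᵀ D θ*)`. -/
def tauStar (k : ℕ) : ℝ :=
  M.tau k * √(M.thetaStar k ⬝ᵥ ((M.D k : Matrix (M.Idx k) (M.Idx k) ℝ) *ᵥ M.thetaStar k))

/-- `n^{-ν}`. -/
def nNu (k : ℕ) : ℝ := (M.n k : ℝ) ^ (-M.nu)

/-- `ζ_† = ζ_U √K_V + ζ_V √K_U`. -/
def zetaDag (k : ℕ) : ℝ := M.zetaU k * √(M.KV k : ℝ) + M.zetaV k * √(M.KU k : ℝ)

/-- `√(κ ln κ / n) + √κ (b_μ + τ* + n^{-ν})`. -/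
def rate (k : ℕ) : ℝ :=
  √(M.kap k * Real.log (M.kap k) / (M.n k : ℝ)) +
    √(M.kap k) * (M.bmu k + M.tauStar k + M.nNu k)

/-! ### Assumptions -/

/-- The standing framework: network, model equations, normalizations, tuning sequences, and
control variables estimated from the treatment-equation data. -/
structure Framework : Prop where
  prob : ∀ k, IsProbabilityMeasure (M.P k)
  n_tendsto : Tendsto M.n atTop atTop
  adj_diag : ∀ k i, M.adj k i i = false
  wt_pos : ∀ k i j, 0 < M.wt k i j ↔ j ∈ M.peers k i
  wt_sum : ∀ k i, ∑ j ∈ M.peers k i, M.wt k i j = 1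
  m_mono : ∀ k i, StrictMonoOn (M.m k i) (Icc M.tlo M.thi)
  m_cont : ∀ k i, ContinuousOn (M.m k i) (Icc M.tlo M.thi)
  meas_X : ∀ k i, Measurable (M.X k i)
  meas_Z : ∀ k i, Measurable (M.Z k i)
  meas_U : ∀ k i, Measurable (M.U k i)
  meas_eps : ∀ k i, Measurable (M.eps k i)
  meas_treat : ∀ k, Measurable (fun p : (Fin dx → ℝ) × (Fin dz → ℝ) => M.treat k p.1 p.2)
  T_mem : ∀ k i ω, M.T k i ω ∈ Icc M.tlo M.thi
  S_mem : ∀ k (i : Fin (M.n k)) ω, M.S k (M.sub k i) ω ∈ Icc M.slo M.shi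
  eta_cont : ∀ k, ContinuousOn (M.eta k) (Icc 0 1)
  eta_mono : ∀ k, StrictMonoOn (M.eta k) (Icc 0 1)
  U_mem : ∀ k i ω, M.U k i ω ∈ Icc (0 : ℝ) 1
  U_unif : ∀ k i, ∀ u ∈ Icc (0 : ℝ) 1,
    (M.P k)⟦M.U k i ⁻¹' Iic u | M.sigmaX k i⟧ =ᵐ[M.P k] fun _ => u
  indep : ∀ k i, IndepFun
    (fun ω (j : M.Closed k i) => (M.Z k j ω, M.X k j ω))
    (fun ω => ((fun j : M.Closed k i => M.U k j ω), M.eps k i ω)) (M.P k)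
  law_UV : ∀ k (i : Fin (M.n k)),
    (M.P k).map (fun ω => (M.U k (M.sub k i) ω, M.V k (M.sub k i) ω)) = M.Q k
  eps_int : ∀ k i, Integrable (M.eps k i) (M.P k)
  eps_UV : ∀ k (i : Fin (M.n k)),
    (M.P k)[M.eps k (M.sub k i) | M.sigmaUV k (M.sub k i)] =ᵐ[M.P k]
      fun ω => M.lam (M.U k (M.sub k i) ω) (M.V k (M.sub k i) ω)
  eps_mean : ∀ k (i : Fin (M.n k)), ∫ ω, M.eps k (M.sub k i) ω ∂(M.P k) = 0
  g_norm : ∫ p in M.rect, M.g p.1 p.2 = 1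
  kap_tendsto : Tendsto M.kap atTop atTop
  kap_TS : ∃ c₁ c₂ : ℝ, 0 < c₁ ∧ ∀ᶠ k in atTop,
    c₁ * M.kap k ≤ (M.KTS k : ℝ) ∧ (M.KTS k : ℝ) ≤ c₂ * M.kap k
  kap_UV : ∃ c₁ c₂ : ℝ, 0 < c₁ ∧ ∀ᶠ k in atTop,
    c₁ * M.kap k ≤ (M.KUV k : ℝ) ∧ (M.KUV k : ℝ) ≤ c₂ * M.kap k
  tau_nonneg : ∀ k, 0 ≤ M.tau k
  tau_tendsto : Tendsto M.tau atTop (𝓝 0)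
  D_psd : ∀ k, (M.D k).PosSemidef
  D_bdd : ∃ C : ℝ, ∀ᶠ k in atTop, spectrum ℝ (M.D k) ⊆ Iic C
  Uhat_meas : ∀ k i, Measurable[M.sigmaObs k] (M.Uhat k i)
  Vhat_meas : ∀ k i, Measurable[M.sigmaObs k] (M.Vhat k i)
  Uhat_mem : ∀ k i ω, M.Uhat k i ω ∈ Icc (0 : ℝ) 1
  Vhat_mem : ∀ k i ω, M.Vhat k i ω ∈ Icc (0 : ℝ) 1

/-- Locations: no infill asymptotics, and links only within a threshold distance. -/
structure SpaceCond : Prop where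
  sep : ∀ k i j, i ≠ j → 1 ≤ dist (M.loc k i) (M.loc k j)
  homophily : ∀ k i j, i ≠ j → (M.Dbar : ℝ) < dist (M.loc k i) (M.loc k j) → M.adj k i j = false

/-- `α`-mixing of the random field, and bounded covariates. -/
structure MixingCond : Prop where
  mixing : ∀ a b : ℕ, Tendsto (fun r => M.mixCoeff a b r) atTop (𝓝 0)
  rate : ∃ (ϑ : ℝ) (αh : ℕ → ℝ), 0 ≤ ϑ ∧
    (∀ a b r : ℕ, M.mixCoeff a b r ≤ ((a : ℝ) + b) ^ ϑ * αh r) ∧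
    Summable fun r : ℕ => (((r + 1 : ℕ) : ℝ) + 2 * M.Dbar) ^ ((d : ℝ) - 1) * αh (r + 1)
  X_bdd : ∃ C : ℝ, ∀ k i, ∀ᵐ ω ∂(M.P k), eucl (M.X k i ω) ≤ C

/-- Conditions on the outcome disturbances. -/
structure ErrorCond : Prop where
  moment_int : ∀ k i, Integrable (fun ω => M.eps k i ω ^ 4) (M.P k)
  moment : ∃ C : ℝ, ∀ k i,
    (M.P k)[fun ω => M.eps k i ω ^ 4 | M.sigmaF k] ≤ᵐ[M.P k] fun _ => C
  mean : ∀ k i, (M.P k)[M.eps k i | M.sigmaF k] =ᵐ[M.P k] (M.P k)[M.eps k i | M.sigmaUV k i]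
  indep : ∀ k, CondIndepFamily (M.P k) (M.sigmaF k) (M.eps k)

/-- Conditions on the basis functions. -/
structure BasisCond : Prop where
  bdd : ∃ C : ℝ, ∀ k,
    (∀ j, ∀ t ∈ Icc M.tlo M.thi, |M.pT k j t| ≤ C) ∧
    (∀ j, ∀ s ∈ Icc M.slo M.shi, |M.pS k j s| ≤ C) ∧
    (∀ j, ∀ u ∈ Icc (0 : ℝ) 1, |M.pU k j u| ≤ C) ∧
    (∀ j, ∀ v ∈ Icc (0 : ℝ) 1, |M.pV k j v| ≤ C)
  diff_U : ∀ k j, DifferentiableOn ℝ (M.pU k j) (Icc 0 1)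
  diff_V : ∀ k j, DifferentiableOn ℝ (M.pV k j) (Icc 0 1)
  deriv_U : ∀ k, ∀ u ∈ Icc (0 : ℝ) 1,
    eucl (fun j => derivWithin (M.pU k j) (Icc 0 1) u) ≤ M.zetaU k
  deriv_V : ∀ k, ∀ v ∈ Icc (0 : ℝ) 1,
    eucl (fun j => derivWithin (M.pV k j) (Icc 0 1) v) ≤ M.zetaV k
  PTSstar_bdd : ∃ C : ℝ, ∀ᶠ k in atTop, eucl (M.PTSstar k) ≤ C
  lam_ne : 0 < ∫ p in unitSq, M.lam p.1 p.2 ^ 2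
  PUVbarStar_bdd : ∃ C : ℝ, ∀ᶠ k in atTop, eucl (M.PUVbarStar k) ≤ C
  lip_UV : ∃ c ξ : ℝ, 0 < c ∧ 0 < ξ ∧ ∀ k, ∀ p ∈ unitSq, ∀ q ∈ unitSq,
    eucl (M.PUV k p.1 p.2 - M.PUV k q.1 q.2) ≤
      c * (M.KUV k : ℝ) ^ ξ * √((p.1 - q.1) ^ 2 + (p.2 - q.2) ^ 2)
  lip_TS : ∃ c ξ : ℝ, 0 < c ∧ 0 < ξ ∧ ∀ k, ∀ p ∈ M.rect, ∀ q ∈ M.rect,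
    eucl (M.PTS k p.1 p.2 - M.PTS k q.1 q.2) ≤
      c * (M.KTS k : ℝ) ^ ξ * √((p.1 - q.1) ^ 2 + (p.2 - q.2) ^ 2)

/-- The eigenvalues of the population second moment matrix are bounded and bounded away from
zero. -/
def EigenCond : Prop :=
  ∃ c₁ c₂ : ℝ, 0 < c₁ ∧ ∀ᶠ k in atTop, spectrum ℝ (M.gram k) ⊆ Ioo c₁ c₂

/-- Smoothness of the functions and quality of the series approximation. -/
structure ApproxCond : Prop where
  beta_smooth : ∀ l, ContDiffOn ℝ 2 (fun p : ℝ × ℝ => M.beta l p.1 p.2) M.rect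
  g_smooth : ContDiffOn ℝ 1 (fun p : ℝ × ℝ => M.g p.1 p.2) M.rect
  lam_smooth : ContDiffOn ℝ 1 (fun p : ℝ × ℝ => M.lam p.1 p.2) unitSq
  muBeta_pos : 0 < M.muBeta
  muG_pos : 0 < M.muG
  muLam_pos : 0 < M.muLam
  beta_approx : ∀ l, ∃ C : ℝ, ∀ᶠ k in atTop, ∀ p ∈ M.rect,
    |M.beta l p.1 p.2 - M.PTS k p.1 p.2 ⬝ᵥ M.thBeta k l| ≤ C * (M.KTS k : ℝ) ^ (-M.muBeta)
  g_approx : ∃ C : ℝ, ∀ᶠ k in atTop, ∀ p ∈ M.rect,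
    |M.g p.1 p.2 - M.PTS k p.1 p.2 ⬝ᵥ M.thG k| ≤ C * (M.KTS k : ℝ) ^ (-M.muG)
  lam_approx : ∃ C : ℝ, ∀ᶠ k in atTop, ∀ p ∈ unitSq,
    |M.lam p.1 p.2 - M.PUVbar k p.1 p.2 ⬝ᵥ M.thLam k| ≤ C * (M.KUV k : ℝ) ^ (-M.muLam)

/-- Rate of the estimated control variables. -/
structure ControlCond : Prop where
  nu_pos : 0 < M.nu
  nu_le : M.nu ≤ 1 / 2
  Uhat_rate : IsBigOP M.P (fun k ω => ⨆ i, ‖M.Uhat k i ω - M.U k i ω‖ₑ) M.nNu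
  Vhat_rate : IsBigOP M.P (fun k ω => ⨆ i, ‖M.Vhat k i ω - M.V k i ω‖ₑ) M.nNu

/-- Growth restrictions on the number of series terms. -/
structure GrowthCond : Prop where
  kap4 : Tendsto (fun k => M.kap k ^ 4 / (M.n k : ℝ)) atTop (𝓝 0)
  zeta : Tendsto (fun k => M.zetaDag k * √(M.kap k) * M.nNu k) atTop (𝓝 0)
  kap4_log : Tendsto (fun k => M.kap k ^ 4 * Real.log (M.kap k) / (M.n k : ℝ)) atTop (𝓝 0)

/-- Additional conditions for the estimator of `g`. -/
structure ExtraCond : Prop where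
  density : ∃ c : ℝ, 0 < c ∧ ∀ᶠ k in atTop, ∃ f : ℝ × ℝ → ℝ≥0∞, Measurable f ∧
    M.Q k = (volume.restrict unitSq).withDensity f ∧ ∀ p ∈ unitSq, ENNReal.ofReal c ≤ f p
  eigen : ∃ c : ℝ, ∀ᶠ k in atTop, spectrum ℝ (M.gramUV k) ⊆ Iio c
  zeta : (fun k => M.zetaDag k * M.kap k * M.nNu k) =O[atTop] fun _ => (1 : ℝ)
  bias : (fun k => M.kap k ^ (3 / 2 : ℝ) * (M.bmu k + M.tauStar k + M.nNu k))
    =O[atTop] fun _ => (1 : ℝ)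

end Setup

end Spillover

end

/-! Write `e_i = ε_i - λ(U_i, V_i)`, let `A` be the feasible design matrix and `H = AᵀA + τ n D`.
Inserting the model into the estimator gives `θ̂ - θ* = H⁻¹Aᵀ(g e) + H⁻¹Aᵀ r - τ n H⁻¹ D θ*`, where
`r` collects the series approximation errors and the effect of the estimated control variables and
centring. Both stages are analysed through this identity, with one fixed random vector `dev =
H⁻¹Aᵀ(g e)` for all evaluation points.

Design. Sums of bounded functions of agents' neighbourhoods have variance `O(n)`, by the covariance
inequality for α-mixing and a count of agents in distance shells (`exists_variance_bound`). Summed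
over the `O(κ⁴)` entries, this makes the infeasible second moment matrix close to its mean in
Frobenius norm, since `κ⁴/n → 0`. Passing to the feasible rows changes each of them by `O(ζ_† √κ
n^{-ν})` plus a negligible centring term, so `AᵀA ≥ c n` with high probability
(`eventually_RegHat_lower`).

Bias. Every coordinate of `r` is `O(b_μ + n^{-ν})`, because `λ` is Lipschitz and has mean zero under
the law of `(U, V)`; `‖H⁻¹Aᵀ‖ ≤ (cn)^{-1/2}` and `‖Dθ*‖² ≤ ρ_max(D) θ*ᵀDθ*` then turn the last two
terms into `O(b_μ + n^{-ν} + τ*)` (`exists_controlled`).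

Noise. The matrix `A` depends only on `(X, Z, U)`, so conditionally on these variables `aᵀ dev` is a
weighted sum of independent centred errors. Only fourth moments are available, hence the logarithmic
rate rests on a self-normalized inequality: `E exp(∑ (w e - w²(e² + 2s)/6)) ≤ 1` with `s` the
conditional variance (`condIndep_inequalities`). It gives Gaussian tails on the event where `∑ w²(e²
+ 2s)` is small, and a Frobenius bound makes that quantity `O(‖a‖²/n)` for all `a` at once. A union
over a grid of polynomially many points and a Lipschitz step yield `sup |aᵀ dev| = O_P(√(κ ln κ /
n))` for families with `‖a‖ = O(√κ)` (`whp_dotProduct_dev_unitSq`).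

Second stage. `λ̂(u, v)` is the functional `∫P_TS ⊗ P̂_UV(u, v)`, whose norm is `O(√κ)` because
`∫P_TS` is bounded; `∫g = 1` identifies the limit. For `ĝ`, the true weight `ω` gives the functional
`P_TS(t, s) ⊗ ∫P̂_UV ω`, again of norm `O(√κ)`. Replacing `ω` by its estimate costs the sup error of
`λ̂` multiplied by the sup error of the first-stage surface, and the latter is bounded since `κ‖θ̂ -
θ*‖ = O_P(1)` (`whp_gHat`). -/

namespace Spillover

set_option linter.unusedSectionVars false

/-! ### Inequalities for the Euclidean norm. -/

section Eucl

variable {ι κ : Type*} [Fintype ι] [Fintype κ]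

lemma eucl_nonneg (v : ι → ℝ) : 0 ≤ eucl v := norm_nonneg _

lemma eucl_sq (v : ι → ℝ) : eucl v ^ 2 = ∑ i, v i ^ 2 := by
  simp [eucl, EuclideanSpace.norm_sq_eq]

lemma eucl_sq_dotProduct (v : ι → ℝ) : eucl v ^ 2 = v ⬝ᵥ v := by
  rw [eucl_sq]; simp [dotProduct, sq]

lemma abs_dotProduct_le (v w : ι → ℝ) : |v ⬝ᵥ w| ≤ eucl v * eucl w := by
  apply abs_le_of_sq_le_sq _ (mul_nonneg (eucl_nonneg _) (eucl_nonneg _))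
  rw [mul_pow, eucl_sq, eucl_sq]
  exact Finset.sum_mul_sq_le_sq_mul_sq _ _ _

lemma dotProduct_le_eucl (v w : ι → ℝ) : v ⬝ᵥ w ≤ eucl v * eucl w :=
  (le_abs_self _).trans (abs_dotProduct_le v w)

lemma eucl_add_le (v w : ι → ℝ) : eucl (v + w) ≤ eucl v + eucl w := by
  simpa [eucl] using norm_add_le (WithLp.toLp 2 v : EuclideanSpace ℝ ι) (WithLp.toLp 2 w)

lemma eucl_sub_le (v w : ι → ℝ) : eucl (v - w) ≤ eucl v + eucl w := by
  simpa [eucl] using norm_sub_le (WithLp.toLp 2 v : EuclideanSpace ℝ ι) (WithLp.toLp 2 w)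

lemma eucl_smul (c : ℝ) (v : ι → ℝ) : eucl (c • v) = |c| * eucl v := by
  simpa [eucl] using norm_smul c (WithLp.toLp 2 v : EuclideanSpace ℝ ι)

lemma eucl_zero : eucl (0 : ι → ℝ) = 0 := by
  simp [eucl]

lemma abs_apply_le_eucl (v : ι → ℝ) (i : ι) : |v i| ≤ eucl v := by
  apply abs_le_of_sq_le_sq _ (eucl_nonneg _)
  rw [eucl_sq]
  exact Finset.single_le_sum (f := fun i => v i ^ 2) (fun j _ => sq_nonneg _) (Finset.mem_univ i)

lemma eucl_le_of_abs_le {v : ι → ℝ} {C : ℝ} (hC : 0 ≤ C) (h : ∀ i, |v i| ≤ C) :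
    eucl v ≤ C * √(Fintype.card ι) := by
  apply le_of_sq_le_sq _ (by positivity)
  rw [eucl_sq, mul_pow, Real.sq_sqrt (by positivity)]
  calc ∑ i, v i ^ 2 ≤ ∑ _i : ι, C ^ 2 :=
        Finset.sum_le_sum fun i _ => sq_le_sq' (abs_le.1 (h i)).1 (abs_le.1 (h i)).2
    _ = C ^ 2 * Fintype.card ι := by simp [mul_comm]

lemma eucl_tensor (v : ι → ℝ) (w : κ → ℝ) :
    eucl (fun c : ι × κ => v c.1 * w c.2) = eucl v * eucl w := by
  refine (sq_eq_sq₀ (eucl_nonneg _) (mul_nonneg (eucl_nonneg _) (eucl_nonneg _))).1 ?_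
  rw [mul_pow, eucl_sq, eucl_sq, eucl_sq, Fintype.sum_prod_type, Finset.sum_mul_sum]
  simp [mul_pow]

lemma eucl_sumElim_sq (v : ι → ℝ) (w : κ → ℝ) :
    eucl (Sum.elim v w) ^ 2 = eucl v ^ 2 + eucl w ^ 2 := by
  simp [eucl_sq]

lemma eucl_sumElim_zero (w : κ → ℝ) : eucl (Sum.elim (0 : ι → ℝ) w) = eucl w := by
  refine (sq_eq_sq₀ (eucl_nonneg _) (eucl_nonneg _)).1 ?_
  rw [eucl_sumElim_sq, eucl_zero]; simp

lemma eucl_le_sqrt_card_mul {n : Type*} [Fintype n] {r : n → ℝ} {C : ℝ} (hC : 0 ≤ C)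
    (h : ∀ i, |r i| ≤ C) : eucl r ^ 2 ≤ Fintype.card n * C ^ 2 := by
  have := pow_le_pow_left₀ (eucl_nonneg _) (eucl_le_of_abs_le hC h) 2
  rw [mul_pow, Real.sq_sqrt (by positivity)] at this
  linarith

end Eucl

/-! ### Quadratic forms and spectra of symmetric matrices. -/

section Spectrum

variable {ι : Type*} [Fintype ι] [DecidableEq ι]

/-- Subtracting `c` shifts the spectrum into `[0, ∞)`, and a Hermitian matrix with nonnegative
eigenvalues is positive semidefinite. -/
lemma quadForm_ge_of_spectrum {G : Matrix ι ι ℝ} (hG : G.IsHermitian) {c : ℝ}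
    (h : spectrum ℝ G ⊆ Ici c) (x : ι → ℝ) : c * eucl x ^ 2 ≤ x ⬝ᵥ (G *ᵥ x) := by
  have h1 : (G - algebraMap ℝ (Matrix ι ι ℝ) c).IsHermitian := by
    refine hG.sub ?_
    rw [Algebra.algebraMap_eq_smul_one]
    simp [Matrix.IsHermitian]
  have h2 : (G - algebraMap ℝ (Matrix ι ι ℝ) c).PosSemidef := by
    rw [h1.posSemidef_iff_eigenvalues_nonneg]
    intro i
    have h3 := h1.eigenvalues_mem_spectrum_real i
    have h4 : h1.eigenvalues i + c ∈ spectrum ℝ G := by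
      rw [spectrum.mem_iff] at h3 ⊢
      convert h3 using 2
      rw [map_add]; abel
    have := h h4
    simpa using this
  have h5 := h2.dotProduct_mulVec_nonneg x
  rw [Algebra.algebraMap_eq_smul_one, Matrix.sub_mulVec, dotProduct_sub, Matrix.smul_mulVec,
    Matrix.one_mulVec, dotProduct_smul] at h5
  simp only [star_trivial, smul_eq_mul] at h5
  rw [eucl_sq_dotProduct]
  linarith

lemma quadForm_le_of_spectrum {G : Matrix ι ι ℝ} (hG : G.IsHermitian) {c : ℝ}
    (h : spectrum ℝ G ⊆ Iic c) (x : ι → ℝ) : x ⬝ᵥ (G *ᵥ x) ≤ c * eucl x ^ 2 := by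
  have h1 : spectrum ℝ (-G) ⊆ Ici (-c) := by
    intro y hy
    rw [spectrum.mem_iff] at hy
    have : -y ∈ spectrum ℝ G := by
      rw [spectrum.mem_iff]
      intro hu
      apply hy
      convert hu.neg using 1
      rw [map_neg]; abel
    have := h this
    simp only [mem_Iic, mem_Ici] at this ⊢
    linarith
  have := quadForm_ge_of_spectrum hG.neg h1 x
  rw [Matrix.neg_mulVec, dotProduct_neg] at this
  linarith

/-- The quadratic form of `D` at `x + t y` is a nonnegative quadratic polynomial in `t`, so its
discriminant is nonpositive. -/
lemma posSemidef_cauchySchwarz {D : Matrix ι ι ℝ} (hD : D.PosSemidef) (x y : ι → ℝ) :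
    (y ⬝ᵥ (D *ᵥ x)) ^ 2 ≤ (y ⬝ᵥ (D *ᵥ y)) * (x ⬝ᵥ (D *ᵥ x)) := by
  have hs : x ⬝ᵥ (D *ᵥ y) = y ⬝ᵥ (D *ᵥ x) := by
    have : Dᵀ = D := by simpa [Matrix.IsHermitian] using hD.isHermitian
    rw [Matrix.dotProduct_mulVec, ← Matrix.mulVec_transpose, this, dotProduct_comm]
  have hx : ∀ t : ℝ, 0 ≤ (y ⬝ᵥ (D *ᵥ y)) * (t * t) + (2 * (y ⬝ᵥ (D *ᵥ x))) * t
      + x ⬝ᵥ (D *ᵥ x) := by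
    intro t
    have := hD.dotProduct_mulVec_nonneg (x + t • y)
    simp only [star_trivial, Matrix.mulVec_add, Matrix.mulVec_smul, dotProduct_add,
      add_dotProduct, smul_dotProduct, dotProduct_smul, smul_eq_mul, hs] at this
    nlinarith
  have := discrim_le_zero hx
  simp only [discrim] at this
  nlinarith

/-- Cauchy–Schwarz for the form `D` with `y = Dx` gives `‖Dx‖⁴ ≤ C‖Dx‖² · xᵀDx`. This is what lets
the penalty bias be measured by `θ*ᵀDθ*` rather than by `‖θ*‖`. -/
lemma eucl_mulVec_sq_le {D : Matrix ι ι ℝ} (hD : D.PosSemidef) {C : ℝ} (hC : 0 ≤ C)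
    (h : spectrum ℝ D ⊆ Iic C) (x : ι → ℝ) :
    eucl (D *ᵥ x) ^ 2 ≤ C * (x ⬝ᵥ (D *ᵥ x)) := by
  have h1 := posSemidef_cauchySchwarz hD x (D *ᵥ x)
  have h2 := quadForm_le_of_spectrum hD.isHermitian h (D *ᵥ x)
  rw [← eucl_sq_dotProduct] at h1
  have h0 : 0 ≤ x ⬝ᵥ (D *ᵥ x) := by simpa using hD.dotProduct_mulVec_nonneg x
  rcases (sq_nonneg (eucl (D *ᵥ x))).eq_or_lt with h3 | h3
  · rw [← h3]; positivity
  · have h4 : eucl (D *ᵥ x) ^ 2 * eucl (D *ᵥ x) ^ 2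
        ≤ eucl (D *ᵥ x) ^ 2 * (C * (x ⬝ᵥ (D *ᵥ x))) := by nlinarith
    exact le_of_mul_le_mul_left h4 h3

/-- A quadratic form is bounded by the Frobenius norm of its matrix. -/
lemma abs_quadForm_le (B : Matrix ι ι ℝ) {F : ℝ} (hF : 0 ≤ F)
    (h : ∑ a, ∑ b, B a b ^ 2 ≤ F ^ 2) (x : ι → ℝ) :
    |x ⬝ᵥ (B *ᵥ x)| ≤ F * eucl x ^ 2 := by
  -- The form is the inner product of the entries of `B` with `x ⊗ x`, and `‖x ⊗ x‖ = ‖x‖²`.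
  have h1 : x ⬝ᵥ (B *ᵥ x) = (fun c : ι × ι => B c.1 c.2) ⬝ᵥ (fun c : ι × ι => x c.1 * x c.2) := by
    simp only [dotProduct, Matrix.mulVec, Finset.mul_sum, Fintype.sum_prod_type]
    exact Finset.sum_congr rfl fun a _ => Finset.sum_congr rfl fun b _ => by ring
  rw [h1]
  refine (abs_dotProduct_le _ _).trans ?_
  rw [eucl_tensor, ← sq]
  gcongr
  apply le_of_sq_le_sq _ hF
  rw [eucl_sq, Fintype.sum_prod_type]
  exact h

end Spectrum

/-! ### Norm bounds for the penalized least squares operator. -/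

section PenalizedLeastSquares

variable {ι n : Type*} [Fintype ι] [DecidableEq ι] [Fintype n]

/-- The penalized normal matrix. -/
noncomputable def penMat (A : Matrix n ι ℝ) (ρ : ℝ) (D : Matrix ι ι ℝ) : Matrix ι ι ℝ :=
  Aᵀ * A + ρ • D

variable {A : Matrix n ι ℝ} {ρ c : ℝ} {D : Matrix ι ι ℝ}

lemma penMat_transpose (hD : D.PosSemidef) : (penMat A ρ D)ᵀ = penMat A ρ D := by
  have : Dᵀ = D := by simpa [Matrix.IsHermitian] using hD.isHermitian
  simp [penMat, Matrix.transpose_mul, this]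

lemma quadForm_penMat (x : ι → ℝ) :
    x ⬝ᵥ (penMat A ρ D *ᵥ x) = eucl (A *ᵥ x) ^ 2 + ρ * (x ⬝ᵥ (D *ᵥ x)) := by
  rw [penMat, Matrix.add_mulVec, dotProduct_add, Matrix.smul_mulVec, dotProduct_smul,
    smul_eq_mul, ← Matrix.mulVec_mulVec, Matrix.dotProduct_mulVec, Matrix.vecMul_transpose,
    eucl_sq_dotProduct]

lemma eucl_mulVec_sq_le_quadForm (hD : D.PosSemidef) (hρ : 0 ≤ ρ) (x : ι → ℝ) :
    eucl (A *ᵥ x) ^ 2 ≤ x ⬝ᵥ (penMat A ρ D *ᵥ x) := by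
  have h0 : 0 ≤ x ⬝ᵥ (D *ᵥ x) := by simpa using hD.dotProduct_mulVec_nonneg x
  rw [quadForm_penMat]
  have := mul_nonneg hρ h0
  linarith

lemma isUnit_det_penMat (hD : D.PosSemidef) (hρ : 0 ≤ ρ) (hc : 0 < c)
    (h : ∀ x, c * eucl x ^ 2 ≤ eucl (A *ᵥ x) ^ 2) : IsUnit (penMat A ρ D).det := by
  rw [← Matrix.isUnit_iff_isUnit_det, ← Matrix.mulVec_injective_iff_isUnit]
  intro x y hxy
  have h1 : penMat A ρ D *ᵥ (x - y) = 0 := by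
    rw [Matrix.mulVec_sub]; exact sub_eq_zero.2 hxy
  have h2 := eucl_mulVec_sq_le_quadForm (A := A) hD hρ (x - y)
  rw [h1, dotProduct_zero] at h2
  have h3 : eucl (x - y) ^ 2 ≤ 0 := by
    have := h (x - y)
    by_contra! h'
    nlinarith
  rw [eucl_sq] at h3
  have h4 := (Finset.sum_eq_zero_iff_of_nonneg (fun i _ => sq_nonneg ((x - y) i))).1
    (le_antisymm h3 (Finset.sum_nonneg fun i _ => sq_nonneg _))
  funext i
  have := h4 i (Finset.mem_univ i)
  simpa [sub_eq_zero] using this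

lemma penMat_mulVec_inv (hD : D.PosSemidef) (hρ : 0 ≤ ρ) (hc : 0 < c)
    (h : ∀ x, c * eucl x ^ 2 ≤ eucl (A *ᵥ x) ^ 2) (y : ι → ℝ) :
    penMat A ρ D *ᵥ ((penMat A ρ D)⁻¹ *ᵥ y) = y := by
  rw [Matrix.mulVec_mulVec, Matrix.mul_nonsing_inv _ (isUnit_det_penMat hD hρ hc h),
    Matrix.one_mulVec]

lemma inv_mulVec_penMat (hD : D.PosSemidef) (hρ : 0 ≤ ρ) (hc : 0 < c)
    (h : ∀ x, c * eucl x ^ 2 ≤ eucl (A *ᵥ x) ^ 2) (y : ι → ℝ) :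
    (penMat A ρ D)⁻¹ *ᵥ (penMat A ρ D *ᵥ y) = y := by
  rw [Matrix.mulVec_mulVec, Matrix.nonsing_inv_mul _ (isUnit_det_penMat hD hρ hc h),
    Matrix.one_mulVec]

/-- With `x = H⁻¹y`, coercivity gives `c‖x‖² ≤ xᵀHx = xᵀy ≤ ‖x‖‖y‖`. The penalty is positive
semidefinite and can only help. -/
lemma eucl_inv_penMat_le (hD : D.PosSemidef) (hρ : 0 ≤ ρ) (hc : 0 < c)
    (h : ∀ x, c * eucl x ^ 2 ≤ eucl (A *ᵥ x) ^ 2) (y : ι → ℝ) :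
    eucl ((penMat A ρ D)⁻¹ *ᵥ y) ≤ eucl y / c := by
  set x := (penMat A ρ D)⁻¹ *ᵥ y with hx
  have h1 := eucl_mulVec_sq_le_quadForm (A := A) hD hρ x
  rw [hx, penMat_mulVec_inv hD hρ hc h, ← hx] at h1
  have h2 := dotProduct_le_eucl x y
  have h3 := h x
  rw [le_div_iff₀ hc]
  rcases (eucl_nonneg x).eq_or_lt with h4 | h4
  · rw [← h4, zero_mul]; exact eucl_nonneg _
  · have : eucl x * (eucl x * c) ≤ eucl x * eucl y := by nlinarith
    exact le_of_mul_le_mul_left this h4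

/-- Testing `Hx = Aᵀr` against `x` gives `‖Ax‖² ≤ (Ax)ᵀr`, hence `‖Ax‖ ≤ ‖r‖`, before coercivity is
used. The bound `c^{-1/2}` for `H⁻¹Aᵀ` thus requires no upper bound on the singular values of `A`.
-/
lemma eucl_inv_penMat_transpose_sq_le (hD : D.PosSemidef) (hρ : 0 ≤ ρ) (hc : 0 < c)
    (h : ∀ x, c * eucl x ^ 2 ≤ eucl (A *ᵥ x) ^ 2) (r : n → ℝ) :
    c * eucl ((penMat A ρ D)⁻¹ *ᵥ (Aᵀ *ᵥ r)) ^ 2 ≤ eucl r ^ 2 := by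
  set x := (penMat A ρ D)⁻¹ *ᵥ (Aᵀ *ᵥ r) with hx
  have h1 := eucl_mulVec_sq_le_quadForm (A := A) hD hρ x
  rw [hx, penMat_mulVec_inv hD hρ hc h, ← hx, Matrix.dotProduct_mulVec,
    Matrix.vecMul_transpose] at h1
  have h2 := dotProduct_le_eucl (A *ᵥ x) r
  have h3 := h x
  have h5 : eucl (A *ᵥ x) ≤ eucl r := by
    rcases (eucl_nonneg (A *ᵥ x)).eq_or_lt with h4 | h4
    · rw [← h4]; exact eucl_nonneg _
    · have : eucl (A *ᵥ x) * eucl (A *ᵥ x) ≤ eucl (A *ᵥ x) * eucl r := by nlinarith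
      exact le_of_mul_le_mul_left this h4
  exact h3.trans (pow_le_pow_left₀ (eucl_nonneg _) h5 2)

/-- The vector `AH⁻¹a` holds the weights of the disturbances in the functional `a`. Its squared norm
is at most `aᵀH⁻¹a`, because `AᵀA ≤ H`. -/
lemma eucl_mulVec_inv_sq_le (hD : D.PosSemidef) (hρ : 0 ≤ ρ) (hc : 0 < c)
    (h : ∀ x, c * eucl x ^ 2 ≤ eucl (A *ᵥ x) ^ 2) (a : ι → ℝ) :
    eucl (A *ᵥ ((penMat A ρ D)⁻¹ *ᵥ a)) ^ 2 ≤ eucl a ^ 2 / c := by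
  have h1 := eucl_mulVec_sq_le_quadForm (A := A) hD hρ ((penMat A ρ D)⁻¹ *ᵥ a)
  rw [penMat_mulVec_inv hD hρ hc h] at h1
  have h2 := dotProduct_le_eucl ((penMat A ρ D)⁻¹ *ᵥ a) a
  have h3 := eucl_inv_penMat_le hD hρ hc h a
  calc _ ≤ _ := h1.trans h2
    _ ≤ eucl a / c * eucl a := by gcongr; exact eucl_nonneg _
    _ = _ := by ring

/-- `a' H⁻¹ A' y = (A H⁻¹ a)' y`. -/
lemma dotProduct_inv_penMat (hD : D.PosSemidef) (a : ι → ℝ) (y : n → ℝ) :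
    a ⬝ᵥ ((penMat A ρ D)⁻¹ *ᵥ (Aᵀ *ᵥ y)) = (A *ᵥ ((penMat A ρ D)⁻¹ *ᵥ a)) ⬝ᵥ y := by
  have h1 : ((penMat A ρ D)⁻¹)ᵀ = (penMat A ρ D)⁻¹ := by
    rw [Matrix.transpose_nonsing_inv, penMat_transpose hD]
  rw [Matrix.dotProduct_mulVec, ← Matrix.mulVec_transpose, h1, Matrix.dotProduct_mulVec,
    Matrix.vecMul_transpose]

end PenalizedLeastSquares

end Spillover

namespace Spillover

set_option linter.unusedSectionVars false

/-! ### Exponential and moment inequalities for one law and for products of laws. -/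

section Scalar

/-- The constants `1/3` and `1/6` make the derivative of `(1 + x + x²/3) exp(-x + x²/6)` collapse to
`x³/9` times an exponential, so this function attains its minimum `1` at `0`. The inequality holds
for every real `x`, which is why no boundedness of the errors is needed later. -/
lemma exp_sub_sq_div_six_le (x : ℝ) : Real.exp (x - x ^ 2 / 6) ≤ 1 + x + x ^ 2 / 3 := by
  set f : ℝ → ℝ := fun x => (1 + x + x ^ 2 / 3) * Real.exp (-x + x ^ 2 / 6) with hf
  have hd : ∀ x, HasDerivAt f (x ^ 3 / 9 * Real.exp (-x + x ^ 2 / 6)) x := by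
    intro x
    have h1 : HasDerivAt (fun x : ℝ => 1 + x + x ^ 2 / 3) (1 + 2 * x / 3) x := by
      have := ((hasDerivAt_id x).const_add 1).add (((hasDerivAt_id x).pow 2).div_const 3)
      convert! this using 1
      simp
    have h2 : HasDerivAt (fun x : ℝ => -x + x ^ 2 / 6) (-1 + 2 * x / 6) x := by
      have := (hasDerivAt_id x).neg.add (((hasDerivAt_id x).pow 2).div_const 6)
      convert! this using 1
      simp
    convert! h1.mul h2.exp using 1
    ring
  have hcont : Continuous f := by fun_prop
  have h0 : f 0 = 1 := by simp [hf]
  have key : 1 ≤ f x := by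
    rcases le_total 0 x with hx | hx
    · have : MonotoneOn f (Ici 0) := by
        refine monotoneOn_of_deriv_nonneg (convex_Ici 0) hcont.continuousOn
          (fun y _ => (hd y).differentiableAt.differentiableWithinAt) fun y hy => ?_
        rw [(hd y).deriv]
        rw [interior_Ici] at hy
        have : (0 : ℝ) < y := hy
        positivity
      rw [← h0]; exact this self_mem_Ici hx hx
    · have : AntitoneOn f (Iic 0) := by
        refine antitoneOn_of_deriv_nonpos (convex_Iic 0) hcont.continuousOn
          (fun y _ => (hd y).differentiableAt.differentiableWithinAt) fun y hy => ?_
        rw [(hd y).deriv]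
        rw [interior_Iic] at hy
        have h3 : y < 0 := hy
        have : y ^ 3 ≤ 0 := by nlinarith [sq_nonneg y]
        exact mul_nonpos_of_nonpos_of_nonneg (by linarith) (Real.exp_pos _).le
      rw [← h0]; exact this hx self_mem_Iic hx
  have e : Real.exp (x - x ^ 2 / 6) * Real.exp (-x + x ^ 2 / 6) = 1 := by
    rw [← Real.exp_add]; simp
  have hp := Real.exp_pos (-x + x ^ 2 / 6)
  have : Real.exp (x - x ^ 2 / 6) * Real.exp (-x + x ^ 2 / 6)
      ≤ (1 + x + x ^ 2 / 3) * Real.exp (-x + x ^ 2 / 6) := by rw [e]; exact key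
  exact le_of_mul_le_mul_right this hp

end Scalar

section FourthMoment

variable {μ : Measure ℝ} [IsProbabilityMeasure μ] {C : ℝ}

lemma integrable_pow_of_fourth (h4 : Integrable (fun x : ℝ => x ^ 4) μ) {j : ℕ} (hj : j ≤ 4) :
    Integrable (fun x : ℝ => x ^ j) μ := by
  refine Integrable.mono' ((integrable_const 1).add h4) (by fun_prop) (ae_of_all _ fun x => ?_)
  rw [Real.norm_eq_abs, abs_pow]
  simp only [Pi.add_apply]
  have h : x ^ 4 = |x| ^ 4 := by rw [← abs_pow, abs_of_nonneg (by positivity)]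
  rw [h]
  rcases le_total |x| 1 with h1 | h1
  · exact (pow_le_one₀ (abs_nonneg x) h1).trans (by have : 0 ≤ |x| ^ 4 := by positivity
                                                    linarith)
  · have := pow_le_pow_right₀ h1 hj
    linarith

lemma integrable_sub_pow_of_fourth (h4 : Integrable (fun x : ℝ => x ^ 4) μ) (l : ℝ) {j : ℕ}
    (hj : j ≤ 4) : Integrable (fun x : ℝ => (x - l) ^ j) μ := by
  have h : Integrable (fun x : ℝ => 8 * (x ^ 4 + l ^ 4) + 1) μ :=
    ((h4.add (integrable_const _)).const_mul 8).add (integrable_const _)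
  refine Integrable.mono' h (by fun_prop) (ae_of_all _ fun x => ?_)
  rw [Real.norm_eq_abs, abs_pow]
  have h1 : |x - l| ^ 4 ≤ 8 * (x ^ 4 + l ^ 4) := by
    rw [← abs_pow, abs_of_nonneg (by positivity)]
    nlinarith [sq_nonneg (x + l), sq_nonneg (x ^ 2 - l ^ 2), sq_nonneg (x - l),
      mul_nonneg (sq_nonneg (x + l)) (sq_nonneg (x + l)),
      mul_nonneg (sq_nonneg (x + l)) (sq_nonneg (x - l))]
  rcases le_total |x - l| 1 with h2 | h2
  · have := pow_le_one₀ (abs_nonneg (x - l)) h2 (n := j)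
    have : 0 ≤ 8 * (x ^ 4 + l ^ 4) := by positivity
    linarith
  · have := pow_le_pow_right₀ h2 hj
    linarith

lemma integral_sq_le_of_fourth (h4 : Integrable (fun x : ℝ => x ^ 4) μ)
    (hC : ∫ x, x ^ 4 ∂μ ≤ C) : ∫ x, x ^ 2 ∂μ ≤ (1 + C) / 2 := by
  have h2 := integrable_pow_of_fourth h4 (j := 2) (by norm_num)
  have : ∫ x, x ^ 2 ∂μ ≤ ∫ x, (1 + x ^ 4) / 2 ∂μ :=
    integral_mono h2 (((integrable_const 1).add h4).div_const 2)
      fun x => by simp only; nlinarith [sq_nonneg (x ^ 2 - 1)]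
  rw [integral_div, integral_add (integrable_const 1) h4] at this
  simp at this
  linarith

lemma integral_sub_sq (h4 : Integrable (fun x : ℝ => x ^ 4) μ) :
    ∫ x, (x - ∫ y, y ∂μ) ^ 2 ∂μ = ∫ x, x ^ 2 ∂μ - (∫ x, x ∂μ) ^ 2 := by
  have h2 := integrable_pow_of_fourth h4 (j := 2) (by norm_num)
  have h1 := integrable_pow_of_fourth h4 (j := 1) (by norm_num)
  simp only [pow_one] at h1
  set l := ∫ y, y ∂μ with hl
  have : ∀ x : ℝ, (x - l) ^ 2 = x ^ 2 - (2 * l) * x + l ^ 2 := fun x => by ring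
  simp_rw [this]
  have h3 : Integrable (fun x : ℝ => 2 * l * x) μ := h1.const_mul _
  have h5 : Integrable (fun x : ℝ => x ^ 2 - 2 * l * x) μ := h2.sub h3
  rw [integral_add h5 (integrable_const _), integral_sub h2 h3, integral_const_mul, ← hl]
  simp
  ring

lemma integral_sub_pow_four_le (h4 : Integrable (fun x : ℝ => x ^ 4) μ)
    (hC : ∫ x, x ^ 4 ∂μ ≤ C) :
    ∫ x, (x - ∫ y, y ∂μ) ^ 4 ∂μ ≤ 8 * C + 2 * (1 + C) ^ 2 := by
  have hs := integral_sub_sq h4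
  have h0 : 0 ≤ ∫ x, (x - ∫ y, y ∂μ) ^ 2 ∂μ := integral_nonneg fun x => sq_nonneg _
  have h2 := integral_sq_le_of_fourth h4 hC
  have hi := integrable_sub_pow_of_fourth h4 (∫ y, y ∂μ) (j := 4) le_rfl
  set l := ∫ y, y ∂μ with hl
  -- The squared mean is at most the second moment, itself at most `(1 + C)/2`. With `(x - l)⁴ ≤
  -- 8(x⁴ + l⁴)` this produces the constant `8C + 2(1 + C)²`.
  have hl4 : l ^ 4 ≤ ((1 + C) / 2) ^ 2 := by
    have : l ^ 2 ≤ (1 + C) / 2 := by linarith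
    calc l ^ 4 = (l ^ 2) ^ 2 := by ring
      _ ≤ _ := pow_le_pow_left₀ (sq_nonneg _) this 2
  have : ∫ x, (x - l) ^ 4 ∂μ ≤ ∫ x, 8 * (x ^ 4 + l ^ 4) ∂μ :=
    integral_mono hi ((h4.add (integrable_const _)).const_mul 8)
      fun x => by
        simp only
        nlinarith [sq_nonneg (x + l), sq_nonneg (x ^ 2 - l ^ 2), sq_nonneg (x - l),
          mul_nonneg (sq_nonneg (x + l)) (sq_nonneg (x + l)),
          mul_nonneg (sq_nonneg (x + l)) (sq_nonneg (x - l))]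
  rw [integral_const_mul, integral_add h4 (integrable_const _)] at this
  simp at this
  nlinarith

/-- The scalar inequality at `t(x - l)` bounds the integrand by `(1 + t(x - l) + t²(x - l)²/3)
exp(-t²s/3)`. The linear term integrates to zero, leaving `(1 + t²s/3) exp(-t²s/3) ≤ 1`. The term
`2s` in the exponent is exactly what cancels the variance. -/
lemma lintegral_exp_selfNormalized_le (h4 : Integrable (fun x : ℝ => x ^ 4) μ) {l s : ℝ}
    (hl : ∫ x, x ∂μ = l) (hs : ∫ x, (x - l) ^ 2 ∂μ = s) (t : ℝ) :
    ∫⁻ x, ENNReal.ofReal (Real.exp (t * (x - l) - t ^ 2 / 6 * ((x - l) ^ 2 + 2 * s))) ∂μ ≤ 1 := by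
  have i1 := integrable_sub_pow_of_fourth h4 l (j := 1) (by norm_num)
  have i2 := integrable_sub_pow_of_fourth h4 l (j := 2) (by norm_num)
  have i0 := integrable_pow_of_fourth h4 (j := 1) (by norm_num)
  simp only [pow_one] at i1 i0
  have hb : ∀ x : ℝ, Real.exp (t * (x - l) - t ^ 2 / 6 * ((x - l) ^ 2 + 2 * s)) ≤
      (1 + t * (x - l) + t ^ 2 / 3 * (x - l) ^ 2) * Real.exp (-(t ^ 2 / 3 * s)) := by
    intro x
    have h1 := exp_sub_sq_div_six_le (t * (x - l))
    have : t * (x - l) - t ^ 2 / 6 * ((x - l) ^ 2 + 2 * s) =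
        (t * (x - l) - (t * (x - l)) ^ 2 / 6) + (-(t ^ 2 / 3 * s)) := by ring
    rw [this, Real.exp_add]
    gcongr
    linarith [h1, (by ring : (t * (x - l)) ^ 2 / 3 = t ^ 2 / 3 * (x - l) ^ 2)]
  have hint : Integrable (fun x : ℝ =>
      (1 + t * (x - l) + t ^ 2 / 3 * (x - l) ^ 2) * Real.exp (-(t ^ 2 / 3 * s))) μ :=
    (((integrable_const 1).add (i1.const_mul t)).add (i2.const_mul _)).mul_const _
  refine (lintegral_mono fun x => ENNReal.ofReal_le_ofReal (hb x)).trans ?_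
  rw [← ofReal_integral_eq_lintegral_ofReal hint
    (ae_of_all _ fun x => (Real.exp_pos _).le.trans (hb x)), ← ENNReal.ofReal_one]
  apply ENNReal.ofReal_le_ofReal
  have i3 : Integrable (fun x : ℝ => 1 + t * (x - l)) μ := (integrable_const 1).add (i1.const_mul t)
  rw [integral_mul_const, integral_add i3 (i2.const_mul _),
    integral_add (integrable_const 1) (i1.const_mul t), integral_const_mul, integral_const_mul,
    integral_sub i0 (integrable_const l), hs, hl]
  simp only [integral_const, probReal_univ, smul_eq_mul, one_mul, sub_self, mul_zero, add_zero]
  have := Real.add_one_le_exp (t ^ 2 / 3 * s)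
  calc (1 + t ^ 2 / 3 * s) * Real.exp (-(t ^ 2 / 3 * s))
      ≤ Real.exp (t ^ 2 / 3 * s) * Real.exp (-(t ^ 2 / 3 * s)) := by gcongr; linarith
    _ = 1 := by rw [← Real.exp_add]; simp

end FourthMoment

section ProductMeasure

variable {ι : Type*} [Fintype ι] {μ : ι → Measure ℝ} [∀ i, IsProbabilityMeasure (μ i)]

lemma lintegral_pi_prod (f : ι → ℝ → ℝ≥0∞) (hf : ∀ i, Measurable (f i)) :
    ∫⁻ y, ∏ i, f i (y i) ∂Measure.pi μ = ∏ i, ∫⁻ x, f i x ∂μ i := by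
  have hind : iIndepFun (fun i (y : ι → ℝ) => f i (y i)) (Measure.pi μ) :=
    iIndepFun_pi fun i => (hf i).aemeasurable
  rw [lintegral_prod_eq_prod_lintegral_of_indepFun Finset.univ _ hind
    fun i => (hf i).comp (measurable_pi_apply i)]
  refine Finset.prod_congr rfl fun i _ => ?_
  rw [← (measurePreserving_eval μ i).lintegral_comp (hf i)]

/-- Independent centred summands are orthogonal, so only the diagonal terms survive. -/
lemma lintegral_pi_sum_sq_le (φ : ι → ℝ → ℝ) (hφ : ∀ i, Measurable (φ i))
    (hm : ∀ i, MemLp (φ i) 2 (μ i)) (h0 : ∀ i, ∫ x, φ i x ∂μ i = 0) {B : ℝ}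
    (hB : ∀ i, ∫ x, φ i x ^ 2 ∂μ i ≤ B) (c : ι → ℝ) :
    ∫⁻ y, ENNReal.ofReal ((∑ i, c i * φ i (y i)) ^ 2) ∂Measure.pi μ
      ≤ ENNReal.ofReal (B * ∑ i, c i ^ 2) := by
  have hm' : ∀ i, MemLp (fun x => c i * φ i x) 2 (μ i) := fun i => (hm i).const_mul (c i)
  have hL : ∀ i, MemLp (fun y : ι → ℝ => c i * φ i (y i)) 2 (Measure.pi μ) := fun i =>
    (hm' i).comp_measurePreserving (measurePreserving_eval μ i)
  have hS : MemLp (fun y : ι → ℝ => ∑ i, c i * φ i (y i)) 2 (Measure.pi μ) :=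
    memLp_finsetSum _ fun i _ => hL i
  have hv := variance_sum_pi hm'
  have hmean : ∫ y, ∑ i, c i * φ i (y i) ∂Measure.pi μ = 0 := by
    rw [integral_finsetSum _ fun i _ => (hL i).integrable (by norm_num)]
    refine Finset.sum_eq_zero fun i _ => ?_
    rw [integral_const_mul]
    have h1 : ∫ y, φ i (y i) ∂Measure.pi μ = ∫ x, φ i x ∂μ i := by
      rw [← (measurePreserving_eval μ i).map_eq, integral_map (measurable_pi_apply i).aemeasurable
        (hφ i).aestronglyMeasurable]
    rw [h1, h0, mul_zero]
  have he : (∑ i, fun y : ι → ℝ => c i * φ i (y i)) = fun y => ∑ i, c i * φ i (y i) := by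
    ext y; simp
  rw [he, variance_of_integral_eq_zero hS.aestronglyMeasurable.aemeasurable hmean] at hv
  rw [← ofReal_integral_eq_lintegral_ofReal hS.integrable_sq (ae_of_all _ fun y => sq_nonneg _)]
  apply ENNReal.ofReal_le_ofReal
  rw [show (∫ y, (∑ i, c i * φ i (y i)) ^ 2 ∂Measure.pi μ) = _ from hv, Finset.mul_sum]
  refine Finset.sum_le_sum fun i _ => ?_
  rw [variance_of_integral_eq_zero (hm' i).aestronglyMeasurable.aemeasurable
    (by rw [integral_const_mul, h0, mul_zero])]
  simp_rw [mul_pow]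
  rw [integral_const_mul, mul_comm]
  exact mul_le_mul_of_nonneg_right (hB i) (sq_nonneg _)

end ProductMeasure

end Spillover

namespace Spillover

set_option linter.unusedSectionVars false

/-! ### Conditional independence as a product form of the conditional law. -/

section CondDistrib

variable {Ω β ι : Type*} [mΩ : MeasurableSpace Ω] [mβ : MeasurableSpace β] [Fintype ι]
  {P : Measure Ω} [IsProbabilityMeasure P] {X : Ω → β} {ε : ι → Ω → ℝ}

/-- The conditional law of one coordinate. -/
noncomputable def condMarg (P : Measure Ω) [IsProbabilityMeasure P] (X : Ω → β) (ε : ι → Ω → ℝ)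
    (ω : Ω) (i : ι) : Measure ℝ :=
  (condDistrib (fun ω i => ε i ω) X P (X ω)).map (Function.eval i)

instance (ω : Ω) (i : ι) : IsProbabilityMeasure (condMarg P X ε ω i) :=
  Measure.isProbabilityMeasure_map (measurable_pi_apply i).aemeasurable

/-- Rational half-lines cover the line. -/
noncomputable def spanningIicRat (μ : Measure ℝ) [IsFiniteMeasure μ] :
    μ.FiniteSpanningSetsIn (⋃ a : ℚ, {Iic (a : ℝ)}) where
  set n := Iic (((n : ℕ) : ℚ) : ℝ)
  set_mem n := by
    simp only [mem_iUnion, mem_singleton_iff]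
    exact ⟨(n : ℚ), rfl⟩
  finite n := measure_lt_top _ _
  spanning := by
    rw [eq_univ_iff_forall]
    intro x
    obtain ⟨n, hn⟩ := exists_nat_ge x
    exact mem_iUnion.2 ⟨n, by simpa using hn⟩

/-- For each fixed box of rational half-lines the product formula holds almost surely, by
conditional independence. There are countably many such boxes, so one null set serves them all, and
they form a generating π-system that determines the measure. -/
lemma condDistrib_eq_pi (hX : Measurable X) (hε : ∀ i, Measurable (ε i))
    (hind : CondIndepFamily P (mβ.comap X) ε) :
    ∀ᵐ ω ∂P, condDistrib (fun ω i => ε i ω) X P (X ω) = Measure.pi (condMarg P X ε ω) := by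
  have hY : Measurable (fun ω i => ε i ω) := measurable_pi_lambda _ hε
  have h1 : ∀ q : ι → ℚ, ∀ᵐ ω ∂P,
      (condDistrib (fun ω i => ε i ω) X P (X ω)).real (pi univ fun i => Iic (q i : ℝ)) =
      ∏ i, (condMarg P X ε ω i).real (Iic (q i : ℝ)) := by
    intro q
    have e1 := condDistrib_ae_eq_condExp (μ := P) hX hY
      (MeasurableSet.univ_pi fun i => measurableSet_Iic (a := (q i : ℝ)))
    have e2 := hind Finset.univ (fun i => Iic (q i : ℝ)) fun i => measurableSet_Iic
    have e3 : ∀ i, (fun ω => (condMarg P X ε ω i).real (Iic (q i : ℝ)))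
        =ᵐ[P] P⟦ε i ⁻¹' Iic (q i : ℝ) | mβ.comap X⟧ := by
      intro i
      have := condDistrib_ae_eq_condExp (μ := P) hX hY
        (measurable_pi_apply i (measurableSet_Iic (a := (q i : ℝ))))
      refine EventuallyEq.trans (ae_of_all _ fun ω => ?_) this
      simp only [condMarg]
      rw [map_measureReal_apply (measurable_pi_apply i) measurableSet_Iic]
    have hset : (⋂ i ∈ (Finset.univ : Finset ι), ε i ⁻¹' Iic (q i : ℝ)) =
        (fun ω i => ε i ω) ⁻¹' (pi univ fun i => Iic (q i : ℝ)) := by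
      ext ω
      simp only [Finset.mem_univ, iInter_true, mem_iInter, mem_preimage, mem_univ_pi]
    rw [hset] at e2
    filter_upwards [e1, e2, ae_all_iff.2 e3] with ω h1 h2 h3
    rw [h1, h2, Finset.prod_apply]
    exact Finset.prod_congr rfl fun i _ => (h3 i).symm
  filter_upwards [ae_all_iff.2 h1] with ω h
  symm
  refine Measure.pi_eq_generateFrom (C := fun _ => ⋃ a : ℚ, {Iic (a : ℝ)})
    (fun i => ?_) (fun i => Real.isPiSystem_Iic_rat) (fun i => spanningIicRat _) ?_
  · rw [← Real.borel_eq_generateFrom_Iic_rat]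
    exact (BorelSpace.measurable_eq (α := ℝ)).symm
  · intro s hs
    have : ∀ i, ∃ q : ℚ, s i = Iic (q : ℝ) := by
      intro i; simpa [eq_comm] using hs i
    choose q hq using this
    obtain rfl : s = fun i => Iic (q i : ℝ) := funext hq
    have h2 := h q
    simp only [measureReal_def] at h2
    rw [← ENNReal.toReal_prod] at h2
    refine (ENNReal.toReal_eq_toReal_iff' (measure_ne_top _ _) ?_).1 h2
    exact ENNReal.prod_ne_top fun i _ => measure_ne_top _ _

/-- Disintegration with the conditioning variable frozen: under the inner integral the disturbances
are genuinely independent, so inequalities for product measures apply pointwise in `ω`. -/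
lemma lintegral_condDistrib (hX : Measurable X) (hε : ∀ i, Measurable (ε i))
    (hind : CondIndepFamily P (mβ.comap X) ε) {H : β → (ι → ℝ) → ℝ≥0∞}
    (hH : Measurable (Function.uncurry H)) :
    ∫⁻ ω, H (X ω) (fun i => ε i ω) ∂P =
      ∫⁻ ω, ∫⁻ y, H (X ω) y ∂Measure.pi (condMarg P X ε ω) ∂P := by
  have hY : Measurable (fun ω i => ε i ω) := measurable_pi_lambda _ hε
  have h1 := compProd_map_condDistrib (mβ := mβ) (X := X) hY.aemeasurable (μ := P)
  have h2 : ∫⁻ ω, H (X ω) (fun i => ε i ω) ∂P =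
      ∫⁻ p, Function.uncurry H p ∂(P.map fun ω => (X ω, fun i => ε i ω)) := by
    rw [lintegral_map hH (hX.prodMk hY)]; rfl
  rw [h2, ← h1, Measure.lintegral_compProd hH, lintegral_map hH.lintegral_kernel_prod_right' hX]
  refine lintegral_congr_ae ?_
  filter_upwards [condDistrib_eq_pi hX hε hind] with ω h
  rw [h]; rfl

lemma integrable_condMarg (hX : Measurable X) (hε : ∀ i, Measurable (ε i)) (i : ι) {f : ℝ → ℝ}
    (hf : Measurable f) (hi : Integrable (fun ω => f (ε i ω)) P) :
    ∀ᵐ ω ∂P, Integrable f (condMarg P X ε ω i) := by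
  have hY : Measurable (fun ω i => ε i ω) := measurable_pi_lambda _ hε
  have h1 : Integrable (fun p : β × (ι → ℝ) => f (p.2 i)) (P.map fun ω => (X ω, fun i => ε i ω)) := by
    have hm : Measurable (fun p : β × (ι → ℝ) => f (p.2 i)) :=
      hf.comp ((measurable_pi_apply i).comp measurable_snd)
    rw [integrable_map_measure hm.aestronglyMeasurable (hX.prodMk hY).aemeasurable]
    exact hi
  filter_upwards [h1.condDistrib_ae hX.aemeasurable hY.aemeasurable] with ω h
  rw [condMarg, integrable_map_measure hf.aestronglyMeasurable (measurable_pi_apply i).aemeasurable]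
  exact h

lemma condExp_eq_integral_condMarg (hX : Measurable X) (hε : ∀ i, Measurable (ε i)) (i : ι)
    {f : ℝ → ℝ} (hf : Measurable f) (hi : Integrable (fun ω => f (ε i ω)) P) :
    P[fun ω => f (ε i ω) | mβ.comap X] =ᵐ[P] fun ω => ∫ x, f x ∂condMarg P X ε ω i := by
  have hY : Measurable (fun ω i => ε i ω) := measurable_pi_lambda _ hε
  have h1 := condExp_ae_eq_integral_condDistrib (μ := P) hX hY.aemeasurable
    (f := fun y : ι → ℝ => f (y i)) (by fun_prop) hi
  refine h1.trans (ae_of_all _ fun ω => ?_)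
  simp only [condMarg]
  rw [integral_map (measurable_pi_apply i).aemeasurable hf.aestronglyMeasurable]

end CondDistrib

section CondIndep

variable {Ω ι : Type*} [Fintype ι]

/-- The second moment bounds and the self-normalized exponential inequality for conditionally
independent disturbances with bounded conditional fourth moments. -/
theorem condIndep_inequalities {m mΩ : MeasurableSpace Ω} (hm : m ≤ mΩ) {P : Measure Ω}
    [IsProbabilityMeasure P] {ε : ι → Ω → ℝ} (hε : ∀ i, Measurable (ε i))
    (hind : CondIndepFamily P m ε) {l : ι → Ω → ℝ} (hl : ∀ i, Measurable[m] (l i))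
    (hmean : ∀ i, P[ε i | m] =ᵐ[P] l i)
    (h4 : ∀ i, Integrable (fun ω => ε i ω ^ 4) P) {C : ℝ} (hC0 : 0 ≤ C)
    (hC : ∀ i, P[fun ω => ε i ω ^ 4 | m] ≤ᵐ[P] fun _ => C) :
    ∃ s : ι → Ω → ℝ, (∀ i, Measurable[m] (s i)) ∧ (∀ i ω, 0 ≤ s i ω ∧ s i ω ≤ (1 + C) / 2) ∧
      (∀ w : ι → Ω → ℝ, (∀ i, Measurable[m] (w i)) →
        ∫⁻ ω, ENNReal.ofReal (Real.exp (∑ i, (w i ω * (ε i ω - l i ω) -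
          w i ω ^ 2 / 6 * ((ε i ω - l i ω) ^ 2 + 2 * s i ω)))) ∂P ≤ 1) ∧
      (∀ c : ι → Ω → ℝ, (∀ i, Measurable[m] (c i)) →
        ∫⁻ ω, ENNReal.ofReal ((∑ i, c i ω * (ε i ω - l i ω)) ^ 2) ∂P ≤
          ∫⁻ ω, ENNReal.ofReal ((8 * C + 2 * (1 + C) ^ 2) * ∑ i, c i ω ^ 2) ∂P) ∧
      (∀ c : ι → Ω → ℝ, (∀ i, Measurable[m] (c i)) →
        ∫⁻ ω, ENNReal.ofReal ((∑ i, c i ω * ((ε i ω - l i ω) ^ 2 - s i ω)) ^ 2) ∂P ≤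
          ∫⁻ ω, ENNReal.ofReal ((8 * C + 2 * (1 + C) ^ 2) * ∑ i, c i ω ^ 2) ∂P) := by
  -- The σ-algebra `m` is generated by the identity viewed as a map into `(Ω, m)`, so conditioning
  -- on `m` becomes conditioning on a random variable.
  have hcomap : m.comap (id : Ω → Ω) = m := MeasurableSpace.comap_id
  have hid : @Measurable Ω Ω mΩ m id := measurable_id'' hm
  set K : Ω → ι → Measure ℝ := @condMarg Ω Ω ι mΩ m _ P _ id ε with hK
  have hKp : ∀ ω i, IsProbabilityMeasure (K ω i) := fun ω i => by rw [hK]; infer_instance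
  have hind' : CondIndepFamily P (m.comap (id : Ω → Ω)) ε := by rwa [hcomap]
  have hdis : ∀ H : Ω → (ι → ℝ) → ℝ≥0∞,
      Measurable[m.prod inferInstance] (Function.uncurry H) →
      ∫⁻ ω, H ω (fun i => ε i ω) ∂P = ∫⁻ ω, ∫⁻ y, H ω y ∂Measure.pi (K ω) ∂P := fun H hH =>
    @lintegral_condDistrib Ω Ω ι mΩ m _ P _ id ε hid hε hind' H hH
  have K4 : ∀ᵐ ω ∂P, ∀ i, Integrable (fun x : ℝ => x ^ 4) (K ω i) := ae_all_iff.2 fun i =>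
    @integrable_condMarg Ω Ω ι mΩ m _ P _ id ε hid hε i (fun x => x ^ 4) (by fun_prop) (h4 i)
  have hpow : ∀ i (j : ℕ), j ≤ 4 → Integrable (fun ω => ε i ω ^ j) P := by
    intro i j hj
    have h4' : Integrable (fun x : ℝ => x ^ 4) (P.map (ε i)) := by
      rw [integrable_map_measure (by fun_prop) (hε i).aemeasurable]; exact h4 i
    have : IsProbabilityMeasure (P.map (ε i)) := Measure.isProbabilityMeasure_map (hε i).aemeasurable
    have := integrable_pow_of_fourth h4' hj
    rwa [integrable_map_measure (by fun_prop) (hε i).aemeasurable] at this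
  have hce : ∀ i (j : ℕ), j ≤ 4 →
      P[fun ω => ε i ω ^ j | m] =ᵐ[P] fun ω => ∫ x, x ^ j ∂K ω i := by
    intro i j hj
    have := @condExp_eq_integral_condMarg Ω Ω ι mΩ m _ P _ id ε hid hε i (fun x => x ^ j)
      (by fun_prop) (hpow i j hj)
    rwa [hcomap] at this
  have K1 : ∀ᵐ ω ∂P, ∀ i, ∫ x, x ∂K ω i = l i ω := ae_all_iff.2 fun i => by
    have h1 := hce i 1 (by norm_num)
    simp only [pow_one] at h1
    filter_upwards [h1, hmean i] with ω a b
    rw [← a]; exact b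
  have K4b : ∀ᵐ ω ∂P, ∀ i, ∫ x, x ^ 4 ∂K ω i ≤ C := ae_all_iff.2 fun i => by
    filter_upwards [hce i 4 le_rfl, hC i] with ω a b
    rw [← a]; exact b
  -- A version of the conditional variance, truncated so that its bounds hold at every `ω` while it
  -- stays `m`-measurable. The truncation is inactive almost surely.
  set s : ι → Ω → ℝ := fun i ω =>
    max 0 (min ((1 + C) / 2) ((P[fun ω => ε i ω ^ 2 | m]) ω - l i ω ^ 2)) with hs
  have K2 : ∀ᵐ ω ∂P, ∀ i, ∫ x, (x - l i ω) ^ 2 ∂K ω i = s i ω := by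
    have h2 : ∀ᵐ ω ∂P, ∀ i, (P[fun ω => ε i ω ^ 2 | m]) ω = ∫ x, x ^ 2 ∂K ω i :=
      ae_all_iff.2 fun i => hce i 2 (by norm_num)
    filter_upwards [h2, K1, K4, K4b] with ω h2 h1 h4 hb i
    have e := integral_sub_sq (h4 i)
    have e2 := integral_sq_le_of_fourth (h4 i) (hb i)
    have e0 : 0 ≤ ∫ x, (x - ∫ y, y ∂K ω i) ^ 2 ∂K ω i := integral_nonneg fun x => sq_nonneg _
    rw [h1 i] at e e0
    simp only [hs]
    rw [h2 i, ← e, min_eq_right (by nlinarith [sq_nonneg (l i ω)]), max_eq_right e0]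
  have hsm : ∀ i, Measurable[m] (s i) := fun i =>
    (measurable_const).max (measurable_const.min
      (stronglyMeasurable_condExp.measurable.sub ((hl i).pow_const 2)))
  have mc : ∀ f : Ω → ℝ, Measurable[m] f →
      Measurable[m.prod (inferInstance : MeasurableSpace (ι → ℝ))] (fun p : Ω × (ι → ℝ) => f p.1) :=
    fun f hf => hf.comp (@measurable_fst Ω (ι → ℝ) m _)
  have my : ∀ i, Measurable[m.prod (inferInstance : MeasurableSpace (ι → ℝ))]
      (fun p : Ω × (ι → ℝ) => p.2 i) :=
    fun i => (measurable_pi_apply i).comp (@measurable_snd Ω (ι → ℝ) m _)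
  have hS0 : ∀ i ω, 0 ≤ s i ω ∧ s i ω ≤ (1 + C) / 2 := fun i ω =>
    ⟨le_max_left _ _, max_le (by linarith) (min_le_left _ _)⟩
  refine ⟨s, hsm, hS0, ?_, ?_, ?_⟩
  · intro w hw
    rw [hdis (fun ω y => ENNReal.ofReal (Real.exp (∑ i, (w i ω * (y i - l i ω) -
          w i ω ^ 2 / 6 * ((y i - l i ω) ^ 2 + 2 * s i ω)))))]
    · calc _ ≤ ∫⁻ _ω, (1 : ℝ≥0∞) ∂P := by
            refine lintegral_mono_ae ?_
            filter_upwards [K1, K2, K4] with ω h1 h2 h4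
            simp_rw [Real.exp_sum]
            have : ∀ y : ι → ℝ, ENNReal.ofReal (∏ i, Real.exp (w i ω * (y i - l i ω) -
                w i ω ^ 2 / 6 * ((y i - l i ω) ^ 2 + 2 * s i ω))) =
                ∏ i, ENNReal.ofReal (Real.exp (w i ω * (y i - l i ω) -
                w i ω ^ 2 / 6 * ((y i - l i ω) ^ 2 + 2 * s i ω))) := fun y =>
              ENNReal.ofReal_prod_of_nonneg fun i _ => (Real.exp_pos _).le
            simp_rw [this]
            rw [lintegral_pi_prod (fun i x => ENNReal.ofReal (Real.exp (w i ω * (x - l i ω) -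
                w i ω ^ 2 / 6 * ((x - l i ω) ^ 2 + 2 * s i ω)))) (fun i => by fun_prop)]
            exact Finset.prod_le_one' fun i _ =>
              lintegral_exp_selfNormalized_le (h4 i) (h1 i) (h2 i) (w i ω)
        _ = 1 := by simp
    · refine ENNReal.measurable_ofReal.comp (Real.measurable_exp.comp ?_)
      refine Finset.measurable_sum _ fun i _ => ?_
      have a1 := mc _ (hw i)
      have a2 := mc _ (hl i)
      have a3 := mc _ (hsm i)
      have a4 := my i
      exact (a1.mul (a4.sub a2)).sub (((a1.pow_const 2).div_const 6).mul
        (((a4.sub a2).pow_const 2).add (a3.const_mul 2)))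
  · intro c hc
    rw [hdis (fun ω y => ENNReal.ofReal ((∑ i, c i ω * (y i - l i ω)) ^ 2))]
    · refine lintegral_mono_ae ?_
      filter_upwards [K1, K2, K4] with ω h1 h2 h4
      refine lintegral_pi_sum_sq_le (fun i x => x - l i ω) (fun i => by fun_prop) (fun i => ?_)
        (fun i => ?_) (fun i => ?_) (fun i => c i ω)
      · exact (memLp_two_iff_integrable_sq (by fun_prop)).2
          (integrable_sub_pow_of_fourth (h4 i) _ (by norm_num))
      · have := integrable_pow_of_fourth (h4 i) (j := 1) (by norm_num)
        simp only [pow_one] at this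
        rw [integral_sub this (integrable_const _), h1 i]
        simp
      · rw [h2 i]
        refine (hS0 i ω).2.trans ?_
        nlinarith
    · refine ENNReal.measurable_ofReal.comp (Measurable.pow_const ?_ 2)
      exact Finset.measurable_sum _ fun i _ => (mc _ (hc i)).mul ((my i).sub (mc _ (hl i)))
  · intro c hc
    rw [hdis (fun ω y => ENNReal.ofReal ((∑ i, c i ω * ((y i - l i ω) ^ 2 - s i ω)) ^ 2))]
    · refine lintegral_mono_ae ?_
      filter_upwards [K1, K2, K4, K4b] with ω h1 h2 h4 hb
      have i2 : ∀ i, Integrable (fun x : ℝ => (x - l i ω) ^ 2) (K ω i) := fun i =>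
        integrable_sub_pow_of_fourth (h4 i) _ (by norm_num)
      have i4 : ∀ i, Integrable (fun x : ℝ => (x - l i ω) ^ 4) (K ω i) := fun i =>
        integrable_sub_pow_of_fourth (h4 i) _ (by norm_num)
      have i5 : ∀ i, Integrable (fun x : ℝ => ((x - l i ω) ^ 2 - s i ω) ^ 2) (K ω i) := fun i => by
        have : Integrable (fun x : ℝ => (x - l i ω) ^ 4 - 2 * s i ω * (x - l i ω) ^ 2 + s i ω ^ 2)
          (K ω i) := ((i4 i).sub ((i2 i).const_mul _)).add (integrable_const _)
        refine this.congr (ae_of_all _ fun x => ?_)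
        simp only; ring
      refine lintegral_pi_sum_sq_le (fun i x => (x - l i ω) ^ 2 - s i ω) (fun i => by fun_prop)
        (fun i => ?_) (fun i => ?_) (fun i => ?_) (fun i => c i ω)
      · exact (memLp_two_iff_integrable_sq (by fun_prop)).2 (i5 i)
      · rw [integral_sub (i2 i) (integrable_const _), h2 i]
        simp
      · have e := integral_sub_pow_four_le (h4 i) (hb i)
        rw [h1 i] at e
        -- The variance of `(x - l)²` is `E(x - l)⁴ - s²`, hence at most the fourth central moment.
        refine le_trans ?_ e
        have i6 : Integrable (fun x : ℝ => 2 * s i ω * (x - l i ω) ^ 2) (K ω i) := (i2 i).const_mul _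
        have i7 : Integrable (fun x : ℝ => (x - l i ω) ^ 4 - 2 * s i ω * (x - l i ω) ^ 2) (K ω i) :=
          (i4 i).sub i6
        have : ∀ x : ℝ, ((x - l i ω) ^ 2 - s i ω) ^ 2 =
          (x - l i ω) ^ 4 - 2 * s i ω * (x - l i ω) ^ 2 + s i ω ^ 2 := fun x => by ring
        simp_rw [this]
        rw [integral_add i7 (integrable_const _), integral_sub (i4 i) i6, integral_const_mul, h2 i]
        simp
        nlinarith [sq_nonneg (s i ω)]
    · refine ENNReal.measurable_ofReal.comp (Measurable.pow_const ?_ 2)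
      exact Finset.measurable_sum _ fun i _ => (mc _ (hc i)).mul
        ((((my i).sub (mc _ (hl i))).pow_const 2).sub (mc _ (hsm i)))

end CondIndep

end Spillover

namespace Spillover

set_option linter.unusedSectionVars false

/-! ### The covariance inequality under α-mixing. -/

section Covariance

variable {Ω : Type*}

/-- The `±1`-valued function that is `1` exactly on `A`. -/
noncomputable def signOn (A : Set Ω) (ω : Ω) : ℝ := 2 * A.indicator 1 ω - 1

lemma abs_signOn (A : Set Ω) (ω : Ω) : |signOn A ω| = 1 := by
  by_cases h : ω ∈ A <;> norm_num [signOn, h]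

lemma measurable_signOn {m : MeasurableSpace Ω} {A : Set Ω} (hA : MeasurableSet A) :
    Measurable (signOn A) :=
  ((measurable_one.indicator hA).const_mul 2).sub_const 1

/-- With `η = E[Y | m] - E Y`, the covariance of an `m`-measurable `X` with `Y` equals `E[X η]`,
which is at most `C E|η|`. The last expectation is the covariance of `Y` with the sign of `η`, so
`X` may be replaced by a sign. -/
lemma exists_signOn_cov {m mΩ : MeasurableSpace Ω} (hm : m ≤ mΩ) {P : Measure Ω}
    [IsProbabilityMeasure P] {X Y : Ω → ℝ} (hX : Measurable[m] X) {C : ℝ}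
    (hXC : ∀ᵐ ω ∂P, |X ω| ≤ C) (hY : Integrable Y P) :
    ∃ A, MeasurableSet[m] A ∧ |∫ ω, X ω * Y ω ∂P - (∫ ω, X ω ∂P) * ∫ ω, Y ω ∂P| ≤
      C * |∫ ω, signOn A ω * Y ω ∂P - (∫ ω, signOn A ω ∂P) * ∫ ω, Y ω ∂P| := by
  have key : ∀ Z : Ω → ℝ, Measurable[m] Z → ∀ D : ℝ, (∀ᵐ ω ∂P, |Z ω| ≤ D) →
      Integrable (fun ω => Z ω * ((P[Y | m]) ω - ∫ ω, Y ω ∂P)) P ∧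
      ∫ ω, Z ω * Y ω ∂P - (∫ ω, Z ω ∂P) * ∫ ω, Y ω ∂P =
        ∫ ω, Z ω * ((P[Y | m]) ω - ∫ ω, Y ω ∂P) ∂P := by
    intro Z hZ D hD
    have hZm : AEStronglyMeasurable Z P := (hZ.mono hm le_rfl).aestronglyMeasurable
    have hZi : Integrable Z P := Integrable.of_bound hZm D (by simpa using hD)
    have hZY : Integrable (fun ω => Z ω * Y ω) P := hY.bdd_mul hZm (by simpa using hD)
    have hZc : Integrable (fun ω => Z ω * (P[Y | m]) ω) P :=
      integrable_condExp.bdd_mul hZm (by simpa using hD)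
    have h1 := condExp_mul_of_stronglyMeasurable_left (μ := P) (m := m) (f := Z) (g := Y)
      hZ.stronglyMeasurable hZY hY
    have h2 : ∫ ω, Z ω * Y ω ∂P = ∫ ω, Z ω * (P[Y | m]) ω ∂P := by
      rw [← integral_condExp hm (f := fun ω => Z ω * Y ω)]
      exact integral_congr_ae h1
    have h3 : ∀ ω, Z ω * ((P[Y | m]) ω - ∫ ω, Y ω ∂P) =
      Z ω * (P[Y | m]) ω - Z ω * ∫ ω, Y ω ∂P := fun ω => by ring
    simp_rw [h3]
    refine ⟨hZc.sub (hZi.mul_const _), ?_⟩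
    rw [integral_sub hZc (hZi.mul_const _), integral_mul_const, h2]
  set η : Ω → ℝ := fun ω => (P[Y | m]) ω - ∫ ω, Y ω ∂P with hη
  have hηm : Measurable[m] η := stronglyMeasurable_condExp.measurable.sub measurable_const
  set A : Set Ω := {ω | 0 ≤ η ω} with hA
  have hAm : MeasurableSet[m] A := measurableSet_le measurable_const hηm
  refine ⟨A, hAm, ?_⟩
  obtain ⟨i1, e1⟩ := key X hX C hXC
  obtain ⟨i2, e2⟩ := key (signOn A) (measurable_signOn hAm) 1
    (ae_of_all _ fun ω => (abs_signOn A ω).le)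
  rw [e1, e2]
  have h4 : ∀ ω, signOn A ω * η ω = |η ω| := by
    intro ω
    by_cases h : 0 ≤ η ω
    · have : ω ∈ A := h
      rw [abs_of_nonneg h]; simp [signOn, this]; ring
    · have : ω ∉ A := h
      rw [abs_of_neg (not_le.1 h)]; simp [signOn, this]
  have i3 : Integrable (fun ω => |η ω|) P := i2.congr (ae_of_all _ h4)
  have h5 : ∫ ω, signOn A ω * η ω ∂P = ∫ ω, |η ω| ∂P := integral_congr_ae (ae_of_all _ h4)
  rw [h5, abs_of_nonneg (a := ∫ ω, |η ω| ∂P) (integral_nonneg fun ω => abs_nonneg _),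
    ← integral_const_mul]
  refine (abs_integral_le_integral_abs).trans (integral_mono_ae i1.abs (i3.const_mul C) ?_)
  filter_upwards [hXC] with ω h
  rw [abs_mul]
  exact mul_le_mul_of_nonneg_right h (abs_nonneg _)

/-- Covariance inequality for bounded random variables. -/
lemma abs_cov_le {m₁ m₂ mΩ : MeasurableSpace Ω} (h₁ : m₁ ≤ mΩ) (h₂ : m₂ ≤ mΩ) {P : Measure Ω}
    [IsProbabilityMeasure P] {X Y : Ω → ℝ} (hX : Measurable[m₁] X) (hY : Measurable[m₂] Y)
    {C α : ℝ} (hC : 0 ≤ C) (hXC : ∀ᵐ ω ∂P, |X ω| ≤ C) (hYC : ∀ᵐ ω ∂P, |Y ω| ≤ C)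
    (hα : ∀ A B, MeasurableSet[m₁] A → MeasurableSet[m₂] B →
      |P.real (A ∩ B) - P.real A * P.real B| ≤ α) :
    |∫ ω, X ω * Y ω ∂P - (∫ ω, X ω ∂P) * ∫ ω, Y ω ∂P| ≤ 4 * C ^ 2 * α := by
  have hYi : Integrable Y P :=
    Integrable.of_bound (hY.mono h₂ le_rfl).aestronglyMeasurable C (by simpa using hYC)
  -- First `X` is replaced by a sign, then `Y` by a sign with the roles exchanged. The covariance of
  -- two `±1` indicators is `4(P(A ∩ B) - P(A)P(B))`, which explains the factor `4C²`.
  obtain ⟨A, hA, eA⟩ := exists_signOn_cov h₁ hX hXC hYi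
  have hAm := h₁ _ hA
  have hAi : Integrable (signOn A) P := Integrable.of_bound
    (measurable_signOn hAm).aestronglyMeasurable 1 (by simp [abs_signOn])
  obtain ⟨B, hB, eB⟩ := exists_signOn_cov h₂ hY hYC hAi
  have hBm := h₂ _ hB
  have hind : ∀ s : Set Ω, MeasurableSet s → Integrable (s.indicator (1 : Ω → ℝ)) P := fun s hs =>
    (integrable_const 1).indicator hs
  have hint : ∀ s : Set Ω, MeasurableSet s → ∫ ω, s.indicator (1 : Ω → ℝ) ω ∂P = P.real s :=
    fun s hs => integral_indicator_one hs
  have hsgn : ∀ s : Set Ω, MeasurableSet s → ∫ ω, signOn s ω ∂P = 2 * P.real s - 1 := by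
    intro s hs
    simp only [signOn]
    rw [integral_sub ((hind s hs).const_mul 2) (integrable_const 1), integral_const_mul, hint s hs]
    simp
  have hprod : ∫ ω, signOn B ω * signOn A ω ∂P =
      4 * P.real (A ∩ B) - 2 * P.real A - 2 * P.real B + 1 := by
    have : ∀ ω, signOn B ω * signOn A ω = 4 * (A ∩ B).indicator (1 : Ω → ℝ) ω -
        2 * A.indicator (1 : Ω → ℝ) ω - 2 * B.indicator (1 : Ω → ℝ) ω + 1 := by
      intro ω
      by_cases ha : ω ∈ A <;> by_cases hb : ω ∈ B <;> norm_num [signOn, ha, hb]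
    simp_rw [this]
    have i1 := (hind _ (hAm.inter hBm)).const_mul 4
    have i2 := (hind _ hAm).const_mul 2
    have i3 := (hind _ hBm).const_mul 2
    have i4 : Integrable (fun ω => 4 * (A ∩ B).indicator (1 : Ω → ℝ) ω -
        2 * A.indicator (1 : Ω → ℝ) ω) P := i1.sub i2
    have i5 : Integrable (fun ω => 4 * (A ∩ B).indicator (1 : Ω → ℝ) ω -
        2 * A.indicator (1 : Ω → ℝ) ω - 2 * B.indicator (1 : Ω → ℝ) ω) P := i4.sub i3
    rw [integral_add i5 (integrable_const _), integral_sub i4 i3, integral_sub i1 i2,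
      integral_const_mul, integral_const_mul, integral_const_mul, hint _ hAm, hint _ hBm,
      hint _ (hAm.inter hBm)]
    simp
  rw [hprod, hsgn A hAm, hsgn B hBm] at eB
  have e3 : 4 * P.real (A ∩ B) - 2 * P.real A - 2 * P.real B + 1 -
      (2 * P.real B - 1) * (2 * P.real A - 1) = 4 * (P.real (A ∩ B) - P.real A * P.real B) := by
    ring
  rw [e3, abs_mul, abs_of_pos (by norm_num : (0 : ℝ) < 4)] at eB
  have e4 : |∫ ω, signOn A ω * Y ω ∂P - (∫ ω, signOn A ω ∂P) * ∫ ω, Y ω ∂P| ≤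
      C * (4 * |P.real (A ∩ B) - P.real A * P.real B|) := by
    have : ∫ ω, signOn A ω * Y ω ∂P = ∫ ω, Y ω * signOn A ω ∂P := by simp_rw [mul_comm]
    rw [this, mul_comm (∫ ω, signOn A ω ∂P), hsgn A hAm]
    exact eB
  calc _ ≤ _ := eA
    _ ≤ C * (C * (4 * |P.real (A ∩ B) - P.real A * P.real B|)) :=
        mul_le_mul_of_nonneg_left e4 hC
    _ ≤ C * (C * (4 * α)) := by gcongr; exact hα A B hA hB
    _ = 4 * C ^ 2 * α := by ring

end Covariance

/-! ### Counting separated points in balls and shells. -/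

section Packing

variable {d : ℕ} {ι : Type*}

lemma volume_real_ball (p : EuclideanSpace ℝ (Fin d)) {r : ℝ} (hr : 0 < r) :
    volume.real (Metric.ball p r) =
      r ^ d * volume.real (Metric.ball (0 : EuclideanSpace ℝ (Fin d)) 1) := by
  rw [measureReal_def, Measure.addHaar_ball_of_pos _ _ hr, ENNReal.toReal_mul,
    ENNReal.toReal_ofReal (by positivity), finrank_euclideanSpace, Fintype.card_fin]
  rfl

/-- Balls of radius `1/2` around `1`-separated points are disjoint, so their volumes add up inside
`T`. -/
lemma card_mul_volume_ball_le {s : Finset ι} {x : ι → EuclideanSpace ℝ (Fin d)}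
    (hx : ∀ i ∈ s, ∀ j ∈ s, i ≠ j → 1 ≤ dist (x i) (x j)) {T : Set (EuclideanSpace ℝ (Fin d))}
    (hT : volume T ≠ ∞) (hsub : ∀ i ∈ s, Metric.ball (x i) (1 / 2) ⊆ T) :
    (s.card : ℝ) * ((1 / 2) ^ d * volume.real (Metric.ball (0 : EuclideanSpace ℝ (Fin d)) 1)) ≤
      volume.real T := by
  have h1 : volume.real (⋃ i ∈ s, Metric.ball (x i) (1 / 2)) =
      ∑ i ∈ s, volume.real (Metric.ball (x i) (1 / 2)) := by
    refine measureReal_biUnion_finset (fun i hi j hj hij => ?_) (fun i _ => measurableSet_ball)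
      (fun i _ => measure_ball_lt_top.ne)
    refine Metric.ball_disjoint_ball ?_
    have := hx i hi j hj hij
    linarith
  have h2 : ∀ i ∈ s, volume.real (Metric.ball (x i) (1 / 2)) =
      (1 / 2) ^ d * volume.real (Metric.ball (0 : EuclideanSpace ℝ (Fin d)) 1) := by
    intro i _
    exact volume_real_ball _ (by norm_num)
  rw [Finset.sum_congr rfl h2, Finset.sum_const, nsmul_eq_mul] at h1
  rw [← h1]
  exact measureReal_mono (iUnion₂_subset hsub) hT

lemma volume_real_ball_pos :
    0 < volume.real (Metric.ball (0 : EuclideanSpace ℝ (Fin d)) 1) :=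
  ENNReal.toReal_pos (Metric.measure_ball_pos _ _ one_pos).ne' measure_ball_lt_top.ne

lemma card_le_of_dist_le {s : Finset ι} {x : ι → EuclideanSpace ℝ (Fin d)}
    (hx : ∀ i ∈ s, ∀ j ∈ s, i ≠ j → 1 ≤ dist (x i) (x j)) (p : EuclideanSpace ℝ (Fin d))
    {R : ℝ} (hR : 0 ≤ R) (h : ∀ i ∈ s, dist (x i) p ≤ R) : (s.card : ℝ) ≤ (2 * R + 1) ^ d := by
  have h1 := card_mul_volume_ball_le hx (T := Metric.ball p (R + 1 / 2)) measure_ball_lt_top.ne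
    (fun i hi => Metric.ball_subset_ball' (by have := h i hi; linarith))
  rw [volume_real_ball _ (by linarith : 0 < R + 1 / 2), ← mul_assoc] at h1
  have h2 := le_of_mul_le_mul_right h1 volume_real_ball_pos
  have h3 : (2 * R + 1) ^ d = 2 ^ d * (R + 1 / 2) ^ d := by rw [← mul_pow]; ring
  rw [h3]
  have h4 : (2 : ℝ) ^ d * (1 / 2) ^ d = 1 := by rw [← mul_pow]; norm_num
  calc (s.card : ℝ) = 2 ^ d * (s.card * (1 / 2) ^ d) := by linear_combination (-(s.card : ℝ)) * h4
    _ ≤ _ := by gcongr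

/-- A shell of unit width and radius `R` contains at most a multiple of `R ^ (d - 1)` points of a
`1`-separated set. -/
lemma card_shell_le {s : Finset ι} {x : ι → EuclideanSpace ℝ (Fin d)}
    (hx : ∀ i ∈ s, ∀ j ∈ s, i ≠ j → 1 ≤ dist (x i) (x j)) (p : EuclideanSpace ℝ (Fin d))
    {R : ℝ} (hR : 1 ≤ R) (h : ∀ i ∈ s, R ≤ dist (x i) p ∧ dist (x i) p < R + 1) :
    (s.card : ℝ) ≤ (2 * d * 5 ^ d) * R ^ ((d : ℝ) - 1) := by
  -- In dimension zero all points coincide, so none lies at distance at least `1` from `p`. The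
  -- exponent `d - 1` could not be treated as a natural number there.
  rcases Nat.eq_zero_or_pos d with rfl | hd
  · rcases s.eq_empty_or_nonempty with rfl | ⟨i, hi⟩
    · simp
    · have := (h i hi).1
      rw [Subsingleton.elim (x i) p, dist_self] at this
      linarith
  -- The half-unit balls fit in the shell thickened by `1/2` on both sides. Its volume is a
  -- difference of two `d`-th powers with bases at distance `2`, both at most `5R/2` as `R ≥ 1`.
  set T := Metric.ball p (R + 3 / 2) \ Metric.ball p (R - 1 / 2) with hTd
  have hsub : ∀ i ∈ s, Metric.ball (x i) (1 / 2) ⊆ T := by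
    intro i hi y hy
    obtain ⟨h1, h2⟩ := h i hi
    rw [Metric.mem_ball] at hy
    have t1 := dist_triangle y (x i) p
    have t2 := dist_triangle (x i) y p
    rw [dist_comm (x i) y] at t2
    refine ⟨Metric.mem_ball.2 (by linarith), fun h3 => ?_⟩
    have := Metric.mem_ball.1 h3
    linarith
  have h1 := card_mul_volume_ball_le hx (T := T)
    (measure_ne_top_of_subset sdiff_subset measure_ball_lt_top.ne) hsub
  rw [hTd, measureReal_sdiff (Metric.ball_subset_ball (by linarith)) measurableSet_ball
    measure_ball_lt_top.ne,
    volume_real_ball _ (by linarith : 0 < R + 3 / 2),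
    volume_real_ball _ (by linarith : 0 < R - 1 / 2), ← mul_assoc, ← sub_mul] at h1
  have h2 := le_of_mul_le_mul_right h1 volume_real_ball_pos
  have h3 := abs_pow_sub_pow_le (R + 3 / 2) (R - 1 / 2) d
  have h5 : max |R + 3 / 2| |R - 1 / 2| ≤ 5 / 2 * R := by
    rw [abs_of_nonneg (by linarith), abs_of_nonneg (by linarith)]
    exact max_le (by linarith) (by linarith)
  have h6 : |R + 3 / 2 - (R - 1 / 2)| = 2 := by
    rw [show R + 3 / 2 - (R - 1 / 2) = 2 by ring]; norm_num
  rw [h6] at h3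
  have h7 : (s.card : ℝ) * (1 / 2) ^ d ≤ 2 * d * (5 / 2 * R) ^ (d - 1) :=
    h2.trans ((le_abs_self _).trans (h3.trans (by gcongr)))
  have h4 : (2 : ℝ) ^ d * (1 / 2) ^ d = 1 := by rw [← mul_pow]; norm_num
  have h8 : R ^ ((d : ℝ) - 1) = R ^ (d - 1) := by
    rw [← Real.rpow_natCast, Nat.cast_sub hd]; simp
  rw [h8]
  calc (s.card : ℝ) = 2 ^ d * (s.card * (1 / 2) ^ d) := by linear_combination (-(s.card : ℝ)) * h4
    _ ≤ 2 ^ d * (2 * d * (5 / 2 * R) ^ (d - 1)) := by gcongr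
    _ = 2 * d * (2 ^ d * (5 / 2) ^ (d - 1)) * R ^ (d - 1) := by rw [mul_pow]; ring
    _ ≤ 2 * d * 5 ^ d * R ^ (d - 1) := by
        gcongr
        calc (2 : ℝ) ^ d * (5 / 2) ^ (d - 1) ≤ 2 ^ d * (5 / 2) ^ d := by
              gcongr
              · norm_num
              · omega
          _ = 5 ^ d := by rw [← mul_pow]; norm_num

end Packing

end Spillover

namespace Spillover

set_option linter.unusedSectionVars false

/-! ### Variance of sums of local functions of the mixing field. -/

namespace Setup

variable {dx dz d : ℕ} {Ω : ℕ → Type*} [∀ k, MeasurableSpace (Ω k)] {M : Setup dx dz d Ω}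

variable (M) in
/-- Agent `i` together with its reference group, as a finite set. -/
def closedSet (k : ℕ) (i : Fin (M.popSize k)) : Finset (Fin (M.popSize k)) :=
  insert i (M.peers k i)

lemma sigmaField_le (hF : M.Framework) (k : ℕ) (K : Finset (Fin (M.popSize k))) :
    M.sigmaField k K ≤ ‹∀ k, MeasurableSpace (Ω k)› k :=
  iSup₂_le fun i _ => ((hF.meas_X k i).prodMk ((hF.meas_Z k i).prodMk
    ((hF.meas_eps k i).prodMk (hF.meas_U k i)))).comap_le

lemma dist_le_of_mem_closedSet (hF : M.Framework) (hS : M.SpaceCond) {k : ℕ}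
    {i j : Fin (M.popSize k)} (h : j ∈ M.closedSet k i) :
    dist (M.loc k i) (M.loc k j) ≤ M.Dbar := by
  rcases Finset.mem_insert.1 h with rfl | h
  · simp
  · have ha : M.adj k i j = true := by simpa [peers] using h
    have hij : i ≠ j := by
      rintro rfl
      rw [hF.adj_diag] at ha
      exact Bool.false_ne_true ha
    by_contra! hd
    rw [hS.homophily k i j hij hd] at ha
    exact Bool.false_ne_true ha

lemma card_closedSet_le (hF : M.Framework) (hS : M.SpaceCond) (k : ℕ) (i : Fin (M.popSize k)) :
    (M.closedSet k i).card ≤ (2 * M.Dbar + 1) ^ d := by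
  have := card_le_of_dist_le (s := M.closedSet k i) (x := M.loc k)
    (fun a _ b _ hab => hS.sep k a b hab) (M.loc k i) (R := M.Dbar) (by positivity)
    (fun j hj => by rw [dist_comm]; exact dist_le_of_mem_closedSet hF hS hj)
  exact_mod_cast this

/-- A real `sSup` dominates the members of a set only if the set is bounded above, so this is needed
before `alphaDep` can be used as an upper bound. -/
lemma alphaDep_bddAbove {Ω : Type*} (m₁ m₂ : MeasurableSpace Ω) [MeasurableSpace Ω]
    (P : Measure Ω) [IsProbabilityMeasure P] :
    BddAbove {x : ℝ | ∃ A B : Set Ω, MeasurableSet[m₁] A ∧ MeasurableSet[m₂] B ∧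
      x = |P.real (A ∩ B) - P.real A * P.real B|} := by
  refine ⟨1, ?_⟩
  rintro x ⟨A, B, -, -, rfl⟩
  have h1 := measureReal_nonneg (μ := P) (s := A ∩ B)
  have h2 := measureReal_le_one (μ := P) (s := A ∩ B)
  have h3 := mul_nonneg (measureReal_nonneg (μ := P) (s := A)) (measureReal_nonneg (μ := P) (s := B))
  have h4 := mul_le_one₀ (measureReal_le_one (μ := P) (s := A)) measureReal_nonneg
    (measureReal_le_one (μ := P) (s := B))
  rw [abs_le]; constructor <;> linarith

lemma alphaDep_le_one {Ω : Type*} (m₁ m₂ : MeasurableSpace Ω) [MeasurableSpace Ω]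
    (P : Measure Ω) [IsProbabilityMeasure P] : alphaDep P m₁ m₂ ≤ 1 := by
  refine Real.sSup_le ?_ zero_le_one
  rintro x ⟨A, B, -, -, rfl⟩
  have h1 := measureReal_nonneg (μ := P) (s := A ∩ B)
  have h2 := measureReal_le_one (μ := P) (s := A ∩ B)
  have h3 := mul_nonneg (measureReal_nonneg (μ := P) (s := A)) (measureReal_nonneg (μ := P) (s := B))
  have h4 := mul_le_one₀ (measureReal_le_one (μ := P) (s := A)) measureReal_nonneg
    (measureReal_le_one (μ := P) (s := B))
  rw [abs_le]; constructor <;> linarith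

lemma alphaDep_nonneg {Ω : Type*} (m₁ m₂ : MeasurableSpace Ω) [MeasurableSpace Ω]
    (P : Measure Ω) : 0 ≤ alphaDep P m₁ m₂ := by
  refine Real.sSup_nonneg ?_
  rintro x ⟨A, B, -, -, rfl⟩
  exact abs_nonneg _

lemma mixCoeff_nonneg (a b r : ℕ) : 0 ≤ M.mixCoeff a b r := by
  refine Real.sSup_nonneg ?_
  rintro x ⟨k, K, L, -, -, -, rfl⟩
  exact alphaDep_nonneg _ _ _

lemma abs_sub_le_mixCoeff (hF : M.Framework) {k a b r : ℕ} {K L : Finset (Fin (M.popSize k))}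
    (hK : K.card ≤ a) (hL : L.card ≤ b)
    (hd : ∀ i ∈ K, ∀ j ∈ L, (r : ℝ) ≤ dist (M.loc k i) (M.loc k j)) {A B : Set (Ω k)}
    (hA : MeasurableSet[M.sigmaField k K] A) (hB : MeasurableSet[M.sigmaField k L] B) :
    |(M.P k).real (A ∩ B) - (M.P k).real A * (M.P k).real B| ≤ M.mixCoeff a b r := by
  have := hF.prob
  calc _ ≤ alphaDep (M.P k) (M.sigmaField k K) (M.sigmaField k L) :=
        le_csSup (alphaDep_bddAbove _ _ _) ⟨A, B, hA, hB, rfl⟩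
    _ ≤ _ := by
        refine le_csSup ⟨1, ?_⟩ ⟨k, K, L, hK, hL, hd, rfl⟩
        rintro x ⟨k, K, L, -, -, -, rfl⟩
        exact alphaDep_le_one _ _ _

lemma sub_injective (k : ℕ) : Function.Injective (M.sub k) := fun _ _ h => Fin.castLE_injective _ h

/-- Sums of bounded local functions of the mixing field have variance of the order of the sample
size. -/
theorem exists_variance_bound (hF : M.Framework) (hS : M.SpaceCond) (hM : M.MixingCond) :
    ∃ B : ℝ, 0 ≤ B ∧ ∀ (k : ℕ) (f : Fin (M.n k) → Ω k → ℝ) (C : ℝ), 0 ≤ C →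
      (∀ i, Measurable[M.sigmaField k (M.closedSet k (M.sub k i))] (f i)) →
      (∀ i, ∀ᵐ ω ∂M.P k, |f i ω| ≤ C) →
      ∫ ω, (∑ i, (f i ω - ∫ ω', f i ω' ∂M.P k)) ^ 2 ∂M.P k ≤ B * C ^ 2 * M.n k := by
  obtain ⟨ϑ, αh, hϑ, hmix, hsum⟩ := hM.rate
  -- Neighbourhoods contain at most `c` agents by packing, so the size factor of the mixing rate is
  -- the constant `W = (2c)^ϑ`.
  set c : ℕ := (2 * M.Dbar + 1) ^ d with hc
  set W : ℝ := ((c : ℝ) + c) ^ ϑ with hW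
  have hc1 : 1 ≤ c := Nat.one_le_pow _ _ (by omega)
  have hW0 : 0 < W := Real.rpow_pos_of_pos (by positivity) _
  -- Nonnegativity of the rate sequence is not assumed; it follows because a positive multiple of it
  -- dominates the nonnegative mixing coefficients.
  have hα0 : ∀ r, 0 ≤ αh r := fun r => by
    have h1 := (mixCoeff_nonneg (M := M) c c r).trans (hmix c c r)
    exact nonneg_of_mul_nonneg_right h1 hW0
  set N₀ : ℝ := (2 * (2 * M.Dbar + 1) + 1) ^ d with hN₀
  set S : ℝ := ∑' r : ℕ, (((r + 1 : ℕ) : ℝ) + 2 * M.Dbar) ^ ((d : ℝ) - 1) * αh (r + 1) with hSd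
  have hS0 : 0 ≤ S := tsum_nonneg fun r => mul_nonneg (by positivity) (hα0 _)
  refine ⟨2 * N₀ + 4 * W * (2 * d * 5 ^ d) * S, by positivity, ?_⟩
  intro k f C hC hfm hfC
  have := hF.prob
  have hle := fun i => sigmaField_le hF k (M.closedSet k (M.sub k i))
  have hfae : ∀ i, AEStronglyMeasurable (f i) (M.P k) := fun i =>
    ((hfm i).mono (hle i) le_rfl).aestronglyMeasurable
  have hfi : ∀ i, Integrable (f i) (M.P k) := fun i =>
    Integrable.of_bound (hfae i) C (by simpa using hfC i)
  have hffi : ∀ i j, Integrable (fun ω => f i ω * f j ω) (M.P k) := fun i j =>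
    (hfi j).bdd_mul (hfae i) (by simpa using hfC i)
  set cov : Fin (M.n k) → Fin (M.n k) → ℝ := fun i j =>
    ∫ ω, f i ω * f j ω ∂M.P k - (∫ ω, f i ω ∂M.P k) * ∫ ω, f j ω ∂M.P k with hcov
  set e : Fin (M.n k) → ℝ := fun i => ∫ ω, f i ω ∂M.P k with he
  have hgi : ∀ i j, Integrable (fun ω => (f i ω - e i) * (f j ω - e j)) (M.P k) := by
    intro i j
    have : Integrable (fun ω => f i ω * f j ω - e j * f i ω - (e i * f j ω - e i * e j)) (M.P k) :=
      ((hffi i j).sub ((hfi i).const_mul _)).sub (((hfi j).const_mul _).sub (integrable_const _))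
    refine this.congr (ae_of_all _ fun ω => ?_)
    simp only; ring
  have h1 : ∫ ω, (∑ i, (f i ω - e i)) ^ 2 ∂M.P k = ∑ i, ∑ j, cov i j := by
    simp_rw [sq, Finset.sum_mul_sum]
    rw [integral_finsetSum _ fun i _ => integrable_finsetSum _ fun j _ => hgi i j]
    refine Finset.sum_congr rfl fun i _ => ?_
    rw [integral_finsetSum _ fun j _ => hgi i j]
    refine Finset.sum_congr rfl fun j _ => ?_
    have h : ∀ ω, (f i ω - e i) * (f j ω - e j) =
      f i ω * f j ω - e j * f i ω - (e i * f j ω - e i * e j) := fun ω => by ring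
    simp_rw [h]
    have i1 : Integrable (fun ω => f i ω * f j ω - e j * f i ω) (M.P k) :=
      (hffi i j).sub ((hfi i).const_mul _)
    have i2 : Integrable (fun ω => e i * f j ω - e i * e j) (M.P k) :=
      ((hfi j).const_mul _).sub (integrable_const _)
    rw [integral_sub i1 i2, integral_sub (hffi i j) ((hfi i).const_mul _),
      integral_sub ((hfi j).const_mul _) (integrable_const _), integral_const_mul,
      integral_const_mul]
    simp only [integral_const, probReal_univ, smul_eq_mul, one_mul, hcov, he]
    ring
  rw [h1]
  have hnear : ∀ i j, cov i j ≤ 2 * C ^ 2 := by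
    intro i j
    have a1 : |∫ ω, f i ω * f j ω ∂M.P k| ≤ C ^ 2 := by
      have : ∀ᵐ ω ∂M.P k, ‖f i ω * f j ω‖ ≤ C ^ 2 := by
        filter_upwards [hfC i, hfC j] with ω a b
        rw [Real.norm_eq_abs, abs_mul, sq]
        exact mul_le_mul a b (abs_nonneg _) hC
      simpa using norm_integral_le_of_norm_le_const this
    have a2 : ∀ i, |e i| ≤ C := fun i => by
      have : ∀ᵐ ω ∂M.P k, ‖f i ω‖ ≤ C := by simpa using hfC i
      simpa using norm_integral_le_of_norm_le_const this
    have a3 : |e i * e j| ≤ C ^ 2 := by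
      rw [abs_mul, sq]; exact mul_le_mul (a2 i) (a2 j) (abs_nonneg _) hC
    have := abs_le.1 a1
    have := abs_le.1 a3
    simp only [hcov]
    change _ - e i * e j ≤ _
    linarith
  -- Each neighbourhood reaches at most `Dbar` from its centre. Centres at distance `r + 2 Dbar`
  -- therefore have neighbourhoods at distance at least `r`.
  have hfar : ∀ i j (r : ℕ), (r : ℝ) + 2 * M.Dbar ≤
      dist (M.loc k (M.sub k i)) (M.loc k (M.sub k j)) → cov i j ≤ 4 * C ^ 2 * (W * αh r) := by
    intro i j r hr
    refine (le_abs_self _).trans ((abs_cov_le (hle i) (hle j) (hfm i) (hfm j) hC (hfC i) (hfC j)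
      fun A B hA hB => ?_).trans (mul_le_mul_of_nonneg_left (hmix c c r) (by positivity)))
    refine abs_sub_le_mixCoeff hF (card_closedSet_le hF hS k _) (card_closedSet_le hF hS k _) ?_
      hA hB
    intro i' hi' j' hj'
    have d1 := dist_le_of_mem_closedSet hF hS hi'
    have d2 := dist_le_of_mem_closedSet hF hS hj'
    have d3 := dist_triangle4 (M.loc k (M.sub k i)) (M.loc k i') (M.loc k j') (M.loc k (M.sub k j))
    rw [dist_comm (M.loc k j')] at d3
    linarith
  have hsep : ∀ a b : Fin (M.n k), a ≠ b →
      1 ≤ dist (M.loc k (M.sub k a)) (M.loc k (M.sub k b)) := fun a b hab =>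
    hS.sep k _ _ fun h => hab (sub_injective k h)
  have hrow : ∀ i, ∑ j, cov i j ≤ (2 * N₀ + 4 * W * (2 * d * 5 ^ d) * S) * C ^ 2 := by
    intro i
    set D : Fin (M.n k) → ℝ := fun j => dist (M.loc k (M.sub k j)) (M.loc k (M.sub k i)) with hD
    rw [← Finset.sum_filter_add_sum_filter_not Finset.univ (fun j => D j ≤ 2 * M.Dbar + 1)]
    have b1 : ∑ j with D j ≤ 2 * M.Dbar + 1, cov i j ≤ N₀ * (2 * C ^ 2) := by
      refine (Finset.sum_le_card_nsmul _ _ _ fun j _ => hnear i j).trans ?_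
      rw [nsmul_eq_mul]
      gcongr
      exact card_le_of_dist_le (fun a _ b _ hab => hsep a b hab) (M.loc k (M.sub k i))
        (by positivity) fun j hj => (Finset.mem_filter.1 hj).2
    -- The shell index of a far agent: its distance lies in `[q + 1 + 2 Dbar, q + 2 + 2 Dbar)` for
    -- `q = g j`. Grouping the far agents by shells and counting each shell reproduces exactly the
    -- summable series of the mixing condition; near agents are bounded in number by packing.
    set g : Fin (M.n k) → ℕ := fun j => ⌊D j⌋₊ - 2 * M.Dbar - 1 with hg
    set s : Finset (Fin (M.n k)) := Finset.univ.filter fun j => ¬ D j ≤ 2 * M.Dbar + 1 with hs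
    have hgj : ∀ j ∈ s, ((g j + 1 : ℕ) : ℝ) + 2 * M.Dbar ≤ D j ∧
        D j < ((g j + 1 : ℕ) : ℝ) + 2 * M.Dbar + 1 := by
      intro j hj
      have h2 := (Finset.mem_filter.1 hj).2
      push Not at h2
      have h3 : 2 * M.Dbar + 1 ≤ ⌊D j⌋₊ := Nat.le_floor (by push_cast; exact h2.le)
      have h4 : g j + 1 + 2 * M.Dbar = ⌊D j⌋₊ := by simp only [hg]; omega
      have h5 : ((g j + 1 : ℕ) : ℝ) + 2 * M.Dbar = (⌊D j⌋₊ : ℝ) := by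
        rw [← h4]; push_cast; ring
      rw [h5]
      exact ⟨Nat.floor_le dist_nonneg, Nat.lt_floor_add_one _⟩
    have b2 : ∑ j ∈ s, cov i j ≤ 4 * C ^ 2 * W * ((2 * d * 5 ^ d) * S) := by
      calc ∑ j ∈ s, cov i j ≤ ∑ j ∈ s, 4 * C ^ 2 * (W * αh (g j + 1)) :=
            Finset.sum_le_sum fun j hj => hfar i j _ (by rw [dist_comm]; exact (hgj j hj).1)
        _ = ∑ q ∈ s.image g, (s.filter fun j => g j = q).card • (4 * C ^ 2 * (W * αh (q + 1))) :=
            Finset.sum_comp (fun q => 4 * C ^ 2 * (W * αh (q + 1))) g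
        _ ≤ ∑ q ∈ s.image g, 4 * C ^ 2 * W * ((2 * d * 5 ^ d) *
              ((((q + 1 : ℕ) : ℝ) + 2 * M.Dbar) ^ ((d : ℝ) - 1) * αh (q + 1))) := by
            refine Finset.sum_le_sum fun q _ => ?_
            have hcard := card_shell_le (s := s.filter fun j => g j = q)
              (x := fun j => M.loc k (M.sub k j)) (fun a _ b _ hab => hsep a b hab)
              (M.loc k (M.sub k i)) (R := ((q + 1 : ℕ) : ℝ) + 2 * M.Dbar)
              (by push_cast; have : (0 : ℝ) ≤ q := by positivity
                  have : (0 : ℝ) ≤ M.Dbar := by positivity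
                  linarith)
              (fun j hj => by
                obtain ⟨h6, h7⟩ := Finset.mem_filter.1 hj
                rw [← h7]; exact hgj j h6)
            rw [nsmul_eq_mul]
            have := mul_le_mul_of_nonneg_right hcard
              (by have := hα0 (q + 1); positivity : 0 ≤ 4 * C ^ 2 * (W * αh (q + 1)))
            refine this.trans (le_of_eq ?_)
            ring
        _ ≤ 4 * C ^ 2 * W * ((2 * d * 5 ^ d) * S) := by
            rw [← Finset.mul_sum, ← Finset.mul_sum]
            gcongr
            exact hsum.sum_le_tsum _ fun q _ => mul_nonneg (by positivity) (hα0 _)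
    calc _ ≤ N₀ * (2 * C ^ 2) + 4 * C ^ 2 * W * ((2 * d * 5 ^ d) * S) := add_le_add b1 b2
      _ = _ := by ring
  calc ∑ i, ∑ j, cov i j ≤ ∑ _i : Fin (M.n k), (2 * N₀ + 4 * W * (2 * d * 5 ^ d) * S) * C ^ 2 :=
        Finset.sum_le_sum fun i _ => hrow i
    _ = _ := by simp; ring

end Setup

end Spillover

/-! ### Measurability of the model variables and of the design. -/

namespace Spillover

set_option linter.unusedSectionVars false

/-- The functions of the model are regular only on the sets where their arguments live. Factoring
through the subtype avoids any assumption on their values elsewhere. -/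
lemma measurable_comp_of_continuousOn {Ω E F : Type*} {m : MeasurableSpace Ω}
    [TopologicalSpace E] [MeasurableSpace E] [OpensMeasurableSpace E]
    [TopologicalSpace F] [MeasurableSpace F] [BorelSpace F] {f : Ω → E} (hf : Measurable[m] f)
    {s : Set E} (hfs : ∀ ω, f ω ∈ s) {φ : E → F} (hφ : ContinuousOn φ s) :
    Measurable[m] (fun ω => φ (f ω)) := by
  have h1 : Measurable (s.domRestrict φ) := (continuousOn_iff_continuous_domRestrict.1 hφ).measurable
  exact h1.comp (hf.subtype_mk (h := hfs))

lemma continuousOn_of_lipschitz_sqrt {ι : Type*} [Fintype ι] {s : Set (ℝ × ℝ)}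
    {f : ℝ × ℝ → ι → ℝ} {L : ℝ} (h : ∀ p ∈ s, ∀ q ∈ s,
      eucl (f p - f q) ≤ L * √((p.1 - q.1) ^ 2 + (p.2 - q.2) ^ 2)) (a : ι) :
    ContinuousOn (fun p => f p a) s := by
  intro p hp
  have h1 : Tendsto (fun q : ℝ × ℝ => L * √((q.1 - p.1) ^ 2 + (q.2 - p.2) ^ 2)) (𝓝[s] p) (𝓝 0) := by
    have : Continuous (fun q : ℝ × ℝ => L * √((q.1 - p.1) ^ 2 + (q.2 - p.2) ^ 2)) := by fun_prop
    have h2 := (this.tendsto p).mono_left (nhdsWithin_le_nhds (s := s))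
    simpa using h2
  rw [ContinuousWithinAt, tendsto_iff_norm_sub_tendsto_zero]
  refine squeeze_zero' (Eventually.of_forall fun q => norm_nonneg _) ?_ h1
  filter_upwards [self_mem_nhdsWithin] with q hq
  exact (abs_apply_le_eucl (f q - f p) a).trans (h q hq p hp)

lemma isCompact_unitSq : IsCompact unitSq := isCompact_Icc.prod isCompact_Icc

lemma measurableSet_unitSq : MeasurableSet unitSq := isCompact_unitSq.measurableSet

lemma convex_unitSq : Convex ℝ unitSq := (convex_Icc _ _).prod (convex_Icc _ _)

lemma volume_real_unitSq : volume.real unitSq = 1 := by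
  rw [unitSq, measureReal_def, Measure.volume_eq_prod, Measure.prod_prod]
  simp

namespace Setup

variable {dx dz d : ℕ} {Ω : ℕ → Type*} [∀ k, MeasurableSpace (Ω k)] {M : Setup dx dz d Ω}

lemma measurable_eta_U (hF : M.Framework) {k : ℕ} {m : MeasurableSpace (Ω k)}
    {i : Fin (M.popSize k)} (hU : Measurable[m] (M.U k i)) :
    Measurable[m] (fun ω => M.eta k (M.U k i ω)) :=
  measurable_comp_of_continuousOn hU (hF.U_mem k i) (hF.eta_cont k)

lemma measurable_T (hF : M.Framework) {k : ℕ} {m : MeasurableSpace (Ω k)}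
    {i : Fin (M.popSize k)} (hX : Measurable[m] (M.X k i)) (hZ : Measurable[m] (M.Z k i))
    (hU : Measurable[m] (M.U k i)) : Measurable[m] (M.T k i) :=
  ((hF.meas_treat k).comp (hX.prodMk hZ)).add (measurable_eta_U hF hU)

lemma weighted_mem_Icc (hF : M.Framework) {k : ℕ} (i : Fin (M.popSize k))
    {f : Fin (M.popSize k) → ℝ} {a b : ℝ} (hf : ∀ j, f j ∈ Icc a b) :
    ∑ j ∈ M.peers k i, M.wt k i j * f j ∈ Icc a b := by
  have h0 : ∀ j ∈ M.peers k i, 0 ≤ M.wt k i j := fun j hj => ((hF.wt_pos k i j).2 hj).le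
  have := (convex_Icc a b).sum_mem h0 (hF.wt_sum k i) fun j _ => hf j
  simpa using this

lemma measurable_S (hF : M.Framework) {k : ℕ} {m : MeasurableSpace (Ω k)}
    {i : Fin (M.popSize k)} (hX : ∀ j ∈ M.peers k i, Measurable[m] (M.X k j))
    (hZ : ∀ j ∈ M.peers k i, Measurable[m] (M.Z k j))
    (hU : ∀ j ∈ M.peers k i, Measurable[m] (M.U k j)) : Measurable[m] (M.S k i) :=
  measurable_comp_of_continuousOn
    (Finset.measurable_sum _ fun j hj => (measurable_T hF (hX j hj) (hZ j hj) (hU j hj)).const_mul _)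
    (fun ω => weighted_mem_Icc hF i fun j => hF.T_mem k j ω) (hF.m_cont k i)

lemma exists_eta_eq (hF : M.Framework) (k : ℕ) (i : Fin (M.popSize k)) (ω : Ω k) :
    ∃ v ∈ Icc (0 : ℝ) 1, M.eta k v = ∑ j ∈ M.peers k i, M.wt k i j * M.eta k (M.U k j ω) := by
  have h1 : ∑ j ∈ M.peers k i, M.wt k i j * M.eta k (M.U k j ω) ∈
      Icc (M.eta k 0) (M.eta k 1) := weighted_mem_Icc hF i fun j =>
    ⟨(hF.eta_mono k).monotoneOn (left_mem_Icc.2 zero_le_one) (hF.U_mem k j ω) (hF.U_mem k j ω).1,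
      (hF.eta_mono k).monotoneOn (hF.U_mem k j ω) (right_mem_Icc.2 zero_le_one)
        (hF.U_mem k j ω).2⟩
  exact intermediate_value_Icc zero_le_one (hF.eta_cont k) h1

lemma V_mem (hF : M.Framework) (k : ℕ) (i : Fin (M.popSize k)) (ω : Ω k) :
    M.V k i ω ∈ Icc (0 : ℝ) 1 :=
  Function.invFunOn_mem (exists_eta_eq hF k i ω)

lemma eta_V (hF : M.Framework) (k : ℕ) (i : Fin (M.popSize k)) (ω : Ω k) :
    M.eta k (M.V k i ω) = ∑ j ∈ M.peers k i, M.wt k i j * M.eta k (M.U k j ω) :=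
  Function.invFunOn_eq (exists_eta_eq hF k i ω)

/-- Since `η` is strictly increasing on `[0, 1]`, the event `V ≤ c` says that the weighted sum is at
most `η(c)`. Thresholds outside the interval are separated first, as nothing is known about `η`
there. -/
lemma measurable_V (hF : M.Framework) {k : ℕ} {m : MeasurableSpace (Ω k)}
    {i : Fin (M.popSize k)} (hU : ∀ j ∈ M.peers k i, Measurable[m] (M.U k j)) :
    Measurable[m] (M.V k i) := by
  have hs : Measurable[m] (fun ω => ∑ j ∈ M.peers k i, M.wt k i j * M.eta k (M.U k j ω)) :=
    Finset.measurable_sum _ fun j hj => (measurable_eta_U hF (hU j hj)).const_mul _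
  refine measurable_of_Iic fun c => ?_
  by_cases h0 : c < 0
  · have : M.V k i ⁻¹' Iic c = ∅ := by
      ext ω; simpa using h0.trans_le (V_mem hF k i ω).1
    rw [this]; exact MeasurableSet.empty
  by_cases h1 : 1 < c
  · have : M.V k i ⁻¹' Iic c = univ := by
      ext ω; simpa using (V_mem hF k i ω).2.trans h1.le
    rw [this]; exact MeasurableSet.univ
  have hc : c ∈ Icc (0 : ℝ) 1 := ⟨not_lt.1 h0, not_lt.1 h1⟩
  have : M.V k i ⁻¹' Iic c =
      {ω | ∑ j ∈ M.peers k i, M.wt k i j * M.eta k (M.U k j ω) ≤ M.eta k c} := by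
    ext ω
    rw [mem_preimage, mem_Iic, mem_ofPred_eq, ← eta_V hF k i ω,
      (hF.eta_mono k).le_iff_le (V_mem hF k i ω) hc]
  rw [this]
  exact measurableSet_le hs measurable_const

lemma UV_mem (hF : M.Framework) (k : ℕ) (i : Fin (M.popSize k)) (ω : Ω k) :
    (M.U k i ω, M.V k i ω) ∈ unitSq := ⟨hF.U_mem k i ω, V_mem hF k i ω⟩

lemma UVhat_mem (hF : M.Framework) (k : ℕ) (i : Fin (M.popSize k)) (ω : Ω k) :
    (M.Uhat k i ω, M.Vhat k i ω) ∈ unitSq := ⟨hF.Uhat_mem k i ω, hF.Vhat_mem k i ω⟩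

lemma TS_mem (hF : M.Framework) (k : ℕ) (i : Fin (M.n k)) (ω : Ω k) :
    (M.T k (M.sub k i) ω, M.S k (M.sub k i) ω) ∈ M.rect := ⟨hF.T_mem k _ ω, hF.S_mem k i ω⟩

lemma continuousOn_PTS (hB : M.BasisCond) (k : ℕ) (a : M.IdxTS k) :
    ContinuousOn (fun p : ℝ × ℝ => M.PTS k p.1 p.2 a) M.rect := by
  obtain ⟨c, ξ, -, -, h⟩ := hB.lip_TS
  exact continuousOn_of_lipschitz_sqrt (f := fun p => M.PTS k p.1 p.2) (h k) a

lemma continuousOn_PUV (hB : M.BasisCond) (k : ℕ) (b : M.IdxUV k) :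
    ContinuousOn (fun p : ℝ × ℝ => M.PUV k p.1 p.2 b) unitSq := by
  obtain ⟨c, ξ, -, -, h⟩ := hB.lip_UV
  exact continuousOn_of_lipschitz_sqrt (f := fun p => M.PUV k p.1 p.2) (h k) b

lemma continuousOn_PUVbar (hB : M.BasisCond) (k : ℕ) (b : M.IdxUV k) :
    ContinuousOn (fun p : ℝ × ℝ => M.PUVbar k p.1 p.2 b) unitSq :=
  (continuousOn_PUV hB k b).sub continuousOn_const

lemma continuousOn_PUVhat (hB : M.BasisCond) (k : ℕ) (ω : Ω k) (b : M.IdxUV k) :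
    ContinuousOn (fun p : ℝ × ℝ => M.PUVhat k ω p.1 p.2 b) unitSq :=
  (continuousOn_PUV hB k b).sub continuousOn_const

lemma measurable_PTS_TS (hF : M.Framework) (hB : M.BasisCond) {k : ℕ} {m : MeasurableSpace (Ω k)}
    {i : Fin (M.n k)} (hT : Measurable[m] (M.T k (M.sub k i)))
    (hS : Measurable[m] (M.S k (M.sub k i))) (a : M.IdxTS k) :
    Measurable[m] (fun ω => M.PTS k (M.T k (M.sub k i) ω) (M.S k (M.sub k i) ω) a) :=
  measurable_comp_of_continuousOn (hT.prodMk hS) (TS_mem hF k i) (continuousOn_PTS hB k a)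

lemma measurable_PUVbar_UV (hF : M.Framework) (hB : M.BasisCond) {k : ℕ}
    {m : MeasurableSpace (Ω k)} {i : Fin (M.popSize k)} (hU : Measurable[m] (M.U k i))
    (hV : Measurable[m] (M.V k i)) (b : M.IdxUV k) :
    Measurable[m] (fun ω => M.PUVbar k (M.U k i ω) (M.V k i ω) b) :=
  measurable_comp_of_continuousOn (hU.prodMk hV) (UV_mem hF k i) (continuousOn_PUVbar hB k b)

section Local

/-- Measurability of the variables `(X_j, Z_j, U_j)` of an agent and its reference group. -/
structure LocalMeas (M : Setup dx dz d Ω) (k : ℕ) (i : Fin (M.popSize k))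
    (m : MeasurableSpace (Ω k)) : Prop where
  X : ∀ j ∈ M.closedSet k i, Measurable[m] (M.X k j)
  Z : ∀ j ∈ M.closedSet k i, Measurable[m] (M.Z k j)
  U : ∀ j ∈ M.closedSet k i, Measurable[m] (M.U k j)

variable {k : ℕ} {m : MeasurableSpace (Ω k)}

lemma self_mem_closedSet (i : Fin (M.popSize k)) : i ∈ M.closedSet k i := Finset.mem_insert_self _ _

lemma peers_subset_closedSet {i j : Fin (M.popSize k)} (h : j ∈ M.peers k i) :
    j ∈ M.closedSet k i := Finset.mem_insert_of_mem h

/-- The same measurability statements are used twice: for the σ-algebra of one neighbourhood, as the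
mixing bounds require, and for `sigmaF`, as conditioning requires. `LocalMeas` isolates what the two
share. -/
lemma localMeas_sigmaField (i : Fin (M.popSize k)) :
    LocalMeas M k i (M.sigmaField k (M.closedSet k i)) := by
  have h : ∀ j ∈ M.closedSet k i, Measurable[M.sigmaField k (M.closedSet k i)]
      (fun ω => (M.X k j ω, M.Z k j ω, M.eps k j ω, M.U k j ω)) := fun j hj =>
    Measurable.of_comap_le (le_iSup₂_of_le (f := fun i (_ : i ∈ M.closedSet k _) =>
      MeasurableSpace.comap (fun ω => (M.X k i ω, M.Z k i ω, M.eps k i ω, M.U k i ω))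
        inferInstance) j hj le_rfl)
  exact ⟨fun j hj => (h j hj).fst, fun j hj => (h j hj).snd.fst,
    fun j hj => (h j hj).snd.snd.snd⟩

lemma measurable_XZU_sigmaF (i : Fin (M.popSize k)) :
    Measurable[M.sigmaF k] (fun ω => (M.X k i ω, M.Z k i ω, M.U k i ω)) :=
  Measurable.of_comap_le (le_iSup (fun i => MeasurableSpace.comap
    (fun ω => (M.X k i ω, M.Z k i ω, M.U k i ω)) inferInstance) i)

lemma localMeas_sigmaF (i : Fin (M.popSize k)) : LocalMeas M k i (M.sigmaF k) :=
  ⟨fun j _ => (measurable_XZU_sigmaF j).fst, fun j _ => (measurable_XZU_sigmaF j).snd.fst,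
    fun j _ => (measurable_XZU_sigmaF j).snd.snd⟩

lemma sigmaF_le (hF : M.Framework) (k : ℕ) :
    M.sigmaF k ≤ ‹∀ k, MeasurableSpace (Ω k)› k :=
  iSup_le fun i => ((hF.meas_X k i).prodMk ((hF.meas_Z k i).prodMk (hF.meas_U k i))).comap_le

lemma LocalMeas.measurable_T (hF : M.Framework) {i : Fin (M.popSize k)} (h : LocalMeas M k i m) :
    Measurable[m] (M.T k i) :=
  Setup.measurable_T hF (h.X _ (self_mem_closedSet i)) (h.Z _ (self_mem_closedSet i))
    (h.U _ (self_mem_closedSet i))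

lemma LocalMeas.measurable_S (hF : M.Framework) {i : Fin (M.popSize k)} (h : LocalMeas M k i m) :
    Measurable[m] (M.S k i) :=
  Setup.measurable_S hF (fun j hj => h.X j (peers_subset_closedSet hj))
    (fun j hj => h.Z j (peers_subset_closedSet hj)) (fun j hj => h.U j (peers_subset_closedSet hj))

lemma LocalMeas.measurable_V (hF : M.Framework) {i : Fin (M.popSize k)} (h : LocalMeas M k i m) :
    Measurable[m] (M.V k i) :=
  Setup.measurable_V hF fun j hj => h.U j (peers_subset_closedSet hj)

lemma LocalMeas.measurable_UV (hF : M.Framework) {i : Fin (M.popSize k)} (h : LocalMeas M k i m) :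
    Measurable[m] (fun ω => (M.U k i ω, M.V k i ω)) :=
  (h.U i (self_mem_closedSet i)).prodMk (h.measurable_V hF)

lemma LocalMeas.measurable_Reg (hF : M.Framework) (hB : M.BasisCond) {i : Fin (M.n k)}
    (h : LocalMeas M k (M.sub k i) m) (a : M.Idx k) : Measurable[m] (fun ω => M.Reg k ω i a) := by
  have hT := h.measurable_T hF
  have hS := h.measurable_S hF
  have hX := h.X _ (self_mem_closedSet _)
  rcases a with ⟨l, a⟩ | ⟨a, b⟩
  · exact ((measurable_pi_apply l).comp hX).mul (measurable_PTS_TS hF hB hT hS a)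
  · exact (measurable_PTS_TS hF hB hT hS a).mul
      (measurable_PUVbar_UV hF hB (h.U _ (self_mem_closedSet _)) (h.measurable_V hF) b)

/-- Treatments are functions of `(X, Z, U)`. Consequently the estimated control variables, and with
them the whole feasible design, are fixed once one conditions on `sigmaF`. -/
lemma sigmaObs_le_sigmaF (hF : M.Framework) (k : ℕ) : M.sigmaObs k ≤ M.sigmaF k := by
  refine iSup_le fun i => Measurable.comap_le ?_
  have h := localMeas_sigmaF (M := M) i
  exact (h.measurable_T hF).prodMk
    ((h.X i (self_mem_closedSet i)).prodMk (h.Z i (self_mem_closedSet i)))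

lemma measurable_UVhat (hF : M.Framework) (k : ℕ) (i : Fin (M.popSize k)) :
    Measurable[M.sigmaF k] (fun ω => (M.Uhat k i ω, M.Vhat k i ω)) :=
  ((hF.Uhat_meas k i).mono (sigmaObs_le_sigmaF hF k) le_rfl).prodMk
    ((hF.Vhat_meas k i).mono (sigmaObs_le_sigmaF hF k) le_rfl)

lemma measurable_PUV_hat (hF : M.Framework) (hB : M.BasisCond) (k : ℕ) (i : Fin (M.popSize k))
    (b : M.IdxUV k) :
    Measurable[M.sigmaF k] (fun ω => M.PUV k (M.Uhat k i ω) (M.Vhat k i ω) b) :=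
  measurable_comp_of_continuousOn (measurable_UVhat hF k i) (UVhat_mem hF k i)
    (continuousOn_PUV hB k b)

/-- The difference between the estimated and the true mean of `P_{UV}`. -/
noncomputable def ctr (M : Setup dx dz d Ω) (k : ℕ) (ω : Ω k) : M.IdxUV k → ℝ := fun b =>
  (1 / (M.n k : ℝ)) * ∑ i, M.PUV k (M.Uhat k (M.sub k i) ω) (M.Vhat k (M.sub k i) ω) b -
    ∫ p, M.PUV k p.1 p.2 b ∂(M.Q k)

lemma PUVhat_eq (k : ℕ) (ω : Ω k) (u v : ℝ) : M.PUVhat k ω u v = M.PUVbar k u v - M.ctr k ω := by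
  funext b; simp only [PUVhat, PUVbar, ctr, Pi.sub_apply]; ring

lemma measurable_ctr (hF : M.Framework) (hB : M.BasisCond) (k : ℕ) (b : M.IdxUV k) :
    Measurable[M.sigmaF k] (fun ω => M.ctr k ω b) :=
  ((Finset.measurable_sum _ fun i _ => measurable_PUV_hat hF hB k (M.sub k i) b).const_mul _).sub_const _

lemma measurable_PUVhat_apply (hF : M.Framework) (hB : M.BasisCond) (k : ℕ) (u v : ℝ)
    (b : M.IdxUV k) : Measurable[M.sigmaF k] (fun ω => M.PUVhat k ω u v b) := by
  simp_rw [PUVhat_eq, Pi.sub_apply]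
  exact (measurable_ctr hF hB k b).const_sub _

lemma measurable_PUVhat_hat (hF : M.Framework) (hB : M.BasisCond) (k : ℕ) (i : Fin (M.popSize k))
    (b : M.IdxUV k) :
    Measurable[M.sigmaF k] (fun ω => M.PUVhat k ω (M.Uhat k i ω) (M.Vhat k i ω) b) := by
  simp_rw [PUVhat_eq, Pi.sub_apply]
  exact (measurable_comp_of_continuousOn (measurable_UVhat hF k i) (UVhat_mem hF k i)
    (continuousOn_PUVbar hB k b)).sub (measurable_ctr hF hB k b)

lemma measurable_RegHat (hF : M.Framework) (hB : M.BasisCond) (k : ℕ) (i : Fin (M.n k))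
    (a : M.Idx k) : Measurable[M.sigmaF k] (fun ω => M.RegHat k ω i a) := by
  have h := localMeas_sigmaF (M := M) (M.sub k i)
  have hT := h.measurable_T hF
  have hS := h.measurable_S hF
  have hX := h.X _ (self_mem_closedSet _)
  rcases a with ⟨l, a⟩ | ⟨a, b⟩
  · exact ((measurable_pi_apply l).comp hX).mul (measurable_PTS_TS hF hB hT hS a)
  · exact (measurable_PTS_TS hF hB hT hS a).mul (measurable_PUVhat_hat hF hB k _ b)

end Local

end Setup

/-- Entries of the inverse of a matrix of measurable functions are measurable. -/
lemma measurable_matrix_inv {Ω ι : Type*} {m : MeasurableSpace Ω} [Fintype ι] [DecidableEq ι]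
    {A : Ω → Matrix ι ι ℝ} (hA : ∀ a b, Measurable[m] (fun ω => A ω a b)) (a b : ι) :
    Measurable[m] (fun ω => (A ω)⁻¹ a b) := by
  have hdet : ∀ B : Ω → Matrix ι ι ℝ, (∀ a b, Measurable[m] (fun ω => B ω a b)) →
      Measurable[m] (fun ω => (B ω).det) := by
    intro B hB
    simp_rw [Matrix.det_apply]
    exact Finset.measurable_sum _ fun σ _ =>
      (Finset.measurable_prod _ fun i _ => hB _ _).const_smul _
  -- Cramer's rule: the entries are cofactors divided by the determinant. The convention `0⁻¹ = 0`
  -- covers singular matrices and keeps division measurable.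
  simp_rw [Matrix.inv_def, Matrix.smul_apply, Matrix.adjugate_apply, Ring.inverse_eq_inv',
    smul_eq_mul]
  refine (hdet A hA).inv.mul (hdet _ fun c e => ?_)
  simp_rw [Matrix.updateRow_apply]
  split_ifs
  · exact measurable_const
  · exact hA c e

end Spillover

/-! ### Uniform bounds on the bases and mean square errors of sample averages. -/

namespace Spillover

set_option linter.unusedSectionVars false

namespace Setup

variable {dx dz d : ℕ} {Ω : ℕ → Type*} [∀ k, MeasurableSpace (Ω k)] {M : Setup dx dz d Ω}

/-- The last bound changes one argument of `P_U ⊗ P_V` at a time. The factor that moves is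
controlled by the mean value inequality with `ζ_U` or `ζ_V`, and the other has norm of order `√K_V`
or `√K_U`; together they form `ζ_†`. -/
lemma exists_basis_bound (hB : M.BasisCond) : ∃ C : ℝ, 1 ≤ C ∧
    (∀ k, ∀ p ∈ M.rect, ∀ a, |M.PTS k p.1 p.2 a| ≤ C) ∧
    (∀ k, ∀ p ∈ unitSq, ∀ b, |M.PUV k p.1 p.2 b| ≤ C) ∧
    (∀ k, ∀ p ∈ unitSq, ∀ q ∈ unitSq, eucl (M.PUV k p.1 p.2 - M.PUV k q.1 q.2) ≤
      C * (M.zetaU k * √(M.KV k : ℝ) * |p.1 - q.1| + M.zetaV k * √(M.KU k : ℝ) * |p.2 - q.2|)) := by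
  obtain ⟨C, hC⟩ := hB.bdd
  set D := max C 1 with hD
  have hD1 : 1 ≤ D := le_max_right _ _
  have hCD : C ≤ D := le_max_left _ _
  have hDD : D ≤ D ^ 2 := by nlinarith
  have mv : ∀ {K : ℕ} (f : Fin K → ℝ → ℝ) (ζ : ℝ),
      (∀ j, DifferentiableOn ℝ (f j) (Icc 0 1)) →
      (∀ u ∈ Icc (0 : ℝ) 1, eucl (fun j => derivWithin (f j) (Icc 0 1) u) ≤ ζ) →
      ∀ x ∈ Icc (0 : ℝ) 1, ∀ y ∈ Icc (0 : ℝ) 1,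
        eucl (fun j => f j x - f j y) ≤ ζ * |x - y| := by
    intro K f ζ hf hζ x hx y hy
    set F : ℝ → EuclideanSpace ℝ (Fin K) := fun u => WithLp.toLp 2 fun j => f j u with hFd
    have hd : ∀ u ∈ Icc (0 : ℝ) 1, HasDerivWithinAt F
        (WithLp.toLp 2 fun j => derivWithin (f j) (Icc 0 1) u) (Icc 0 1) u := by
      intro u hu
      have h1 : HasDerivWithinAt (fun u j => f j u) (fun j => derivWithin (f j) (Icc 0 1) u)
          (Icc 0 1) u := hasDerivWithinAt_pi.2 fun j => (hf j u hu).hasDerivWithinAt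
      exact ((PiLp.continuousLinearEquiv 2 ℝ fun _ : Fin K => ℝ).symm.hasFDerivAt.comp_hasDerivWithinAt
        u h1)
    have := (convex_Icc (0 : ℝ) 1).norm_image_sub_le_of_norm_hasDerivWithin_le hd hζ hy hx
    rw [Real.norm_eq_abs] at this
    exact this
  refine ⟨D ^ 2, by nlinarith, ?_, ?_, ?_⟩
  · intro k p hp a
    obtain ⟨h1, h2, -, -⟩ := hC k
    simp only [PTS]
    rw [abs_mul, sq]
    exact mul_le_mul ((h1 _ _ hp.1).trans hCD) ((h2 _ _ hp.2).trans hCD) (abs_nonneg _) (by linarith)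
  · intro k p hp a
    obtain ⟨-, -, h1, h2⟩ := hC k
    simp only [PUV]
    rw [abs_mul, sq]
    exact mul_le_mul ((h1 _ _ hp.1).trans hCD) ((h2 _ _ hp.2).trans hCD) (abs_nonneg _) (by linarith)
  · intro k p hp q hq
    obtain ⟨-, -, h1, h2⟩ := hC k
    have e : M.PUV k p.1 p.2 - M.PUV k q.1 q.2 =
        (fun b : M.IdxUV k => (M.pU k b.1 p.1 - M.pU k b.1 q.1) * M.pV k b.2 p.2) +
        (fun b : M.IdxUV k => M.pU k b.1 q.1 * (M.pV k b.2 p.2 - M.pV k b.2 q.2)) := by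
      funext b; simp only [PUV, Pi.sub_apply, Pi.add_apply]; ring
    rw [e]
    refine (eucl_add_le _ _).trans ?_
    rw [eucl_tensor (fun j => M.pU k j p.1 - M.pU k j q.1) (fun j => M.pV k j p.2),
      eucl_tensor (fun j => M.pU k j q.1) (fun j => M.pV k j p.2 - M.pV k j q.2)]
    have v1 : eucl (fun j => M.pV k j p.2) ≤ D * √(M.KV k : ℝ) := by
      simpa using eucl_le_of_abs_le (v := fun j => M.pV k j p.2) (C := D) (by linarith)
        fun j => (h2 j _ hp.2).trans hCD
    have v2 : eucl (fun j => M.pU k j q.1) ≤ D * √(M.KU k : ℝ) := by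
      simpa using eucl_le_of_abs_le (v := fun j => M.pU k j q.1) (C := D) (by linarith)
        fun j => (h1 j _ hq.1).trans hCD
    have u1 := mv (M.pU k) (M.zetaU k) (hB.diff_U k) (hB.deriv_U k) p.1 hp.1 q.1 hq.1
    have u2 := mv (M.pV k) (M.zetaV k) (hB.diff_V k) (hB.deriv_V k) p.2 hp.2 q.2 hq.2
    have z1 : 0 ≤ M.zetaU k := (eucl_nonneg _).trans (hB.deriv_U k 0 (left_mem_Icc.2 zero_le_one))
    have z2 : 0 ≤ M.zetaV k := (eucl_nonneg _).trans (hB.deriv_V k 0 (left_mem_Icc.2 zero_le_one))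
    have w1 := mul_le_mul u1 v1 (eucl_nonneg _) (by positivity)
    have w2 := mul_le_mul v2 u2 (eucl_nonneg _) (by positivity)
    calc _ ≤ _ := add_le_add w1 w2
      _ = D * (M.zetaU k * √(M.KV k : ℝ) * |p.1 - q.1| +
          M.zetaV k * √(M.KU k : ℝ) * |p.2 - q.2|) := by ring
      _ ≤ _ := by gcongr

lemma zeta_nonneg (hB : M.BasisCond) (k : ℕ) : 0 ≤ M.zetaU k ∧ 0 ≤ M.zetaV k :=
  ⟨(eucl_nonneg _).trans (hB.deriv_U k 0 (left_mem_Icc.2 zero_le_one)),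
    (eucl_nonneg _).trans (hB.deriv_V k 0 (left_mem_Icc.2 zero_le_one))⟩

lemma law_UV_mem (hF : M.Framework) {k : ℕ} (i : Fin (M.n k)) : ∀ᵐ p ∂M.Q k, p ∈ unitSq := by
  rw [← hF.law_UV k i]
  have hm : Measurable (fun ω => (M.U k (M.sub k i) ω, M.V k (M.sub k i) ω)) :=
    ((localMeas_sigmaF (M := M) (M.sub k i)).measurable_UV hF).mono (sigmaF_le hF k) le_rfl
  exact (ae_map_iff hm.aemeasurable measurableSet_unitSq).2 (ae_of_all _ fun ω => UV_mem hF k _ ω)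

/-- Continuity on the square suffices for the change of variables, since the law `Q` is carried by
the square. -/
lemma integral_Q_eq (hF : M.Framework) {k : ℕ} (i : Fin (M.n k)) {f : ℝ × ℝ → ℝ}
    (hf : ContinuousOn f unitSq) :
    ∫ p, f p ∂M.Q k = ∫ ω, f (M.U k (M.sub k i) ω, M.V k (M.sub k i) ω) ∂M.P k := by
  have hm : Measurable (fun ω => (M.U k (M.sub k i) ω, M.V k (M.sub k i) ω)) :=
    ((localMeas_sigmaF (M := M) (M.sub k i)).measurable_UV hF).mono (sigmaF_le hF k) le_rfl
  have h1 : AEStronglyMeasurable f (M.Q k) := by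
    rw [← Measure.restrict_eq_self_of_ae_mem (law_UV_mem hF i)]
    exact hf.aestronglyMeasurable measurableSet_unitSq
  rw [← hF.law_UV k i] at h1 ⊢
  exact integral_map hm.aemeasurable h1

lemma isProbabilityMeasure_Q (hF : M.Framework) {k : ℕ} (i : Fin (M.n k)) :
    IsProbabilityMeasure (M.Q k) := by
  have := hF.prob k
  have hm : Measurable (fun ω => (M.U k (M.sub k i) ω, M.V k (M.sub k i) ω)) :=
    ((localMeas_sigmaF (M := M) (M.sub k i)).measurable_UV hF).mono (sigmaF_le hF k) le_rfl
  rw [← hF.law_UV k i]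
  exact Measure.isProbabilityMeasure_map hm.aemeasurable

lemma abs_integral_Q_le (hF : M.Framework) {k : ℕ} (i : Fin (M.n k)) {f : ℝ × ℝ → ℝ} {C : ℝ}
    (hf : ∀ p ∈ unitSq, |f p| ≤ C) : |∫ p, f p ∂M.Q k| ≤ C := by
  have := isProbabilityMeasure_Q hF i
  have h : ∀ᵐ p ∂M.Q k, ‖f p‖ ≤ C := by
    filter_upwards [law_UV_mem hF i] with p hp using hf p hp
  simpa using norm_integral_le_of_norm_le_const h

lemma exists_lam_bound (hA : M.ApproxCond) : ∃ C : ℝ, 1 ≤ C ∧ ∀ p ∈ unitSq, |M.lam p.1 p.2| ≤ C := by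
  obtain ⟨C, hC⟩ := isCompact_unitSq.exists_bound_of_continuousOn hA.lam_smooth.continuousOn
  exact ⟨max C 1, le_max_right _ _, fun p hp => (hC p hp).trans (le_max_left _ _)⟩

lemma isCompact_rect : IsCompact M.rect := isCompact_Icc.prod isCompact_Icc

lemma exists_g_bound (hA : M.ApproxCond) : ∃ C : ℝ, 1 ≤ C ∧ ∀ p ∈ M.rect, |M.g p.1 p.2| ≤ C := by
  obtain ⟨C, hC⟩ := isCompact_rect.exists_bound_of_continuousOn hA.g_smooth.continuousOn
  exact ⟨max C 1, le_max_right _ _, fun p hp => (hC p hp).trans (le_max_left _ _)⟩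

lemma exists_X_bound (hM : M.MixingCond) : ∃ C : ℝ, 0 ≤ C ∧ ∀ k, ∀ᵐ ω ∂M.P k, ∀ i,
    eucl (M.X k i ω) ≤ C := by
  obtain ⟨C, hC⟩ := hM.X_bdd
  exact ⟨max C 0, le_max_right _ _, fun k => ae_all_iff.2 fun i =>
    (hC k i).mono fun ω h => h.trans (le_max_left _ _)⟩

lemma abs_PUVhat_le (hF : M.Framework) {k : ℕ} {C : ℝ} (hC : 0 ≤ C)
    (h : ∀ p ∈ unitSq, ∀ b, |M.PUV k p.1 p.2 b| ≤ C) (ω : Ω k) {p : ℝ × ℝ} (hp : p ∈ unitSq)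
    (b : M.IdxUV k) : |M.PUVhat k ω p.1 p.2 b| ≤ 2 * C := by
  have h1 : |(1 / (M.n k : ℝ)) *
      ∑ i, M.PUV k (M.Uhat k (M.sub k i) ω) (M.Vhat k (M.sub k i) ω) b| ≤ C := by
    rw [abs_mul, abs_of_nonneg (by positivity)]
    have h2 : |∑ i, M.PUV k (M.Uhat k (M.sub k i) ω) (M.Vhat k (M.sub k i) ω) b| ≤ M.n k * C := by
      refine (Finset.abs_sum_le_sum_abs _ _).trans ?_
      refine (Finset.sum_le_card_nsmul _ _ C fun i _ => h _ (UVhat_mem hF k _ ω) b).trans ?_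
      simp
    rcases Nat.eq_zero_or_pos (M.n k) with h0 | h0
    · simpa [h0] using hC
    · have : (0 : ℝ) < M.n k := by exact_mod_cast h0
      calc _ ≤ 1 / (M.n k : ℝ) * (M.n k * C) := by gcongr
        _ = C := by field_simp
  have := h p hp b
  simp only [PUVhat]
  refine (abs_sub _ _).trans ?_
  linarith

lemma abs_PUVbar_le (hF : M.Framework) {k : ℕ} (i : Fin (M.n k)) {C : ℝ}
    (h : ∀ p ∈ unitSq, ∀ b, |M.PUV k p.1 p.2 b| ≤ C) {p : ℝ × ℝ} (hp : p ∈ unitSq)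
    (b : M.IdxUV k) : |M.PUVbar k p.1 p.2 b| ≤ 2 * C := by
  have h1 := abs_integral_Q_le hF i (f := fun p => M.PUV k p.1 p.2 b) fun p hp => h p hp b
  have := h p hp b
  simp only [PUVbar]
  refine (abs_sub _ _).trans ?_
  linarith

lemma abs_RegHat_le (hF : M.Framework) {k : ℕ} {C CX : ℝ} (hC : 0 ≤ C)
    (hT : ∀ p ∈ M.rect, ∀ a, |M.PTS k p.1 p.2 a| ≤ C)
    (h : ∀ p ∈ unitSq, ∀ b, |M.PUV k p.1 p.2 b| ≤ C) {ω : Ω k} (hX : ∀ i, eucl (M.X k i ω) ≤ CX)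
    (i : Fin (M.n k)) (a : M.Idx k) : |M.RegHat k ω i a| ≤ CX * C + 2 * C ^ 2 := by
  have hCX : 0 ≤ CX := (eucl_nonneg _).trans (hX (M.sub k i))
  have t := fun a => hT _ (TS_mem hF k i ω) a
  rcases a with ⟨l, a⟩ | ⟨a, b⟩
  · have : |M.RegHat k ω i (Sum.inl (l, a))| ≤ CX * C := by
      simp only [RegHat, Matrix.of_apply, Sum.elim_inl, abs_mul]
      exact mul_le_mul ((abs_apply_le_eucl _ l).trans (hX _)) (t a) (abs_nonneg _) hCX
    have : 0 ≤ C ^ 2 := by positivity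
    linarith
  · have : |M.RegHat k ω i (Sum.inr (a, b))| ≤ C * (2 * C) := by
      simp only [RegHat, Matrix.of_apply, Sum.elim_inr, abs_mul]
      exact mul_le_mul (t a) (abs_PUVhat_le hF hC h ω (UVhat_mem hF k _ ω) b) (abs_nonneg _) hC
    have := mul_nonneg hCX hC
    linarith

lemma abs_Reg_le (hF : M.Framework) {k : ℕ} {C CX : ℝ} (hC : 0 ≤ C)
    (hT : ∀ p ∈ M.rect, ∀ a, |M.PTS k p.1 p.2 a| ≤ C)
    (h : ∀ p ∈ unitSq, ∀ b, |M.PUV k p.1 p.2 b| ≤ C) {ω : Ω k} (hX : ∀ i, eucl (M.X k i ω) ≤ CX)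
    (i : Fin (M.n k)) (a : M.Idx k) : |M.Reg k ω i a| ≤ CX * C + 2 * C ^ 2 := by
  have hCX : 0 ≤ CX := (eucl_nonneg _).trans (hX (M.sub k i))
  have t := fun a => hT _ (TS_mem hF k i ω) a
  rcases a with ⟨l, a⟩ | ⟨a, b⟩
  · have : |M.Reg k ω i (Sum.inl (l, a))| ≤ CX * C := by
      simp only [Reg, Sum.elim_inl, abs_mul]
      exact mul_le_mul ((abs_apply_le_eucl _ l).trans (hX _)) (t a) (abs_nonneg _) hCX
    have : 0 ≤ C ^ 2 := by positivity
    linarith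
  · have : |M.Reg k ω i (Sum.inr (a, b))| ≤ C * (2 * C) := by
      simp only [Reg, Sum.elim_inr, abs_mul]
      exact mul_le_mul (t a) (abs_PUVbar_le hF i h (UV_mem hF k _ ω) b) (abs_nonneg _) hC
    have := mul_nonneg hCX hC
    linarith

/-- Mean square error of sample averages of bounded local functions. -/
theorem exists_avg_bound (hF : M.Framework) (hS : M.SpaceCond) (hM : M.MixingCond) :
    ∃ B : ℝ, 0 ≤ B ∧ ∀ (k : ℕ), 0 < M.n k → ∀ (f : Fin (M.n k) → Ω k → ℝ) (C : ℝ), 0 ≤ C →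
      (∀ i, Measurable[M.sigmaField k (M.closedSet k (M.sub k i))] (f i)) →
      (∀ i, ∀ᵐ ω ∂M.P k, |f i ω| ≤ C) → ∀ c : ℝ,
      c = (1 / (M.n k : ℝ)) * ∑ i, ∫ ω, f i ω ∂M.P k →
      Measurable (fun ω => (1 / (M.n k : ℝ)) * ∑ i, f i ω - c) ∧
      ∫⁻ ω, ENNReal.ofReal (((1 / (M.n k : ℝ)) * ∑ i, f i ω - c) ^ 2) ∂M.P k ≤
        ENNReal.ofReal (B * C ^ 2 / M.n k) := by
  obtain ⟨B, hB0, hB⟩ := exists_variance_bound hF hS hM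
  refine ⟨B, hB0, fun k hn f C hC hfm hfC c hc => ?_⟩
  have := hF.prob k
  have hle := fun i => sigmaField_le hF k (M.closedSet k (M.sub k i))
  have hm : ∀ i, Measurable (f i) := fun i => (hfm i).mono (hle i) le_rfl
  have hfi : ∀ i, Integrable (f i) (M.P k) := fun i =>
    Integrable.of_bound (hm i).aestronglyMeasurable C (by simpa using hfC i)
  have hmeas : Measurable (fun ω => (1 / (M.n k : ℝ)) * ∑ i, f i ω - c) :=
    ((Finset.measurable_sum _ fun i _ => hm i).const_mul _).sub_const _
  refine ⟨hmeas, ?_⟩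
  have h1 := hB k f C hC hfm hfC
  have e : ∀ ω, ((1 / (M.n k : ℝ)) * ∑ i, f i ω - c) ^ 2 =
      (1 / (M.n k : ℝ)) ^ 2 * (∑ i, (f i ω - ∫ ω', f i ω' ∂M.P k)) ^ 2 := by
    intro ω
    rw [hc, Finset.sum_sub_distrib]; ring
  have hbd : ∀ᵐ ω ∂M.P k, ‖(∑ i, (f i ω - ∫ ω', f i ω' ∂M.P k)) ^ 2‖ ≤
      (∑ i, (C + |∫ ω', f i ω' ∂M.P k|)) ^ 2 := by
    filter_upwards [ae_all_iff.2 hfC] with ω h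
    rw [Real.norm_eq_abs, abs_pow]
    refine pow_le_pow_left₀ (abs_nonneg _) ((Finset.abs_sum_le_sum_abs _ _).trans ?_) 2
    exact Finset.sum_le_sum fun i _ => (abs_sub _ _).trans (by linarith [h i])
  have hint : Integrable (fun ω => (∑ i, (f i ω - ∫ ω', f i ω' ∂M.P k)) ^ 2) (M.P k) :=
    Integrable.of_bound (((Finset.measurable_sum _ fun i _ =>
      (hm i).sub_const _).pow_const 2).aestronglyMeasurable) _ hbd
  simp_rw [e]
  rw [← ofReal_integral_eq_lintegral_ofReal (hint.const_mul _)
    (ae_of_all _ fun ω => by positivity), integral_const_mul]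
  apply ENNReal.ofReal_le_ofReal
  have hn' : (0 : ℝ) < M.n k := by exact_mod_cast hn
  calc _ ≤ (1 / (M.n k : ℝ)) ^ 2 * (B * C ^ 2 * M.n k) := by gcongr
    _ = _ := by field_simp

/-- The sample average of `λ(U_i, V_i)`. -/
noncomputable def lamAvg (M : Setup dx dz d Ω) (k : ℕ) (ω : Ω k) : ℝ :=
  (1 / (M.n k : ℝ)) * ∑ i, M.lam (M.U k (M.sub k i) ω) (M.V k (M.sub k i) ω)

/-- The infeasible centring error of `P_{UV}`. -/
noncomputable def ctrTrue (M : Setup dx dz d Ω) (k : ℕ) (ω : Ω k) : M.IdxUV k → ℝ := fun b =>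
  (1 / (M.n k : ℝ)) * ∑ i, M.PUV k (M.U k (M.sub k i) ω) (M.V k (M.sub k i) ω) b -
    ∫ p, M.PUV k p.1 p.2 b ∂(M.Q k)

/-- The deviation of the infeasible sample second moment matrix from its mean. -/
noncomputable def gramDev (M : Setup dx dz d Ω) (k : ℕ) (ω : Ω k) : Matrix (M.Idx k) (M.Idx k) ℝ :=
  Matrix.of fun a b =>
    (1 / (M.n k : ℝ)) * ∑ i, M.Reg k ω i a * M.Reg k ω i b - M.gram k a b

lemma lintegral_ofReal_sum_le {Ω ι : Type*} [MeasurableSpace Ω] {P : Measure Ω} [Fintype ι]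
    {f : ι → Ω → ℝ} (hf : ∀ i, Measurable (f i)) (h0 : ∀ i ω, 0 ≤ f i ω) {C : ℝ}
    (h : ∀ i, ∫⁻ ω, ENNReal.ofReal (f i ω) ∂P ≤ ENNReal.ofReal C) :
    ∫⁻ ω, ENNReal.ofReal (∑ i, f i ω) ∂P ≤ ENNReal.ofReal (Fintype.card ι * C) := by
  have e : ∀ ω, ENNReal.ofReal (∑ i, f i ω) = ∑ i, ENNReal.ofReal (f i ω) := fun ω =>
    ENNReal.ofReal_sum_of_nonneg fun i _ => h0 i ω
  simp_rw [e]
  rw [lintegral_finsetSum _ fun i _ => (hf i).ennreal_ofReal]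
  refine (Finset.sum_le_card_nsmul _ _ _ fun i _ => h i).trans (le_of_eq ?_)
  rw [nsmul_eq_mul, ENNReal.ofReal_mul (by positivity)]
  simp

/-- By the tower property from `E ε = 0`. This makes the sample mean of `λ(U_i, V_i)` of order
`n^{-1/2}`, so that centring the basis does not spoil the approximation of `λ`. -/
lemma lam_mean (hF : M.Framework) {k : ℕ} (i : Fin (M.n k)) :
    ∫ ω, M.lam (M.U k (M.sub k i) ω) (M.V k (M.sub k i) ω) ∂M.P k = 0 := by
  have := hF.prob k
  rw [← hF.eps_mean k i, ← integral_congr_ae (hF.eps_UV k i), integral_condExp]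
  exact (((localMeas_sigmaF (M := M) (M.sub k i)).measurable_UV hF).comap_le).trans (sigmaF_le hF k)

theorem exists_lamAvg_bound (hF : M.Framework) (hS : M.SpaceCond) (hM : M.MixingCond)
    (hA : M.ApproxCond) :
    ∃ B : ℝ, 0 ≤ B ∧ ∀ k, 0 < M.n k →
      ∫⁻ ω, ENNReal.ofReal (M.lamAvg k ω ^ 2) ∂M.P k ≤ ENNReal.ofReal (B / M.n k) := by
  obtain ⟨B, hB0, hB⟩ := exists_avg_bound hF hS hM
  obtain ⟨C, hC1, hC⟩ := exists_lam_bound hA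
  refine ⟨B * C ^ 2, by positivity, fun k hn => ?_⟩
  have := (hB k hn (fun i ω => M.lam (M.U k (M.sub k i) ω) (M.V k (M.sub k i) ω)) C (by linarith)
    (fun i => measurable_comp_of_continuousOn ((localMeas_sigmaField (M.sub k i)).measurable_UV hF)
      (UV_mem hF k _) hA.lam_smooth.continuousOn)
    (fun i => ae_of_all _ fun ω => hC _ (UV_mem hF k _ ω)) 0
    (by simp [lam_mean hF])).2
  simpa [lamAvg] using this

theorem exists_ctrTrue_bound (hF : M.Framework) (hS : M.SpaceCond) (hM : M.MixingCond)
    (hBa : M.BasisCond) :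
    ∃ B : ℝ, 0 ≤ B ∧ ∀ k, 0 < M.n k →
      ∫⁻ ω, ENNReal.ofReal (eucl (M.ctrTrue k ω) ^ 2) ∂M.P k ≤
        ENNReal.ofReal (M.KUV k * (B / M.n k)) := by
  obtain ⟨B, hB0, hB⟩ := exists_avg_bound hF hS hM
  obtain ⟨C, hC1, -, hC, -⟩ := exists_basis_bound hBa
  refine ⟨B * C ^ 2, by positivity, fun k hn => ?_⟩
  have h := fun b : M.IdxUV k =>
    hB k hn (fun i ω => M.PUV k (M.U k (M.sub k i) ω) (M.V k (M.sub k i) ω) b) C (by linarith)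
    (fun i => measurable_comp_of_continuousOn ((localMeas_sigmaField (M.sub k i)).measurable_UV hF)
      (UV_mem hF k _) (continuousOn_PUV hBa k b))
    (fun i => ae_of_all _ fun ω => hC k _ (UV_mem hF k _ ω) b) (∫ p, M.PUV k p.1 p.2 b ∂(M.Q k))
    (by
      have : ∀ i : Fin (M.n k), ∫ ω, M.PUV k (M.U k (M.sub k i) ω) (M.V k (M.sub k i) ω) b ∂M.P k =
        ∫ p, M.PUV k p.1 p.2 b ∂(M.Q k) := fun i =>
        (integral_Q_eq hF i (continuousOn_PUV hBa k b)).symm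
      simp_rw [this]
      have hn' : (M.n k : ℝ) ≠ 0 := by exact_mod_cast hn.ne'
      simp
      field_simp)
  have := lintegral_ofReal_sum_le (P := M.P k) (f := fun b ω => M.ctrTrue k ω b ^ 2)
    (fun b => (h b).1.pow_const 2) (fun b ω => sq_nonneg _) (C := B * C ^ 2 / M.n k)
    (fun b => (h b).2)
  simp_rw [eucl_sq]
  refine this.trans (le_of_eq ?_)
  simp [KUV]

/-- Each entry of the deviation has variance `O(1/n)`. The Frobenius norm costs the square of the
number of regressors, which is where `κ⁴/n` comes from. -/
theorem exists_gramDev_bound (hF : M.Framework) (hS : M.SpaceCond) (hM : M.MixingCond)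
    (hBa : M.BasisCond) :
    ∃ B : ℝ, 0 ≤ B ∧ ∀ k, 0 < M.n k →
      ∫⁻ ω, ENNReal.ofReal (∑ a, ∑ b, M.gramDev k ω a b ^ 2) ∂M.P k ≤
        ENNReal.ofReal ((Fintype.card (M.Idx k) : ℝ) ^ 2 * (B / M.n k)) := by
  obtain ⟨B, hB0, hB⟩ := exists_avg_bound hF hS hM
  obtain ⟨C, hC1, hT, hC, -⟩ := exists_basis_bound hBa
  obtain ⟨CX, hCX0, hCX⟩ := exists_X_bound hM
  set R := CX * C + 2 * C ^ 2 with hR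
  have hR0 : 0 ≤ R := by positivity
  refine ⟨B * (R ^ 2) ^ 2, by positivity, fun k hn => ?_⟩
  have := hF.prob k
  have hb : ∀ (i : Fin (M.n k)), ∀ᵐ ω ∂M.P k, ∀ a, |M.Reg k ω i a| ≤ R := fun i => by
    filter_upwards [hCX k] with ω hX a
    exact abs_Reg_le hF (by linarith) (hT k) (hC k) hX i a
  have hb2 : ∀ (i : Fin (M.n k)) (c : M.Idx k × M.Idx k), ∀ᵐ ω ∂M.P k,
      |M.Reg k ω i c.1 * M.Reg k ω i c.2| ≤ R ^ 2 := fun i c => by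
    filter_upwards [hb i] with ω hω
    rw [abs_mul, sq]
    exact mul_le_mul (hω _) (hω _) (abs_nonneg _) hR0
  have hmeas : ∀ (i : Fin (M.n k)) (c : M.Idx k × M.Idx k),
      Measurable[M.sigmaField k (M.closedSet k (M.sub k i))]
      (fun ω => M.Reg k ω i c.1 * M.Reg k ω i c.2) := fun i c =>
    ((localMeas_sigmaField (M.sub k i)).measurable_Reg hF hBa c.1).mul
      ((localMeas_sigmaField (M.sub k i)).measurable_Reg hF hBa c.2)
  have h := fun c : M.Idx k × M.Idx k =>
    hB k hn (fun i ω => M.Reg k ω i c.1 * M.Reg k ω i c.2) (R ^ 2) (by positivity)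
    (fun i => hmeas i c) (fun i => hb2 i c) (M.gram k c.1 c.2)
    (by
      simp only [gram, Matrix.of_apply]
      rw [integral_const_mul, integral_finsetSum]
      intro i _
      exact Integrable.of_bound ((hmeas i c).mono (sigmaField_le hF k _) le_rfl).aestronglyMeasurable
        (R ^ 2) (by simpa using hb2 i c))
  have := lintegral_ofReal_sum_le (P := M.P k)
    (f := fun (c : M.Idx k × M.Idx k) ω => M.gramDev k ω c.1 c.2 ^ 2)
    (fun c => (h c).1.pow_const 2) (fun b ω => sq_nonneg _) (C := B * (R ^ 2) ^ 2 / M.n k)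
    (fun c => (h c).2)
  simp_rw [Fintype.sum_prod_type] at this
  refine this.trans (le_of_eq ?_)
  rw [Fintype.card_prod, Nat.cast_mul, sq (Fintype.card (M.Idx k) : ℝ)]

end Setup

end Spillover

namespace Spillover

set_option linter.unusedSectionVars false

/-! ### Calculus of events of high probability. -/

section Whp

variable {Ω : ℕ → Type*} [∀ k, MeasurableSpace (Ω k)]

/-- Eventually, the `k`-th event has probability at least `1 - δ`. -/
def Whp (P : ∀ k, Measure (Ω k)) (δ : ℝ) (G : ∀ k, Ω k → Prop) : Prop :=
  ∀ᶠ k in atTop, P k {ω | ¬ G k ω} ≤ ENNReal.ofReal δ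

variable {P : ∀ k, Measure (Ω k)} {δ δ₁ δ₂ : ℝ} {G G₁ G₂ : ∀ k, Ω k → Prop}

lemma Whp.and (h₁ : Whp P δ₁ G₁) (h₂ : Whp P δ₂ G₂) (hδ₁ : 0 ≤ δ₁) (hδ₂ : 0 ≤ δ₂) :
    Whp P (δ₁ + δ₂) fun k ω => G₁ k ω ∧ G₂ k ω := by
  filter_upwards [h₁, h₂] with k a b
  rw [ENNReal.ofReal_add hδ₁ hδ₂]
  refine (measure_mono fun ω hω => ?_).trans ((measure_union_le _ _).trans (add_le_add a b))
  simp only [mem_union, mem_ofPred_eq] at hω ⊢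
  tauto

lemma Whp.mono (h : Whp P δ G₁) (hi : ∀ᶠ k in atTop, ∀ ω, G₁ k ω → G₂ k ω) : Whp P δ G₂ := by
  filter_upwards [h, hi] with k a b
  exact (measure_mono fun ω (hω : ¬ G₂ k ω) h' => hω (b ω h')).trans a

lemma Whp.of_ae (h : ∀ᶠ k in atTop, ∀ᵐ ω ∂P k, G k ω) : Whp P δ G := by
  filter_upwards [h] with k hk
  have : P k {ω | ¬ G k ω} = 0 := ae_iff.1 hk
  rw [this]; exact zero_le

/-- Markov's inequality, with the threshold chosen so that the probability of failure is `δ`. -/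
lemma Whp.of_lintegral {R : ∀ k, Ω k → ℝ} {t : ℕ → ℝ}
    (h : ∀ᶠ k in atTop, 0 < t k ∧ Measurable (R k) ∧
      ∫⁻ ω, ENNReal.ofReal (R k ω) ∂P k ≤ ENNReal.ofReal (δ * t k)) :
    Whp P δ fun k ω => R k ω ≤ t k := by
  filter_upwards [h] with k ⟨ht, hm, hR⟩
  have h1 := mul_meas_ge_le_lintegral (μ := P k) hm.ennreal_ofReal (ENNReal.ofReal (t k))
  have h2 : P k {ω | ¬ R k ω ≤ t k} ≤ P k {ω | ENNReal.ofReal (t k) ≤ ENNReal.ofReal (R k ω)} :=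
    measure_mono fun ω hω => ENNReal.ofReal_le_ofReal (not_le.1 hω).le
  have h0 : ENNReal.ofReal (t k) ≠ 0 := by simpa using ht
  have h3 := (mul_le_mul_right h2 (ENNReal.ofReal (t k))).trans (h1.trans hR)
  rw [mul_comm δ, ENNReal.ofReal_mul ht.le] at h3
  exact (ENNReal.mul_le_mul_iff_right h0 ENNReal.ofReal_ne_top).1 h3

lemma isBigOP_of_whp {X : ∀ k, Ω k → ℝ≥0∞} {r : ℕ → ℝ}
    (h : ∀ δ : ℝ, 0 < δ → ∃ C : ℝ, 0 < C ∧ Whp P δ fun k ω => X k ω ≤ ENNReal.ofReal (C * r k)) :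
    IsBigOP P X r := by
  intro δ hδ
  obtain ⟨C, hC, hw⟩ := h δ hδ
  refine ⟨C, hC, ?_⟩
  filter_upwards [hw] with k hk
  simpa [not_le] using hk

lemma whp_of_isBigOP {X : ∀ k, Ω k → ℝ≥0∞} {r : ℕ → ℝ} (h : IsBigOP P X r) (hδ : 0 < δ) :
    ∃ C : ℝ, 0 < C ∧ Whp P δ fun k ω => X k ω ≤ ENNReal.ofReal (C * r k) := by
  obtain ⟨C, hC, hw⟩ := h δ hδ
  refine ⟨C, hC, ?_⟩
  filter_upwards [hw] with k hk
  simpa [not_le] using hk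

end Whp

/-! ### Tail bounds for self-normalized sums. -/

section Tail

variable {Ω ι : Type*} [Fintype ι] {m mΩ : MeasurableSpace Ω} {P : Measure Ω}

/-- Tail bound for self-normalized sums. -/
lemma selfNormalized_tail (hm : m ≤ mΩ) {e s : ι → Ω → ℝ} (he : ∀ i, Measurable (e i))
    (hs : ∀ i, Measurable (s i))
    (hexp : ∀ w : ι → Ω → ℝ, (∀ i, Measurable[m] (w i)) →
        ∫⁻ ω, ENNReal.ofReal (Real.exp (∑ i, (w i ω * e i ω -
          w i ω ^ 2 / 6 * (e i ω ^ 2 + 2 * s i ω)))) ∂P ≤ 1)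
    {w : ι → Ω → ℝ} (hw : ∀ i, Measurable[m] (w i)) {x v : ℝ} (hx : 0 < x) (hv : 0 < v) :
    P {ω | x < |∑ i, w i ω * e i ω| ∧ ∑ i, w i ω ^ 2 * (e i ω ^ 2 + 2 * s i ω) ≤ v} ≤
      ENNReal.ofReal (2 * Real.exp (-(3 * x ^ 2 / (2 * v)))) := by
  have one : ∀ w : ι → Ω → ℝ, (∀ i, Measurable[m] (w i)) →
      P {ω | x < ∑ i, w i ω * e i ω ∧ ∑ i, w i ω ^ 2 * (e i ω ^ 2 + 2 * s i ω) ≤ v} ≤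
        ENNReal.ofReal (Real.exp (-(3 * x ^ 2 / (2 * v)))) := by
    intro w hw
    -- The maximizer of `t x - t² v / 6`, whose maximum is `3x²/(2v)`.
    set t : ℝ := 3 * x / v with ht
    have ht0 : 0 < t := by positivity
    have h1 := hexp (fun i ω => t * w i ω) fun i => (hw i).const_mul t
    set Z : Ω → ℝ := fun ω => ∑ i, (t * w i ω * e i ω -
          (t * w i ω) ^ 2 / 6 * (e i ω ^ 2 + 2 * s i ω)) with hZ
    have hZm : Measurable Z := Finset.measurable_sum _ fun i _ => by
      have := (hw i).mono hm le_rfl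
      have := he i
      have := hs i
      fun_prop
    have hsub : {ω | x < ∑ i, w i ω * e i ω ∧ ∑ i, w i ω ^ 2 * (e i ω ^ 2 + 2 * s i ω) ≤ v} ⊆
        {ω | ENNReal.ofReal (Real.exp (3 * x ^ 2 / (2 * v))) ≤ ENNReal.ofReal (Real.exp (Z ω))} := by
      rintro ω ⟨h2, h3⟩
      apply ENNReal.ofReal_le_ofReal
      apply Real.exp_le_exp.2
      have e1 : Z ω = t * (∑ i, w i ω * e i ω) -
          t ^ 2 / 6 * ∑ i, w i ω ^ 2 * (e i ω ^ 2 + 2 * s i ω) := by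
        rw [hZ, Finset.mul_sum, Finset.mul_sum, ← Finset.sum_sub_distrib]
        exact Finset.sum_congr rfl fun i _ => by ring
      have e2 : 3 * x ^ 2 / (2 * v) = t * x - t ^ 2 / 6 * v := by
        rw [ht]; field_simp; ring
      rw [e1, e2]
      gcongr
    have h4 := mul_meas_ge_le_lintegral (μ := P) (Real.measurable_exp.comp hZm).ennreal_ofReal
      (ENNReal.ofReal (Real.exp (3 * x ^ 2 / (2 * v))))
    have h5 := (mul_le_mul_right (measure_mono (μ := P) hsub) _).trans (h4.trans h1)
    calc _ = ENNReal.ofReal (Real.exp (-(3 * x ^ 2 / (2 * v)))) *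
          (ENNReal.ofReal (Real.exp (3 * x ^ 2 / (2 * v))) * P {ω | x < ∑ i, w i ω * e i ω ∧
            ∑ i, w i ω ^ 2 * (e i ω ^ 2 + 2 * s i ω) ≤ v}) := by
          rw [← mul_assoc, ← ENNReal.ofReal_mul (Real.exp_pos _).le, ← Real.exp_add]
          simp
      _ ≤ ENNReal.ofReal (Real.exp (-(3 * x ^ 2 / (2 * v)))) * 1 := by gcongr
      _ = _ := mul_one _
  have hneg := one (fun i ω => - w i ω) fun i => (hw i).neg
  rw [two_mul, ENNReal.ofReal_add (Real.exp_pos _).le (Real.exp_pos _).le]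
  refine (measure_mono fun ω hω => ?_).trans
    ((measure_union_le _ _).trans (add_le_add (one w hw) hneg))
  obtain ⟨h1, h2⟩ := hω
  rcases lt_abs.1 h1 with h | h
  · exact Or.inl ⟨h, h2⟩
  · refine Or.inr ⟨?_, by simpa using h2⟩
    simpa [Finset.sum_neg_distrib] using h

/-- A union bound. The variance bound is kept as a premise inside the event, so that it can be
verified pathwise later, where it is a consequence of a random matrix bound. -/
lemma selfNormalized_tail_finite (hm : m ≤ mΩ) {e s : ι → Ω → ℝ} (he : ∀ i, Measurable (e i))
    (hs : ∀ i, Measurable (s i))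
    (hexp : ∀ w : ι → Ω → ℝ, (∀ i, Measurable[m] (w i)) →
        ∫⁻ ω, ENNReal.ofReal (Real.exp (∑ i, (w i ω * e i ω -
          w i ω ^ 2 / 6 * (e i ω ^ 2 + 2 * s i ω)))) ∂P ≤ 1)
    {J : Type*} [Fintype J]
    {w : J → ι → Ω → ℝ} (hw : ∀ j i, Measurable[m] (w j i)) {x v : ℝ} (hx : 0 < x) (hv : 0 < v) :
    P {ω | ¬ ∀ j, ∑ i, w j i ω ^ 2 * (e i ω ^ 2 + 2 * s i ω) ≤ v → |∑ i, w j i ω * e i ω| ≤ x} ≤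
      ENNReal.ofReal (Fintype.card J * (2 * Real.exp (-(3 * x ^ 2 / (2 * v))))) := by
  have hsub : {ω | ¬ ∀ j, ∑ i, w j i ω ^ 2 * (e i ω ^ 2 + 2 * s i ω) ≤ v →
      |∑ i, w j i ω * e i ω| ≤ x} ⊆ ⋃ j ∈ (Finset.univ : Finset J),
      {ω | x < |∑ i, w j i ω * e i ω| ∧ ∑ i, w j i ω ^ 2 * (e i ω ^ 2 + 2 * s i ω) ≤ v} := by
    intro ω hω
    simp only [mem_ofPred_eq, not_forall, not_le] at hω
    obtain ⟨j, h1, h2⟩ := hω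
    exact mem_iUnion₂.2 ⟨j, Finset.mem_univ j, h2, h1⟩
  refine (measure_mono hsub).trans ((measure_biUnion_finset_le _ _).trans ?_)
  refine (Finset.sum_le_card_nsmul _ _ _ fun j _ =>
    selfNormalized_tail hm he hs hexp (hw j) hx hv).trans (le_of_eq ?_)
  rw [nsmul_eq_mul, ENNReal.ofReal_mul (by positivity)]
  simp

/-- Passes from the population to the sample: agents outside the image receive the trivial event
`univ`. -/
lemma CondIndepFamily.comp_injective {Ω ι κ : Type*} {m : MeasurableSpace Ω} [MeasurableSpace Ω]
    {P : Measure Ω} {f : ι → Ω → ℝ} (h : CondIndepFamily P m f) {g : κ → ι}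
    (hg : Function.Injective g) : CondIndepFamily P m fun j => f (g j) := by
  classical
  intro s B hB
  set B' : ι → Set ℝ := Function.extend g B fun _ => univ with hB'
  have hBg : ∀ j, B' (g j) = B j := fun j => hg.extend_apply _ _ _
  have := h (s.map ⟨g, hg⟩) B' fun i => by
    by_cases hi : ∃ j, g j = i
    · obtain ⟨j, rfl⟩ := hi
      rw [hBg]; exact hB j
    · rw [hB', Function.extend_apply' _ _ _ hi]; exact MeasurableSet.univ
  simpa [hBg, Finset.prod_map] using this

end Tail

namespace Setup

variable {dx dz d : ℕ} {Ω : ℕ → Type*} [∀ k, MeasurableSpace (Ω k)] {M : Setup dx dz d Ω}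

/-- The centred disturbances `ε_i - λ(U_i, V_i)`. -/
noncomputable def err (M : Setup dx dz d Ω) (k : ℕ) (i : Fin (M.n k)) (ω : Ω k) : ℝ :=
  M.eps k (M.sub k i) ω - M.lam (M.U k (M.sub k i) ω) (M.V k (M.sub k i) ω)

lemma measurable_lam_UV (hF : M.Framework) (hA : M.ApproxCond) {k : ℕ} (i : Fin (M.n k)) :
    Measurable[M.sigmaF k] (fun ω => M.lam (M.U k (M.sub k i) ω) (M.V k (M.sub k i) ω)) :=
  measurable_comp_of_continuousOn ((localMeas_sigmaF (M.sub k i)).measurable_UV hF)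
    (UV_mem hF k _) hA.lam_smooth.continuousOn

lemma measurable_err (hF : M.Framework) (hA : M.ApproxCond) {k : ℕ} (i : Fin (M.n k)) :
    Measurable (M.err k i) :=
  (hF.meas_eps k _).sub ((measurable_lam_UV hF hA i).mono (sigmaF_le hF k) le_rfl)

/-- Conditional moment and exponential inequalities for the centred disturbances. -/
theorem exists_err_bounds (hF : M.Framework) (hE : M.ErrorCond) (hA : M.ApproxCond) :
    ∃ (C : ℝ) (s : ∀ k, Fin (M.n k) → Ω k → ℝ), 1 ≤ C ∧ ∀ k,
      (∀ i, Measurable[M.sigmaF k] (s k i)) ∧ (∀ i ω, 0 ≤ s k i ω ∧ s k i ω ≤ C) ∧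
      (∀ w : Fin (M.n k) → Ω k → ℝ, (∀ i, Measurable[M.sigmaF k] (w i)) →
        ∫⁻ ω, ENNReal.ofReal (Real.exp (∑ i, (w i ω * M.err k i ω -
          w i ω ^ 2 / 6 * (M.err k i ω ^ 2 + 2 * s k i ω)))) ∂M.P k ≤ 1) ∧
      (∀ c : Fin (M.n k) → Ω k → ℝ, (∀ i, Measurable[M.sigmaF k] (c i)) →
        ∫⁻ ω, ENNReal.ofReal ((∑ i, c i ω * M.err k i ω) ^ 2) ∂M.P k ≤
          ∫⁻ ω, ENNReal.ofReal (C * ∑ i, c i ω ^ 2) ∂M.P k) ∧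
      (∀ c : Fin (M.n k) → Ω k → ℝ, (∀ i, Measurable[M.sigmaF k] (c i)) →
        ∫⁻ ω, ENNReal.ofReal ((∑ i, c i ω * (M.err k i ω ^ 2 - s k i ω)) ^ 2) ∂M.P k ≤
          ∫⁻ ω, ENNReal.ofReal (C * ∑ i, c i ω ^ 2) ∂M.P k) := by
  obtain ⟨C₀, hC₀⟩ := hE.moment
  set C := max C₀ 0 with hC
  have hC0 : 0 ≤ C := le_max_right _ _
  have key := fun k => by
    have := hF.prob k
    exact condIndep_inequalities (sigmaF_le hF k) (P := M.P k)
      (ε := fun i : Fin (M.n k) => M.eps k (M.sub k i)) (fun i => hF.meas_eps k _)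
      ((hE.indep k).comp_injective (sub_injective k)) (fun i => measurable_lam_UV hF hA i)
      (fun i => (hE.mean k _).trans (hF.eps_UV k i)) (fun i => hE.moment_int k _) hC0
      (fun i => (hC₀ k _).mono fun ω h => h.trans (le_max_left _ _))
  choose s h1 h2 h3 h4 h5 using key
  refine ⟨8 * C + 2 * (1 + C) ^ 2, s, by nlinarith, fun k => ⟨h1 k, fun i ω => ⟨(h2 k i ω).1,
    (h2 k i ω).2.trans (by nlinarith)⟩, h3 k, h4 k, h5 k⟩⟩

end Setup

end Spillover

/-! ### The noise score and the event on which all stochastic terms behave. -/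

namespace Spillover

set_option linter.unusedSectionVars false

namespace Setup

variable {dx dz d : ℕ} {Ω : ℕ → Type*} [∀ k, MeasurableSpace (Ω k)] {M : Setup dx dz d Ω}

/-- The value of `g` at the treatment and exposure of the `i`-th sampled agent. -/
noncomputable def gTS (M : Setup dx dz d Ω) (k : ℕ) (ω : Ω k) (i : Fin (M.n k)) : ℝ :=
  M.g (M.T k (M.sub k i) ω) (M.S k (M.sub k i) ω)

/-- The noise score `Π̂ᵀ (g e)`. -/
noncomputable def noise (M : Setup dx dz d Ω) (k : ℕ) (ω : Ω k) : M.Idx k → ℝ :=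
  (M.RegHat k ω)ᵀ *ᵥ fun i => M.gTS k ω i * M.err k i ω

/-- The centred conditional variance matrix of the noise score. -/
noncomputable def noiseVar (M : Setup dx dz d Ω) (s : ∀ k, Fin (M.n k) → Ω k → ℝ) (k : ℕ)
    (ω : Ω k) : Matrix (M.Idx k) (M.Idx k) ℝ :=
  Matrix.of fun a b => ∑ i, M.RegHat k ω i a * M.RegHat k ω i b * M.gTS k ω i ^ 2 *
    (M.err k i ω ^ 2 - s k i ω)

lemma measurable_gTS (hF : M.Framework) (hA : M.ApproxCond) {k : ℕ} (i : Fin (M.n k)) :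
    Measurable[M.sigmaF k] (fun ω => M.gTS k ω i) := by
  have h := localMeas_sigmaF (M := M) (M.sub k i)
  exact measurable_comp_of_continuousOn ((h.measurable_T hF).prodMk (h.measurable_S hF))
    (TS_mem hF k i) hA.g_smooth.continuousOn

lemma measurable_noise (hF : M.Framework) (hB : M.BasisCond) (hA : M.ApproxCond) {k : ℕ}
    (a : M.Idx k) : Measurable (fun ω => M.noise k ω a) := by
  change Measurable fun ω => ∑ i, M.RegHat k ω i a * (M.gTS k ω i * M.err k i ω)
  exact Finset.measurable_sum _ fun i _ => ((measurable_RegHat hF hB k i a).mono (sigmaF_le hF k) le_rfl).mul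
    (((measurable_gTS hF hA i).mono (sigmaF_le hF k) le_rfl).mul (measurable_err hF hA i))

/-- Second moment bounds for the noise score and its centred conditional variance matrix. -/
theorem exists_noise_bound (hF : M.Framework) (hM : M.MixingCond) (hB : M.BasisCond)
    (hA : M.ApproxCond) {C : ℝ} {s : ∀ k, Fin (M.n k) → Ω k → ℝ} (hC : 1 ≤ C)
    (hs : ∀ k i, Measurable[M.sigmaF k] (s k i))
    (h1 : ∀ k, ∀ c : Fin (M.n k) → Ω k → ℝ, (∀ i, Measurable[M.sigmaF k] (c i)) →
        ∫⁻ ω, ENNReal.ofReal ((∑ i, c i ω * M.err k i ω) ^ 2) ∂M.P k ≤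
          ∫⁻ ω, ENNReal.ofReal (C * ∑ i, c i ω ^ 2) ∂M.P k)
    (h2 : ∀ k, ∀ c : Fin (M.n k) → Ω k → ℝ, (∀ i, Measurable[M.sigmaF k] (c i)) →
        ∫⁻ ω, ENNReal.ofReal ((∑ i, c i ω * (M.err k i ω ^ 2 - s k i ω)) ^ 2) ∂M.P k ≤
          ∫⁻ ω, ENNReal.ofReal (C * ∑ i, c i ω ^ 2) ∂M.P k) :
    ∃ B : ℝ, 0 ≤ B ∧ ∀ k,
      Measurable (fun ω => eucl (M.noise k ω) ^ 2) ∧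
      Measurable (fun ω => ∑ a, ∑ b, M.noiseVar s k ω a b ^ 2) ∧
      ∫⁻ ω, ENNReal.ofReal (eucl (M.noise k ω) ^ 2) ∂M.P k ≤
        ENNReal.ofReal (Fintype.card (M.Idx k) * (B * M.n k)) ∧
      ∫⁻ ω, ENNReal.ofReal (∑ a, ∑ b, M.noiseVar s k ω a b ^ 2) ∂M.P k ≤
        ENNReal.ofReal ((Fintype.card (M.Idx k) : ℝ) ^ 2 * (B * M.n k)) := by
  obtain ⟨D, hD1, hT, hU, -⟩ := exists_basis_bound hB
  obtain ⟨CX, hCX0, hCX⟩ := exists_X_bound hM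
  obtain ⟨Gb, hG1, hG⟩ := exists_g_bound hA
  set R := CX * D + 2 * D ^ 2 with hR
  have hR0 : 0 ≤ R := by positivity
  refine ⟨C * (R * Gb) ^ 2 + C * (R * R * Gb ^ 2) ^ 2, by positivity, fun k => ?_⟩
  have := hF.prob k
  have hRm := fun i a => measurable_RegHat hF hB k i a
  have hgm := fun i => measurable_gTS hF hA (k := k) i
  have hle := sigmaF_le hF k
  have hRb : ∀ᵐ ω ∂M.P k, ∀ i a, |M.RegHat k ω i a| ≤ R := by
    filter_upwards [hCX k] with ω hX i a
    exact abs_RegHat_le hF (by linarith) (hT k) (hU k) hX i a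
  have hgb : ∀ ω i, |M.gTS k ω i| ≤ Gb := fun ω i => hG _ (TS_mem hF k i ω)
  have avg : ∀ (c : Fin (M.n k) → Ω k → ℝ) (b : ℝ), (∀ᵐ ω ∂M.P k, ∀ i, |c i ω| ≤ b) →
      ∫⁻ ω, ENNReal.ofReal (C * ∑ i, c i ω ^ 2) ∂M.P k ≤ ENNReal.ofReal (C * b ^ 2 * M.n k) := by
    intro c b hc
    calc _ ≤ ∫⁻ _ω, ENNReal.ofReal (C * b ^ 2 * M.n k) ∂M.P k := by
          refine lintegral_mono_ae ?_
          filter_upwards [hc] with ω h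
          apply ENNReal.ofReal_le_ofReal
          have : ∑ i, c i ω ^ 2 ≤ ∑ _i : Fin (M.n k), b ^ 2 := Finset.sum_le_sum fun i _ => by
            rw [← sq_abs]; exact pow_le_pow_left₀ (abs_nonneg _) (h i) 2
          simp only [Finset.sum_const, Finset.card_univ, Fintype.card_fin, nsmul_eq_mul] at this
          calc C * ∑ i, c i ω ^ 2 ≤ C * (M.n k * b ^ 2) := by gcongr
            _ = _ := by ring
      _ = _ := by simp
  have m1 : ∀ a, Measurable (fun ω => M.noise k ω a ^ 2) := fun a =>
    (measurable_noise hF hB hA a).pow_const 2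
  have m2 : ∀ c : M.Idx k × M.Idx k, Measurable (fun ω => M.noiseVar s k ω c.1 c.2 ^ 2) := fun c => by
    change Measurable fun ω => (∑ i, M.RegHat k ω i c.1 * M.RegHat k ω i c.2 * M.gTS k ω i ^ 2 *
      (M.err k i ω ^ 2 - s k i ω)) ^ 2
    exact (Finset.measurable_sum _ fun i _ => ((((hRm i c.1).mul (hRm i c.2)).mul
      ((hgm i).pow_const 2)).mono hle le_rfl).mul
      (((measurable_err hF hA i).pow_const 2).sub ((hs k i).mono hle le_rfl))).pow_const 2
  have b1 : ∀ a, ∫⁻ ω, ENNReal.ofReal (M.noise k ω a ^ 2) ∂M.P k ≤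
      ENNReal.ofReal ((C * (R * Gb) ^ 2 + C * (R * R * Gb ^ 2) ^ 2) * M.n k) := by
    intro a
    have e : ∀ ω, M.noise k ω a = ∑ i, (M.RegHat k ω i a * M.gTS k ω i) * M.err k i ω := fun ω => by
      simp only [noise, Matrix.mulVec, dotProduct, Matrix.transpose_apply, mul_assoc]
    simp_rw [e]
    refine (h1 k (fun i ω => M.RegHat k ω i a * M.gTS k ω i) fun i => (hRm i a).mul (hgm i)).trans
      ((avg _ (R * Gb) ?_).trans (ENNReal.ofReal_le_ofReal ?_))
    · filter_upwards [hRb] with ω h i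
      rw [abs_mul]
      exact mul_le_mul (h i a) (hgb ω i) (abs_nonneg _) hR0
    · gcongr
      have : 0 ≤ C * (R * R * Gb ^ 2) ^ 2 := by positivity
      linarith
  have b2 : ∀ c : M.Idx k × M.Idx k, ∫⁻ ω, ENNReal.ofReal (M.noiseVar s k ω c.1 c.2 ^ 2) ∂M.P k ≤
      ENNReal.ofReal ((C * (R * Gb) ^ 2 + C * (R * R * Gb ^ 2) ^ 2) * M.n k) := by
    intro c
    refine (h2 k (fun i ω => M.RegHat k ω i c.1 * M.RegHat k ω i c.2 * M.gTS k ω i ^ 2) fun i =>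
      ((hRm i c.1).mul (hRm i c.2)).mul ((hgm i).pow_const 2)).trans
      ((avg _ (R * R * Gb ^ 2) ?_).trans (ENNReal.ofReal_le_ofReal ?_))
    · filter_upwards [hRb] with ω h i
      rw [abs_mul, abs_mul, abs_pow]
      exact mul_le_mul (mul_le_mul (h i _) (h i _) (abs_nonneg _) hR0)
        (pow_le_pow_left₀ (abs_nonneg _) (hgb ω i) 2) (by positivity) (by positivity)
    · gcongr
      have : 0 ≤ C * (R * Gb) ^ 2 := by positivity
      linarith
  refine ⟨?_, ?_, ?_, ?_⟩
  · simp_rw [eucl_sq]; exact Finset.measurable_sum _ fun a _ => m1 a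
  · exact Finset.measurable_sum _ fun a _ => Finset.measurable_sum _ fun b _ => m2 (a, b)
  · simp_rw [eucl_sq]
    exact lintegral_ofReal_sum_le m1 (fun _ _ => sq_nonneg _) b1
  · have := lintegral_ofReal_sum_le (P := M.P k)
      (f := fun (c : M.Idx k × M.Idx k) ω => M.noiseVar s k ω c.1 c.2 ^ 2)
      m2 (fun _ _ => sq_nonneg _) b2
    simp_rw [Fintype.sum_prod_type] at this
    refine this.trans (le_of_eq ?_)
    rw [Fintype.card_prod, Nat.cast_mul, sq (Fintype.card (M.Idx k) : ℝ)]

/-- Orders of magnitude of the numbers of series terms. -/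
lemma exists_size (hF : M.Framework) : ∃ c : ℝ, 1 ≤ c ∧ ∀ᶠ k in atTop,
    0 < M.n k ∧ 1 ≤ M.kap k ∧ 1 ≤ Real.log (M.kap k) ∧
    M.kap k ≤ c * M.KTS k ∧ M.KTS k ≤ c * M.kap k ∧
    M.kap k ≤ c * M.KUV k ∧ M.KUV k ≤ c * M.kap k ∧
    (Fintype.card (M.Idx k) : ℝ) ≤ c * M.kap k ^ 2 := by
  obtain ⟨a₁, a₂, ha, h1⟩ := hF.kap_TS
  obtain ⟨b₁, b₂, hb, h2⟩ := hF.kap_UV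
  set e := |a₂| + |b₂| + 1 / a₁ + 1 / b₁ + 1 with he
  have p1 : 0 < 1 / a₁ := by positivity
  have p2 : 0 < 1 / b₁ := by positivity
  have he1 : 1 ≤ e := by have := abs_nonneg a₂; have := abs_nonneg b₂; linarith
  have he2 : e ≤ dx * e + e ^ 2 := by
    have : (0 : ℝ) ≤ dx * e := by positivity
    nlinarith
  have ea : a₂ ≤ e := by have := le_abs_self a₂; have := abs_nonneg b₂; linarith
  have eb : b₂ ≤ e := by have := le_abs_self b₂; have := abs_nonneg a₂; linarith
  have ea1 : 1 / a₁ ≤ e := by have := abs_nonneg a₂; have := abs_nonneg b₂; linarith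
  have eb1 : 1 / b₁ ≤ e := by have := abs_nonneg a₂; have := abs_nonneg b₂; linarith
  refine ⟨dx * e + e ^ 2, by linarith, ?_⟩
  -- The threshold `exp 1` gives `1 ≤ log κ`, which later lets `1/√n` be absorbed into the
  -- stochastic rate.
  filter_upwards [h1, h2, hF.kap_tendsto.eventually_ge_atTop (Real.exp 1),
    hF.n_tendsto.eventually_gt_atTop 0] with k h1 h2 hk hn
  have hk1 : 1 ≤ M.kap k := by have := Real.add_one_le_exp (1 : ℝ); linarith
  have hk0 : 0 < M.kap k := by linarith
  have t1 : (M.KTS k : ℝ) ≤ e * M.kap k := h1.2.trans (by gcongr)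
  have t2 : (M.KUV k : ℝ) ≤ e * M.kap k := h2.2.trans (by gcongr)
  have t3 : M.kap k ≤ e * M.KTS k := by
    have : M.kap k ≤ 1 / a₁ * M.KTS k := by
      rw [one_div, ← div_eq_inv_mul, le_div_iff₀ ha]; linarith [h1.1]
    exact this.trans (by gcongr)
  have t4 : M.kap k ≤ e * M.KUV k := by
    have : M.kap k ≤ 1 / b₁ * M.KUV k := by
      rw [one_div, ← div_eq_inv_mul, le_div_iff₀ hb]; linarith [h2.1]
    exact this.trans (by gcongr)
  have up : ∀ x : ℝ, 0 ≤ x → e * x ≤ (dx * e + e ^ 2) * x := fun x hx => by gcongr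
  refine ⟨hn, hk1, ?_, t3.trans (up _ (by positivity)), t1.trans (up _ hk0.le),
    t4.trans (up _ (by positivity)), t2.trans (up _ hk0.le), ?_⟩
  · rw [← Real.log_exp 1]; exact Real.log_le_log (Real.exp_pos 1) hk
  · have hc : (Fintype.card (M.Idx k) : ℝ) = dx * M.KTS k + M.KTS k * M.KUV k := by
      simp [Idx, IdxTS, IdxUV, KTS, KUV]
    rw [hc]
    calc (dx : ℝ) * M.KTS k + M.KTS k * M.KUV k ≤ dx * (e * M.kap k) + e * M.kap k * (e * M.kap k) := by
          gcongr
      _ = dx * e * M.kap k + e ^ 2 * M.kap k ^ 2 := by ring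
      _ ≤ dx * e * M.kap k ^ 2 + e ^ 2 * M.kap k ^ 2 := by
          gcongr
          nlinarith
      _ = _ := by ring

/-- The event on which all stochastic terms have their expected order. -/
structure Good (M : Setup dx dz d Ω) (s : ∀ k, Fin (M.n k) → Ω k → ℝ) (c K : ℝ) (k : ℕ)
    (ω : Ω k) : Prop where
  X : ∀ i, eucl (M.X k i ω) ≤ K
  U : ∀ i, |M.Uhat k i ω - M.U k i ω| ≤ K * M.nNu k
  V : ∀ i, |M.Vhat k i ω - M.V k i ω| ≤ K * M.nNu k
  lamAvg : |M.lamAvg k ω| ≤ K * M.nNu k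
  ctr : eucl (M.ctrTrue k ω) ≤ K * √(M.kap k / M.n k)
  gram : ∑ a, ∑ b, M.gramDev k ω a b ^ 2 ≤ (c / 2) ^ 2
  noise : eucl (M.noise k ω) ≤ K * (M.kap k * √(M.n k : ℝ))
  nvar : ∑ a, ∑ b, M.noiseVar s k ω a b ^ 2 ≤ (M.n k : ℝ) ^ 2

lemma nNu_nonneg (k : ℕ) : 0 ≤ M.nNu k := Real.rpow_nonneg (by positivity) _

lemma measurable_lamAvg (hF : M.Framework) (hA : M.ApproxCond) (k : ℕ) :
    Measurable (M.lamAvg k) :=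
  (Finset.measurable_sum _ fun i _ =>
    (measurable_lam_UV hF hA i).mono (sigmaF_le hF k) le_rfl).const_mul _

lemma measurable_ctrTrue (hF : M.Framework) (hB : M.BasisCond) (k : ℕ) (b : M.IdxUV k) :
    Measurable (fun ω => M.ctrTrue k ω b) :=
  ((Finset.measurable_sum _ fun i _ => (measurable_comp_of_continuousOn
    ((localMeas_sigmaF (M.sub k i)).measurable_UV hF) (UV_mem hF k _)
    (continuousOn_PUV hB k b)).mono (sigmaF_le hF k) le_rfl).const_mul _).sub_const _

lemma measurable_gramDev (hF : M.Framework) (hB : M.BasisCond) (k : ℕ) (a b : M.Idx k) :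
    Measurable (fun ω => M.gramDev k ω a b) :=
  ((Finset.measurable_sum _ fun i _ => (((localMeas_sigmaF (M.sub k i)).measurable_Reg hF hB a).mul
    ((localMeas_sigmaF (M.sub k i)).measurable_Reg hF hB b)).mono
      (sigmaF_le hF k) le_rfl).const_mul _).sub_const _

/-- Markov's inequality for the quantities with known second moments, and the assumed rates for the
control variables. The bounds on `gramDev` and `noiseVar` need no constant `K`: their expected
squared Frobenius norms are `O(κ⁴/n)` and `n² · O(κ⁴/n)`, so any fixed multiple of `1` and of `n²`
is eventually enough. -/
theorem exists_good (hF : M.Framework) (hS : M.SpaceCond) (hM : M.MixingCond) (hB : M.BasisCond)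
    (hA : M.ApproxCond) (hCo : M.ControlCond) (hG : M.GrowthCond)
    {C : ℝ} {s : ∀ k, Fin (M.n k) → Ω k → ℝ} (hC : 1 ≤ C)
    (hs : ∀ k i, Measurable[M.sigmaF k] (s k i))
    (h1 : ∀ k, ∀ c : Fin (M.n k) → Ω k → ℝ, (∀ i, Measurable[M.sigmaF k] (c i)) →
        ∫⁻ ω, ENNReal.ofReal ((∑ i, c i ω * M.err k i ω) ^ 2) ∂M.P k ≤
          ∫⁻ ω, ENNReal.ofReal (C * ∑ i, c i ω ^ 2) ∂M.P k)
    (h2 : ∀ k, ∀ c : Fin (M.n k) → Ω k → ℝ, (∀ i, Measurable[M.sigmaF k] (c i)) →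
        ∫⁻ ω, ENNReal.ofReal ((∑ i, c i ω * (M.err k i ω ^ 2 - s k i ω)) ^ 2) ∂M.P k ≤
          ∫⁻ ω, ENNReal.ofReal (C * ∑ i, c i ω ^ 2) ∂M.P k)
    {c : ℝ} (hc : 0 < c) {δ : ℝ} (hδ : 0 < δ) :
    ∃ K : ℝ, 1 ≤ K ∧ Whp M.P δ (M.Good s c K) := by
  obtain ⟨e, he1, hsize⟩ := exists_size hF
  obtain ⟨CX, hCX0, hCX⟩ := exists_X_bound hM
  obtain ⟨B₁, hB₁0, hB₁⟩ := exists_lamAvg_bound hF hS hM hA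
  obtain ⟨B₂, hB₂0, hB₂⟩ := exists_ctrTrue_bound hF hS hM hB
  obtain ⟨B₃, hB₃0, hB₃⟩ := exists_gramDev_bound hF hS hM hB
  obtain ⟨B₄, hB₄0, hB₄⟩ := exists_noise_bound hF hM hB hA hC hs h1 h2
  -- Seven events may fail; the bound on the covariates holds almost surely and costs nothing.
  set η := δ / 7 with hη
  have hη0 : 0 < η := by positivity
  obtain ⟨KU, hKU0, wU⟩ := whp_of_isBigOP hCo.Uhat_rate hη0
  obtain ⟨KV, hKV0, wV⟩ := whp_of_isBigOP hCo.Vhat_rate hη0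
  have wX : Whp M.P 0 fun k ω => ∀ i, eucl (M.X k i ω) ≤ CX :=
    Whp.of_ae (Eventually.of_forall hCX)
  have w1 : Whp M.P η fun k ω => M.lamAvg k ω ^ 2 ≤ (B₁ / η + 1) / M.n k := by
    refine Whp.of_lintegral ?_
    filter_upwards [hsize] with k ⟨hn, _⟩
    have hn' : (0 : ℝ) < M.n k := by exact_mod_cast hn
    refine ⟨by positivity, (measurable_lamAvg hF hA k).pow_const 2, (hB₁ k hn).trans
      (ENNReal.ofReal_le_ofReal ?_)⟩
    rw [← mul_div_assoc, mul_add, mul_div_cancel₀ _ hη0.ne']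
    gcongr
    linarith
  have w2 : Whp M.P η fun k ω => eucl (M.ctrTrue k ω) ^ 2 ≤ (e * B₂ / η + 1) * (M.kap k / M.n k) := by
    refine Whp.of_lintegral ?_
    filter_upwards [hsize] with k ⟨hn, hk, _, _, _, _, hUV, _⟩
    have hn' : (0 : ℝ) < M.n k := by exact_mod_cast hn
    have hk0 : 0 < M.kap k := by linarith
    refine ⟨by positivity, ?_, (hB₂ k hn).trans (ENNReal.ofReal_le_ofReal ?_)⟩
    · simp_rw [eucl_sq]
      exact Finset.measurable_sum _ fun b _ => (measurable_ctrTrue hF hB k b).pow_const 2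
    · calc (M.KUV k : ℝ) * (B₂ / M.n k) ≤ e * M.kap k * (B₂ / M.n k) := by gcongr
        _ = e * B₂ * (M.kap k / M.n k) := by ring
        _ ≤ (e * B₂ + η) * (M.kap k / M.n k) := by gcongr; linarith
        _ = _ := by field_simp
  have hk4 := hG.kap4
  have hnat : ∀ᶠ k in atTop, (M.n k : ℝ) > 0 := by
    filter_upwards [hF.n_tendsto.eventually_gt_atTop 0] with k hk
    exact_mod_cast hk
  have w3 : Whp M.P η fun k ω => ∑ a, ∑ b, M.gramDev k ω a b ^ 2 ≤ (c / 2) ^ 2 := by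
    refine Whp.of_lintegral ?_
    have hlim : Tendsto (fun k => e ^ 2 * B₃ * (M.kap k ^ 4 / M.n k)) atTop (𝓝 0) := by
      simpa using hk4.const_mul (e ^ 2 * B₃)
    filter_upwards [hsize, hlim.eventually_le_const (u := η * (c / 2) ^ 2) (by positivity)]
      with k ⟨hn, hk, _, _, _, _, _, hI⟩ hl
    have hn' : (0 : ℝ) < M.n k := by exact_mod_cast hn
    refine ⟨by positivity, ?_, (hB₃ k hn).trans (ENNReal.ofReal_le_ofReal (le_trans ?_ hl))⟩
    · exact Finset.measurable_sum _ fun a _ => Finset.measurable_sum _ fun b _ =>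
        (measurable_gramDev hF hB k a b).pow_const 2
    · calc (Fintype.card (M.Idx k) : ℝ) ^ 2 * (B₃ / M.n k)
          ≤ (e * M.kap k ^ 2) ^ 2 * (B₃ / M.n k) := by gcongr
        _ = _ := by ring
  have w4 : Whp M.P η fun k ω => eucl (M.noise k ω) ^ 2 ≤
      (e * B₄ / η + 1) * (M.kap k ^ 2 * M.n k) := by
    refine Whp.of_lintegral ?_
    filter_upwards [hsize] with k ⟨hn, hk, _, _, _, _, _, hI⟩
    have hn' : (0 : ℝ) < M.n k := by exact_mod_cast hn
    have hk0 : 0 < M.kap k := by linarith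
    obtain ⟨m1, -, b1, -⟩ := hB₄ k
    refine ⟨by positivity, m1, b1.trans (ENNReal.ofReal_le_ofReal ?_)⟩
    calc (Fintype.card (M.Idx k) : ℝ) * (B₄ * M.n k) ≤ e * M.kap k ^ 2 * (B₄ * M.n k) := by gcongr
      _ = e * B₄ * (M.kap k ^ 2 * M.n k) := by ring
      _ ≤ (e * B₄ + η) * (M.kap k ^ 2 * M.n k) := by gcongr; linarith
      _ = _ := by field_simp
  have w5 : Whp M.P η fun k ω => ∑ a, ∑ b, M.noiseVar s k ω a b ^ 2 ≤ (M.n k : ℝ) ^ 2 := by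
    refine Whp.of_lintegral ?_
    have hlim : Tendsto (fun k => e ^ 2 * B₄ * (M.kap k ^ 4 / M.n k)) atTop (𝓝 0) := by
      simpa using hk4.const_mul (e ^ 2 * B₄)
    filter_upwards [hsize, hlim.eventually_le_const (u := η) hη0]
      with k ⟨hn, hk, _, _, _, _, _, hI⟩ hl
    have hn' : (0 : ℝ) < M.n k := by exact_mod_cast hn
    obtain ⟨-, m2, -, b2⟩ := hB₄ k
    refine ⟨by positivity, m2, b2.trans (ENNReal.ofReal_le_ofReal ?_)⟩
    calc (Fintype.card (M.Idx k) : ℝ) ^ 2 * (B₄ * M.n k)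
          ≤ (e * M.kap k ^ 2) ^ 2 * (B₄ * M.n k) := by gcongr
        _ = e ^ 2 * B₄ * (M.kap k ^ 4 / M.n k) * M.n k ^ 2 := by field_simp
        _ ≤ η * M.n k ^ 2 := by gcongr
  have hall := ((((((wX.and wU le_rfl hη0.le).and wV (by positivity) hη0.le).and w1 (by positivity)
    hη0.le).and w2 (by positivity) hη0.le).and w3 (by positivity) hη0.le).and w4 (by positivity)
    hη0.le).and w5 (by positivity) hη0.le
  have hδe : 0 + η + η + η + η + η + η + η = δ := by rw [hη]; ring
  rw [hδe] at hall
  have q1 : 0 ≤ B₁ / η := by positivity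
  have q2 : 0 ≤ e * B₂ / η := by positivity
  have q4 : 0 ≤ e * B₄ / η := by positivity
  set K := CX + KU + KV + (B₁ / η + 1) + (e * B₂ / η + 1) + (e * B₄ / η + 1) with hK
  refine ⟨K, by linarith, hall.mono ?_⟩
  have sqrt_le : ∀ x : ℝ, 1 ≤ x → √x ≤ x := fun x hx => by
    rw [Real.sqrt_le_left (by linarith)]; nlinarith
  filter_upwards [hsize] with k ⟨hn, hk, _⟩ ω ⟨⟨⟨⟨⟨⟨⟨gX, gU⟩, gV⟩, g1⟩, g2⟩, g3⟩, g4⟩, g5⟩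
  have hn' : (0 : ℝ) < M.n k := by exact_mod_cast hn
  have hk0 : 0 < M.kap k := by linarith
  have hnu := nNu_nonneg (M := M) k
  have sup : ∀ (f : Fin (M.popSize k) → ℝ) (A : ℝ), 0 ≤ A → A ≤ K →
      ⨆ i, ‖f i‖ₑ ≤ ENNReal.ofReal (A * M.nNu k) → ∀ i, |f i| ≤ K * M.nNu k := by
    intro f A hA0 hA h i
    have h3 := (le_iSup (fun i => ‖f i‖ₑ) i).trans h
    rw [Real.enorm_eq_ofReal_abs, ENNReal.ofReal_le_ofReal_iff (by positivity)] at h3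
    exact h3.trans (by gcongr)
  refine ⟨fun i => (gX i).trans (by linarith), sup _ KU hKU0.le (by linarith) gU,
    sup _ KV hKV0.le (by linarith) gV, ?_, ?_, g3, ?_, g5⟩
  · have h3 : |M.lamAvg k ω| ≤ √((B₁ / η + 1) / M.n k) := Real.abs_le_sqrt g1
    rw [Real.sqrt_div (by positivity)] at h3
    -- Here `ν ≤ 1/2` enters: the parametric rate is absorbed by that of the control variables.
    have h4 : 1 / √(M.n k : ℝ) ≤ M.nNu k := by
      rw [nNu, Real.sqrt_eq_rpow, one_div, ← Real.rpow_neg hn'.le]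
      exact Real.rpow_le_rpow_of_exponent_le (by exact_mod_cast hn) (by linarith [hCo.nu_le])
    calc _ ≤ _ := h3
      _ = √(B₁ / η + 1) * (1 / √(M.n k : ℝ)) := by ring
      _ ≤ K * M.nNu k := mul_le_mul ((sqrt_le _ (by linarith)).trans (by linarith)) h4
          (by positivity) (by linarith)
  · have h3 := Real.le_sqrt_of_sq_le g2
    rw [Real.sqrt_mul (by positivity)] at h3
    exact h3.trans (mul_le_mul_of_nonneg_right ((sqrt_le _ (by linarith)).trans (by linarith))
      (Real.sqrt_nonneg _))
  · have h3 := Real.le_sqrt_of_sq_le g4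
    rw [Real.sqrt_mul (by positivity), Real.sqrt_mul (by positivity), Real.sqrt_sq hk0.le] at h3
    exact h3.trans (mul_le_mul_of_nonneg_right ((sqrt_le _ (by linarith)).trans (by linarith))
      (by positivity))

end Setup

end Spillover

/-! ### The smallest eigenvalue of the feasible design. -/

namespace Spillover

set_option linter.unusedSectionVars false

lemma eucl_sum_le {ι κ : Type*} [Fintype ι] (s : Finset κ) (f : κ → ι → ℝ) :
    eucl (∑ j ∈ s, f j) ≤ ∑ j ∈ s, eucl (f j) := by
  classical
  induction s using Finset.induction_on with
  | empty => simp [eucl_zero]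
  | insert a s ha ih =>
    rw [Finset.sum_insert ha, Finset.sum_insert ha]
    exact (eucl_add_le _ _).trans (by gcongr)

lemma eucl_average_le {ι : Type*} [Fintype ι] {n : ℕ} (hn : 0 < n) {f : Fin n → ι → ℝ} {b : ℝ}
    (h : ∀ i, eucl (f i) ≤ b) : eucl ((1 / (n : ℝ)) • ∑ i, f i) ≤ b := by
  have hn' : (0 : ℝ) < n := by exact_mod_cast hn
  rw [eucl_smul, abs_of_pos (by positivity)]
  calc 1 / (n : ℝ) * eucl (∑ i, f i) ≤ 1 / (n : ℝ) * ∑ _i : Fin n, b := by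
        gcongr
        exact (eucl_sum_le _ _).trans (Finset.sum_le_sum fun i _ => h i)
    _ = b := by
        simp only [Finset.sum_const, Finset.card_univ, Fintype.card_fin, nsmul_eq_mul]
        field_simp

/-- A perturbation of the rows of a design matrix preserves the lower bound on its singular
values up to a constant. -/
lemma eucl_mulVec_sq_ge_of_row_sub {n ι : Type*} [Fintype n] [Fintype ι] {A B : Matrix n ι ℝ}
    {ε : ℝ} (h : ∀ i, eucl (A i - B i) ≤ ε) (x : ι → ℝ) :
    eucl (B *ᵥ x) ^ 2 / 2 - Fintype.card n * ε ^ 2 * eucl x ^ 2 ≤ eucl (A *ᵥ x) ^ 2 := by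
  have h1 : ∀ i, (B *ᵥ x) i ^ 2 / 2 - ε ^ 2 * eucl x ^ 2 ≤ (A *ᵥ x) i ^ 2 := by
    intro i
    have e : (A *ᵥ x) i = (B *ᵥ x) i + (A i - B i) ⬝ᵥ x := by
      simp [Matrix.mulVec, sub_dotProduct]
    have h2 := (abs_dotProduct_le (A i - B i) x).trans
      (mul_le_mul_of_nonneg_right (h i) (eucl_nonneg x))
    have h3 := sq_le_sq' (abs_le.1 h2).1 (abs_le.1 h2).2
    rw [e]
    rw [mul_pow] at h3
    -- With `b` the old value and `δ` the change, `(b + δ)² - b²/2 + δ² = (b + 2δ)²/2`.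
    nlinarith [sq_nonneg ((B *ᵥ x) i + 2 * ((A i - B i) ⬝ᵥ x))]
  rw [eucl_sq (B *ᵥ x), eucl_sq (A *ᵥ x)]
  calc _ = ∑ i, ((B *ᵥ x) i ^ 2 / 2 - ε ^ 2 * eucl x ^ 2) := by
        simp only [Finset.sum_sub_distrib, Finset.sum_div, Finset.sum_const, Finset.card_univ,
          nsmul_eq_mul]
        ring
    _ ≤ _ := Finset.sum_le_sum fun i _ => h1 i

namespace Setup

variable {dx dz d : ℕ} {Ω : ℕ → Type*} [∀ k, MeasurableSpace (Ω k)] {M : Setup dx dz d Ω}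

/-- The change of the basis vector is `O(ζ_† n^{-ν})`. The factor `√κ` anticipates the
multiplication by `P_TS`, whose norm is of that order. -/
lemma eventually_PUV_hat_sub (hF : M.Framework) (hB : M.BasisCond) (hG : M.GrowthCond)
    {s : ∀ k, Fin (M.n k) → Ω k → ℝ} {c K ε : ℝ} (hε : 0 < ε) :
    ∀ᶠ k in atTop, ∀ ω, M.Good s c K k ω → ∀ i,
      √(M.kap k) * eucl (M.PUV k (M.Uhat k i ω) (M.Vhat k i ω) - M.PUV k (M.U k i ω) (M.V k i ω))
        ≤ ε := by
  obtain ⟨C, hC1, -, -, hL⟩ := exists_basis_bound hB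
  have hlim : Tendsto (fun k => C * K * (M.zetaDag k * √(M.kap k) * M.nNu k)) atTop (𝓝 0) := by
    simpa using hG.zeta.const_mul (C * K)
  filter_upwards [hlim.eventually_le_const hε] with k hk ω g i
  obtain ⟨z1, z2⟩ := zeta_nonneg hB k
  refine le_trans ?_ hk
  calc _ ≤ √(M.kap k) * (C * (M.zetaU k * √(M.KV k : ℝ) * (K * M.nNu k) +
        M.zetaV k * √(M.KU k : ℝ) * (K * M.nNu k))) := by
        gcongr
        refine (hL k _ (UVhat_mem hF k i ω) _ (UV_mem hF k i ω)).trans ?_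
        have := g.U i
        have := g.V i
        gcongr
    _ = _ := by rw [zetaDag]; ring

lemma ctr_eq (k : ℕ) (ω : Ω k) : M.ctr k ω = M.ctrTrue k ω + (1 / (M.n k : ℝ)) •
    ∑ i, (M.PUV k (M.Uhat k (M.sub k i) ω) (M.Vhat k (M.sub k i) ω) -
      M.PUV k (M.U k (M.sub k i) ω) (M.V k (M.sub k i) ω)) := by
  ext b
  simp only [ctr, ctrTrue, Pi.add_apply, Pi.smul_apply, Finset.sum_apply, Pi.sub_apply,
    smul_eq_mul, Finset.sum_sub_distrib]
  ring

/-- The centring error splits into a sampling error of order `√(κ/n)` and an average of changes of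
the basis vector. Multiplied by `√κ`, the first is `O(κ/√n)` and the second is small by the
preceding bound. -/
lemma eventually_ctr (hF : M.Framework) (hB : M.BasisCond) (hG : M.GrowthCond)
    {s : ∀ k, Fin (M.n k) → Ω k → ℝ} {c K ε : ℝ} (hK : 1 ≤ K) (hε : 0 < ε) :
    ∀ᶠ k in atTop, ∀ ω, M.Good s c K k ω → √(M.kap k) * eucl (M.ctr k ω) ≤ ε := by
  obtain ⟨e, he1, hsize⟩ := exists_size hF
  have hlim : Tendsto (fun k => K ^ 2 * (M.kap k ^ 4 / M.n k)) atTop (𝓝 0) := by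
    simpa using hG.kap4.const_mul (K ^ 2)
  filter_upwards [eventually_PUV_hat_sub hF hB hG (half_pos hε), hsize,
    hlim.eventually_le_const (u := (ε / 2) ^ 2) (by positivity)] with k h ⟨hn, hk, _⟩ hl ω g
  have hk0 : 0 < M.kap k := by linarith
  have hn' : (0 : ℝ) < M.n k := by exact_mod_cast hn
  have hs : 0 < √(M.kap k) := Real.sqrt_pos.2 hk0
  have h1 : √(M.kap k) * eucl (M.ctrTrue k ω) ≤ ε / 2 := by
    refine (mul_le_mul_of_nonneg_left g.ctr hs.le).trans (abs_le_of_sq_le_sq' ?_ (by positivity)).2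
    refine le_trans ?_ hl
    rw [mul_pow, mul_pow, Real.sq_sqrt hk0.le, Real.sq_sqrt (by positivity)]
    calc M.kap k * (K ^ 2 * (M.kap k / M.n k)) = K ^ 2 * (M.kap k ^ 2 / M.n k) := by ring
      _ ≤ _ := by gcongr; norm_num
  have h2 := eucl_average_le hn (f := fun i =>
    M.PUV k (M.Uhat k (M.sub k i) ω) (M.Vhat k (M.sub k i) ω) -
      M.PUV k (M.U k (M.sub k i) ω) (M.V k (M.sub k i) ω)) (b := ε / 2 / √(M.kap k))
    fun i => by rw [le_div_iff₀ hs, mul_comm]; exact h ω g _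
  rw [le_div_iff₀ hs] at h2
  rw [ctr_eq]
  calc _ ≤ √(M.kap k) * (eucl (M.ctrTrue k ω) + _) := by gcongr; exact eucl_add_le _ _
    _ ≤ _ := by linarith

lemma eucl_PTS_le {k : ℕ} {C e : ℝ} (hC : 0 ≤ C) (he : 1 ≤ e)
    (hT : ∀ p ∈ M.rect, ∀ a, |M.PTS k p.1 p.2 a| ≤ C) (hK : (M.KTS k : ℝ) ≤ e * M.kap k)
    {p : ℝ × ℝ} (hp : p ∈ M.rect) : eucl (M.PTS k p.1 p.2) ≤ C * e * √(M.kap k) := by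
  have h := eucl_le_of_abs_le hC (hT p hp)
  have hc : (Fintype.card (M.IdxTS k) : ℝ) = M.KTS k := by simp [IdxTS, KTS]
  rw [hc] at h
  have h2 : √(M.KTS k : ℝ) ≤ e * √(M.kap k) := by
    refine (Real.sqrt_le_sqrt hK).trans ?_
    rw [Real.sqrt_mul (by linarith)]
    gcongr
    rw [Real.sqrt_le_left (by linarith)]
    nlinarith
  calc _ ≤ _ := h
    _ ≤ C * (e * √(M.kap k)) := by gcongr
    _ = _ := by ring

/-- The covariate block does not involve the control variables, so the difference lies in the tensor
block, where norms multiply. -/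
lemma eucl_RegHat_sub (k : ℕ) (ω : Ω k) (i : Fin (M.n k)) :
    eucl (M.RegHat k ω i - M.Reg k ω i) =
      eucl (M.PTS k (M.T k (M.sub k i) ω) (M.S k (M.sub k i) ω)) *
        eucl ((M.PUV k (M.Uhat k (M.sub k i) ω) (M.Vhat k (M.sub k i) ω) -
          M.PUV k (M.U k (M.sub k i) ω) (M.V k (M.sub k i) ω)) - M.ctr k ω) := by
  refine Eq.trans ?_ ((eucl_sumElim_zero (ι := Fin dx × M.IdxTS k) _).trans (eucl_tensor _ _))
  refine congrArg (eucl (ι := M.Idx k)) (funext fun a => ?_)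
  rcases a with a | a
  · simp [RegHat, Reg]
  · simp only [RegHat, Reg, Matrix.of_apply, Pi.sub_apply, Sum.elim_inr, PUVhat_eq, PUVbar]
    ring

lemma eventually_RegHat_sub (hF : M.Framework) (hB : M.BasisCond) (hG : M.GrowthCond)
    {s : ∀ k, Fin (M.n k) → Ω k → ℝ} {c K ε : ℝ} (hK : 1 ≤ K) (hε : 0 < ε) :
    ∀ᶠ k in atTop, ∀ ω, M.Good s c K k ω → ∀ i, eucl (M.RegHat k ω i - M.Reg k ω i) ≤ ε := by
  obtain ⟨C, hC1, hT, -, -⟩ := exists_basis_bound hB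
  obtain ⟨e, he1, hsize⟩ := exists_size hF
  have hη : 0 < ε / (2 * (C * e)) := by positivity
  filter_upwards [eventually_PUV_hat_sub (s := s) (c := c) (K := K) hF hB hG hη,
    eventually_ctr (s := s) (c := c) hF hB hG hK hη, hsize]
    with k h1 h2 hsz ω g i
  have h3 := h1 ω g (M.sub k i)
  have h4 := h2 ω g
  have ht' : eucl (M.PTS k (M.T k (M.sub k i) ω) (M.S k (M.sub k i) ω)) ≤ C * e * √(M.kap k) :=
    eucl_PTS_le (p := (M.T k (M.sub k i) ω, M.S k (M.sub k i) ω)) (zero_le_one.trans hC1) he1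
      (hT k) hsz.2.2.2.2.1 (TS_mem hF k i ω)
  have hδ' := mul_le_mul_of_nonneg_left (eucl_sub_le (M.PUV k (M.Uhat k (M.sub k i) ω)
    (M.Vhat k (M.sub k i) ω) - M.PUV k (M.U k (M.sub k i) ω) (M.V k (M.sub k i) ω))
    (M.ctr k ω)) (Real.sqrt_nonneg (M.kap k))
  rw [mul_add] at hδ'
  rw [eucl_RegHat_sub]
  refine (mul_le_mul_of_nonneg_right ht' (eucl_nonneg _)).trans ?_
  rw [mul_assoc]
  refine (mul_le_mul_of_nonneg_left (hδ'.trans (add_le_add h3 h4)) (by positivity)).trans ?_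
  have : C * e ≠ 0 := by positivity
  field_simp
  norm_num

lemma eucl_Reg_mulVec_sq {k : ℕ} (hn : 0 < M.n k) (ω : Ω k) (x : M.Idx k → ℝ) :
    eucl (Matrix.of (M.Reg k ω) *ᵥ x) ^ 2 =
      M.n k * (x ⬝ᵥ (M.gram k *ᵥ x) + x ⬝ᵥ (M.gramDev k ω *ᵥ x)) := by
  have hn' : (0 : ℝ) < M.n k := by exact_mod_cast hn
  have e : M.gram k + M.gramDev k ω =
      (1 / (M.n k : ℝ)) • ((Matrix.of (M.Reg k ω))ᵀ * Matrix.of (M.Reg k ω)) := by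
    ext a b
    simp [gram, gramDev, Matrix.mul_apply]
  rw [← dotProduct_add, ← Matrix.add_mulVec, e, Matrix.smul_mulVec, dotProduct_smul, smul_eq_mul,
    ← mul_assoc, mul_one_div_cancel hn'.ne', one_mul, ← Matrix.mulVec_mulVec,
    Matrix.dotProduct_mulVec, Matrix.vecMul_transpose, eucl_sq_dotProduct]

lemma gram_isHermitian (k : ℕ) : (M.gram k).IsHermitian := by
  ext a b
  simp [gram, mul_comm]

/-- On the good event the smallest eigenvalue of the feasible design matrix is of order `n`. -/
theorem eventually_RegHat_lower (hF : M.Framework) (hB : M.BasisCond) (hG : M.GrowthCond)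
    {s : ∀ k, Fin (M.n k) → Ω k → ℝ} {c K : ℝ} (hK : 1 ≤ K) (hc : 0 < c)
    (hgram : ∀ᶠ k in atTop, spectrum ℝ (M.gram k) ⊆ Ici c) :
    ∀ᶠ k in atTop, ∀ ω, M.Good s c K k ω → ∀ x : M.Idx k → ℝ,
      c / 8 * M.n k * eucl x ^ 2 ≤ eucl (M.RegHat k ω *ᵥ x) ^ 2 := by
  -- Accounting of constants: the mean matrix gives `c`, its Frobenius deviation costs `c/2`, the
  -- row perturbation halves the rest to `c/4` and then subtracts `c/8`.
  have hε : 0 < √(c / 8) := by positivity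
  filter_upwards [eventually_RegHat_sub hF hB hG hK hε, hgram,
    hF.n_tendsto.eventually_gt_atTop 0] with k h hg hn ω g x
  have hn' : (0 : ℝ) < M.n k := by exact_mod_cast hn
  have h1 := eucl_mulVec_sq_ge_of_row_sub (A := M.RegHat k ω) (B := Matrix.of (M.Reg k ω))
    (h ω g) x
  have h2 := quadForm_ge_of_spectrum (gram_isHermitian k) hg x
  have h3 := (abs_le.1 (abs_quadForm_le (M.gramDev k ω) (by positivity) g.gram x)).1
  rw [eucl_Reg_mulVec_sq hn, Real.sq_sqrt (by positivity), Fintype.card_fin] at h1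
  refine le_trans ?_ h1
  have h4 : c / 2 * eucl x ^ 2 ≤ x ⬝ᵥ (M.gram k *ᵥ x) + x ⬝ᵥ (M.gramDev k ω *ᵥ x) := by linarith
  have h5 := mul_le_mul_of_nonneg_left h4 hn'.le
  linarith

end Setup

end Spillover

/-! ### Approximation bias and pathwise control of the estimation error. -/

namespace Spillover

set_option linter.unusedSectionVars false

/-- The derivative is bounded on the compact convex square. The norm on pairs is the maximum norm,
hence one `r` bounds both coordinate differences. -/
lemma exists_lipschitz_of_contDiffOn_unitSq {f : ℝ × ℝ → ℝ} (hf : ContDiffOn ℝ 1 f unitSq) :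
    ∃ L : ℝ, 0 ≤ L ∧ ∀ p ∈ unitSq, ∀ q ∈ unitSq, ∀ r : ℝ, |p.1 - q.1| ≤ r → |p.2 - q.2| ≤ r →
      |f p - f q| ≤ L * r := by
  have hu : UniqueDiffOn ℝ unitSq :=
    (uniqueDiffOn_Icc zero_lt_one).prod (uniqueDiffOn_Icc zero_lt_one)
  obtain ⟨C, hC⟩ := isCompact_unitSq.exists_bound_of_continuousOn
    (hf.continuousOn_fderivWithin hu le_rfl)
  refine ⟨max C 0, le_max_right _ _, fun p hp q hq r h1 h2 => ?_⟩
  have h := convex_unitSq.norm_image_sub_le_of_norm_fderivWithin_le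
    (hf.differentiableOn one_ne_zero) (fun x hx => (hC x hx).trans (le_max_left _ 0)) hq hp
  rw [Real.norm_eq_abs] at h
  refine h.trans (mul_le_mul_of_nonneg_left ?_ (le_max_right _ _))
  rw [Prod.norm_def]
  exact max_le h1 h2

namespace Setup

variable {dx dz d : ℕ} {Ω : ℕ → Type*} [∀ k, MeasurableSpace (Ω k)] {M : Setup dx dz d Ω}

/-- The bias order `b_μ + τ* + n^{-ν}`. -/
noncomputable def bias (M : Setup dx dz d Ω) (k : ℕ) : ℝ := M.bmu k + M.tauStar k + M.nNu k

lemma tauStar_nonneg (hF : M.Framework) (k : ℕ) : 0 ≤ M.tauStar k :=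
  mul_nonneg (hF.tau_nonneg k) (Real.sqrt_nonneg _)

lemma bmu_nonneg (k : ℕ) : 0 ≤ M.bmu k := by
  unfold bmu; positivity

lemma bias_nonneg (hF : M.Framework) (k : ℕ) : 0 ≤ M.bias k := by
  have := bmu_nonneg (M := M) k
  have := tauStar_nonneg hF k
  have := nNu_nonneg (M := M) k
  unfold bias; linarith

/-- Pairing the centring error with `θ_λ*` through the approximated function `λ`, rather than by
Cauchy–Schwarz, avoids any bound on `‖θ_λ*‖`. -/
lemma ctr_dotProduct {k : ℕ} (hn : 0 < M.n k) (ω : Ω k) (x : M.IdxUV k → ℝ) :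
    M.ctr k ω ⬝ᵥ x = (1 / (M.n k : ℝ)) * ∑ i,
      M.PUVbar k (M.Uhat k (M.sub k i) ω) (M.Vhat k (M.sub k i) ω) ⬝ᵥ x := by
  have hn' : (0 : ℝ) < M.n k := by exact_mod_cast hn
  have e : M.ctr k ω = (1 / (M.n k : ℝ)) •
      ∑ i, M.PUVbar k (M.Uhat k (M.sub k i) ω) (M.Vhat k (M.sub k i) ω) := by
    ext b
    simp only [ctr, PUVbar, Pi.smul_apply, Finset.sum_apply, smul_eq_mul, Finset.sum_sub_distrib,
      Finset.sum_const, Finset.card_univ, Fintype.card_fin, nsmul_eq_mul]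
    field_simp
  rw [e, smul_dotProduct, smul_eq_mul, sum_dotProduct]

lemma abs_average_le {n : ℕ} (hn : 0 < n) {f : Fin n → ℝ} {b : ℝ} (h : ∀ i, |f i| ≤ b) :
    |(1 / (n : ℝ)) * ∑ i, f i| ≤ b := by
  have hn' : (0 : ℝ) < n := by exact_mod_cast hn
  rw [abs_mul, abs_of_pos (by positivity)]
  calc 1 / (n : ℝ) * |∑ i, f i| ≤ 1 / (n : ℝ) * ∑ _i : Fin n, b := by
        gcongr
        exact (Finset.abs_sum_le_sum_abs _ _).trans (Finset.sum_le_sum fun i _ => h i)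
    _ = b := by
        simp only [Finset.sum_const, Finset.card_univ, Fintype.card_fin, nsmul_eq_mul]
        field_simp

/-- Approximation of `λ` by the feasibly centred basis on the good event. -/
theorem exists_lam_approx (hF : M.Framework) (hA : M.ApproxCond)
    {s : ∀ k, Fin (M.n k) → Ω k → ℝ} {c K : ℝ} (hK : 1 ≤ K) :
    ∃ B : ℝ, 1 ≤ B ∧ ∀ᶠ k in atTop, ∀ ω, M.Good s c K k ω → ∀ p ∈ unitSq,
      |M.PUVhat k ω p.1 p.2 ⬝ᵥ M.thLam k - M.lam p.1 p.2| ≤ B * (M.bmu k + M.nNu k) := by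
  obtain ⟨C, hC⟩ := hA.lam_approx
  obtain ⟨L, hL0, hL⟩ := exists_lipschitz_of_contDiffOn_unitSq hA.lam_smooth
  refine ⟨1 + 2 * |C| + (K + L * K), ?_, ?_⟩
  · have := abs_nonneg C
    have := mul_nonneg hL0 (zero_le_one.trans hK)
    linarith
  filter_upwards [hC, hF.n_tendsto.eventually_gt_atTop 0] with k hC hn ω g p hp
  set b := |C| * (M.KUV k : ℝ) ^ (-M.muLam) with hb
  have hC' : ∀ p ∈ unitSq, |M.lam p.1 p.2 - M.PUVbar k p.1 p.2 ⬝ᵥ M.thLam k| ≤ b := fun p hp =>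
    (hC p hp).trans (mul_le_mul_of_nonneg_right (le_abs_self C) (by positivity))
  have h1 : |(1 / (M.n k : ℝ)) * ∑ i, (M.PUVbar k (M.Uhat k (M.sub k i) ω)
      (M.Vhat k (M.sub k i) ω) ⬝ᵥ M.thLam k - M.lam (M.U k (M.sub k i) ω) (M.V k (M.sub k i) ω))|
      ≤ b + L * (K * M.nNu k) := by
    refine abs_average_le hn fun i => ?_
    have a1 := hC' _ (UVhat_mem hF k (M.sub k i) ω)
    have a2 := hL _ (UVhat_mem hF k (M.sub k i) ω) _ (UV_mem hF k (M.sub k i) ω) _ (g.U _) (g.V _)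
    rw [abs_sub_comm] at a1
    refine (abs_sub_le _ (M.lam (M.Uhat k (M.sub k i) ω) (M.Vhat k (M.sub k i) ω)) _).trans ?_
    exact add_le_add a1 a2
  -- The centring error paired with `θ_λ*` is an average of `P̄_UVᵀθ_λ*` at the estimated points. Up
  -- to approximation and Lipschitz errors this is the sample mean of `λ(U_i, V_i)`, which the good
  -- event bounds by a multiple of `n^{-ν}`.
  have h2 : M.ctr k ω ⬝ᵥ M.thLam k = (1 / (M.n k : ℝ)) * ∑ i, (M.PUVbar k (M.Uhat k (M.sub k i) ω)
      (M.Vhat k (M.sub k i) ω) ⬝ᵥ M.thLam k - M.lam (M.U k (M.sub k i) ω) (M.V k (M.sub k i) ω))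
      + M.lamAvg k ω := by
    rw [ctr_dotProduct hn, lamAvg, Finset.sum_sub_distrib]; ring
  have h3 := hC' p hp
  have h4 := g.lamAvg
  have hb1 : (M.KUV k : ℝ) ^ (-M.muLam) ≤ M.bmu k + M.nNu k := by
    have := nNu_nonneg (M := M) k
    have : (0 : ℝ) ≤ (M.KTS k : ℝ) ^ (-M.muBeta) := by positivity
    have : (0 : ℝ) ≤ (M.KTS k : ℝ) ^ (-M.muG) := by positivity
    unfold bmu; linarith
  have hb0 := bmu_nonneg (M := M) k
  have hb2 : M.nNu k ≤ M.bmu k + M.nNu k := by linarith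
  have h5 : b ≤ |C| * (M.bmu k + M.nNu k) := by rw [hb]; gcongr
  have h6 : (K + L * K) * M.nNu k ≤ (K + L * K) * (M.bmu k + M.nNu k) := by gcongr
  have h7 := nNu_nonneg (M := M) k
  rw [PUVhat_eq, sub_dotProduct, h2]
  rw [abs_le] at *
  constructor <;> nlinarith

lemma eventually_bmu_add_nNu_le (hF : M.Framework) (hA : M.ApproxCond) (hC : M.ControlCond) :
    ∀ᶠ k in atTop, M.bmu k + M.nNu k ≤ 4 := by
  obtain ⟨e, he, hs⟩ := exists_size hF
  filter_upwards [hs] with k hs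
  have pos : ∀ m : ℕ, M.kap k ≤ e * m → (1 : ℝ) ≤ m := by
    intro m h
    rcases Nat.eq_zero_or_pos m with rfl | h0
    · have := hs.2.1; simp at h; linarith
    · exact_mod_cast h0
  have h1 := pos _ hs.2.2.2.1
  have h2 := pos _ hs.2.2.2.2.2.1
  have h3 : (1 : ℝ) ≤ M.n k := by exact_mod_cast hs.1
  have q : ∀ x y : ℝ, 1 ≤ x → 0 < y → x ^ (-y) ≤ 1 := fun x y hx hy =>
    Real.rpow_le_one_of_one_le_of_nonpos hx (by linarith)
  have := q _ _ h1 hA.muBeta_pos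
  have := q _ _ h1 hA.muG_pos
  have := q _ _ h2 hA.muLam_pos
  have := q _ _ h3 hC.nu_pos
  unfold bmu nNu; linarith

/-- The approximation error of the series regression. -/
noncomputable def resid (M : Setup dx dz d Ω) (k : ℕ) (ω : Ω k) (i : Fin (M.n k)) : ℝ :=
  M.Y k i ω - M.gTS k ω i * M.err k i ω - (M.RegHat k ω *ᵥ M.thetaStar k) i

lemma RegHat_mulVec_thetaStar (k : ℕ) (ω : Ω k) (i : Fin (M.n k)) :
    (M.RegHat k ω *ᵥ M.thetaStar k) i = ∑ l, M.X k (M.sub k i) ω l *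
        (M.PTS k (M.T k (M.sub k i) ω) (M.S k (M.sub k i) ω) ⬝ᵥ M.thBeta k l) +
      (M.PTS k (M.T k (M.sub k i) ω) (M.S k (M.sub k i) ω) ⬝ᵥ M.thG k) *
        (M.PUVhat k ω (M.Uhat k (M.sub k i) ω) (M.Vhat k (M.sub k i) ω) ⬝ᵥ M.thLam k) := by
  simp only [Matrix.mulVec, dotProduct, Fintype.sum_sum_type, RegHat, Matrix.of_apply,
    Sum.elim_inl, Sum.elim_inr, thetaStar]
  congr 1
  · rw [Fintype.sum_prod_type]
    refine Finset.sum_congr rfl fun l _ => ?_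
    rw [Finset.mul_sum]
    exact Finset.sum_congr rfl fun a _ => by ring
  · rw [Fintype.sum_prod_type, Finset.sum_mul_sum]
    exact Finset.sum_congr rfl fun a _ => Finset.sum_congr rfl fun b _ => by ring

/-- After removal of `g e` the outcome is `Xᵀβ + gλ`, and the product error is split as `g(λ - λ_h)
+ (g - g_h)λ_h`. The abstract names `t`, `s`, `l`, `lh` keep the final algebra tractable. -/
lemma resid_eq (k : ℕ) (ω : Ω k) (i : Fin (M.n k)) {t s l lh : ℝ}
    (ht : t = M.T k (M.sub k i) ω) (hs : s = M.S k (M.sub k i) ω)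
    (hl : l = M.lam (M.U k (M.sub k i) ω) (M.V k (M.sub k i) ω))
    (hh : lh = M.PUVhat k ω (M.Uhat k (M.sub k i) ω) (M.Vhat k (M.sub k i) ω) ⬝ᵥ M.thLam k) :
    M.resid k ω i = ∑ j, M.X k (M.sub k i) ω j * (M.beta j t s - M.PTS k t s ⬝ᵥ M.thBeta k j) +
      (M.g t s * (l - lh) + (M.g t s - M.PTS k t s ⬝ᵥ M.thG k) * lh) := by
  rw [resid, RegHat_mulVec_thetaStar, Y, gTS, err, ← ht, ← hs, ← hl, ← hh]
  simp only [mul_sub, Finset.sum_sub_distrib]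
  ring

/-- The estimated control variables enter through the Lipschitz function `λ`, not through the
derivatives of the basis. They therefore contribute `n^{-ν}` without a factor `ζ_†`. -/
theorem exists_resid_bound (hF : M.Framework) (hA : M.ApproxCond) (hCo : M.ControlCond)
    {s : ∀ k, Fin (M.n k) → Ω k → ℝ} {c K : ℝ} (hK : 1 ≤ K) :
    ∃ B : ℝ, 0 ≤ B ∧ ∀ᶠ k in atTop, ∀ ω, M.Good s c K k ω → ∀ i,
      |M.resid k ω i| ≤ B * (M.bmu k + M.nNu k) := by
  obtain ⟨B₁, hB₁, h1⟩ := exists_lam_approx (s := s) (c := c) hF hA hK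
  obtain ⟨Gb, hG1, hG⟩ := exists_g_bound hA
  obtain ⟨Lb, hLb1, hLb⟩ := exists_lam_bound hA
  obtain ⟨L, hL0, hL⟩ := exists_lipschitz_of_contDiffOn_unitSq hA.lam_smooth
  obtain ⟨Cg, hCg⟩ := hA.g_approx
  choose Cb hCb using hA.beta_approx
  refine ⟨K * ∑ l, |Cb l| + Gb * (L * K + B₁) + |Cg| * (Lb + B₁ * 4), ?_, ?_⟩
  · have : 0 ≤ ∑ l, |Cb l| := Finset.sum_nonneg fun _ _ => abs_nonneg _
    positivity
  filter_upwards [h1, hCg, eventually_all.2 hCb, eventually_bmu_add_nNu_le hF hA hCo] with k h1 hCg hCb h4 ω g i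
  have hb0 : 0 ≤ (M.KTS k : ℝ) ^ (-M.muBeta) := by positivity
  have hg0 : 0 ≤ (M.KTS k : ℝ) ^ (-M.muG) := by positivity
  have hl0 : 0 ≤ (M.KUV k : ℝ) ^ (-M.muLam) := by positivity
  have hn0 := nNu_nonneg (M := M) k
  have hb1 : (M.KTS k : ℝ) ^ (-M.muBeta) ≤ M.bmu k + M.nNu k := by unfold bmu; linarith
  have hg1 : (M.KTS k : ℝ) ^ (-M.muG) ≤ M.bmu k + M.nNu k := by unfold bmu; linarith
  have hn1 : M.nNu k ≤ M.bmu k + M.nNu k := by have := bmu_nonneg (M := M) k; linarith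
  have hβ0 : 0 ≤ M.bmu k + M.nNu k := hn0.trans hn1
  rw [resid_eq k ω i rfl rfl rfl rfl]
  have hTS := TS_mem hF k i ω
  have hUV := UV_mem hF k (M.sub k i) ω
  have hUVh := UVhat_mem hF k (M.sub k i) ω
  have a1 := h1 ω g _ hUVh
  have a2 := hL _ hUVh _ hUV _ (g.U _) (g.V _)
  have a3 := hLb _ hUVh
  have a4 := hG _ hTS
  have a5 := hCg _ hTS
  have a6 := fun l => hCb l _ hTS
  simp only at a1 a2 a3 a4 a5 a6
  generalize M.PUVhat k ω (M.Uhat k (M.sub k i) ω) (M.Vhat k (M.sub k i) ω) ⬝ᵥ M.thLam k = lh at *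
  generalize M.lam (M.Uhat k (M.sub k i) ω) (M.Vhat k (M.sub k i) ω) = l' at *
  generalize M.lam (M.U k (M.sub k i) ω) (M.V k (M.sub k i) ω) = l at *
  generalize M.T k (M.sub k i) ω = t at *
  generalize M.S k (M.sub k i) ω = u at *
  have b1 : |∑ j, M.X k (M.sub k i) ω j * (M.beta j t u - M.PTS k t u ⬝ᵥ M.thBeta k j)| ≤
      K * (∑ l, |Cb l|) * (M.bmu k + M.nNu k) := by
    refine (Finset.abs_sum_le_sum_abs _ _).trans ?_
    rw [Finset.mul_sum, Finset.sum_mul]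
    refine Finset.sum_le_sum fun j _ => ?_
    rw [abs_mul, mul_assoc]
    refine mul_le_mul ((abs_apply_le_eucl _ j).trans (g.X _)) ?_ (abs_nonneg _) (by linarith)
    exact (a6 j).trans (mul_le_mul (le_abs_self _) hb1 hb0 (abs_nonneg _))
  have b2 : |l - lh| ≤ (L * K + B₁) * (M.bmu k + M.nNu k) := by
    have c1 : L * (K * M.nNu k) ≤ L * K * (M.bmu k + M.nNu k) := by
      rw [← mul_assoc]; gcongr
    have c2 := abs_sub_le l l' lh
    rw [abs_sub_comm l l', abs_sub_comm l' lh] at c2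
    linarith
  have b3 : |lh| ≤ Lb + B₁ * 4 := by
    have c1 : B₁ * (M.bmu k + M.nNu k) ≤ B₁ * 4 := by gcongr
    have c2 := abs_sub_abs_le_abs_sub lh l'
    linarith
  have b4 : |M.g t u - M.PTS k t u ⬝ᵥ M.thG k| ≤ |Cg| * (M.bmu k + M.nNu k) :=
    a5.trans (mul_le_mul (le_abs_self _) hg1 hg0 (abs_nonneg _))
  have b5 : |M.g t u * (l - lh)| ≤ Gb * ((L * K + B₁) * (M.bmu k + M.nNu k)) := by
    rw [abs_mul]; exact mul_le_mul a4 b2 (abs_nonneg _) (by linarith)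
  have b6 : |(M.g t u - M.PTS k t u ⬝ᵥ M.thG k) * lh| ≤
      |Cg| * (M.bmu k + M.nNu k) * (Lb + B₁ * 4) := by
    rw [abs_mul]; exact mul_le_mul b4 b3 (abs_nonneg _) (by positivity)
  refine (abs_add_le _ _).trans ((add_le_add b1 ((abs_add_le _ _).trans (add_le_add b5 b6))).trans
    (le_of_eq (by ring)))

/-- The inverse of the penalized design matrix. -/
noncomputable def penInv (M : Setup dx dz d Ω) (k : ℕ) (ω : Ω k) : Matrix (M.Idx k) (M.Idx k) ℝ :=
  (penMat (M.RegHat k ω) (M.tau k * (M.n k : ℝ)) (M.D k : Matrix (M.Idx k) (M.Idx k) ℝ))⁻¹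

/-- The noise part of the estimation error. -/
noncomputable def dev (M : Setup dx dz d Ω) (k : ℕ) (ω : Ω k) : M.Idx k → ℝ :=
  M.penInv k ω *ᵥ M.noise k ω

/-- The weights of the disturbances in the linear functional `a` of the estimation error. -/
noncomputable def devWt (M : Setup dx dz d Ω) (k : ℕ) (ω : Ω k) (a : M.Idx k → ℝ)
    (i : Fin (M.n k)) : ℝ :=
  (M.RegHat k ω *ᵥ (M.penInv k ω *ᵥ a)) i * M.gTS k ω i

/-- Exhibits a functional of the noise part as a sum of disturbances with weights known given
`sigmaF`, the form to which the self-normalized inequality applies. -/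
lemma dotProduct_dev (hF : M.Framework) (k : ℕ) (ω : Ω k) (a : M.Idx k → ℝ) :
    a ⬝ᵥ M.dev k ω = ∑ i, M.devWt k ω a i * M.err k i ω := by
  rw [dev, penInv, noise, dotProduct_inv_penMat (hF.D_psd k)]
  simp only [dotProduct, devWt, penInv]
  exact Finset.sum_congr rfl fun i _ => by ring

lemma measurable_devWt (hF : M.Framework) (hB : M.BasisCond) (hA : M.ApproxCond) (k : ℕ)
    {a : Ω k → M.Idx k → ℝ} (ha : ∀ c, Measurable[M.sigmaF k] fun ω => a ω c) (i : Fin (M.n k)) :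
    Measurable[M.sigmaF k] (fun ω => M.devWt k ω (a ω) i) := by
  have hR := fun i c => measurable_RegHat hF hB k i c
  have hI : ∀ c c', Measurable[M.sigmaF k] fun ω => M.penInv k ω c c' := by
    refine measurable_matrix_inv fun c c' => ?_
    simp only [penMat, Matrix.add_apply, Matrix.mul_apply, Matrix.transpose_apply]
    exact (Finset.measurable_sum _ fun j _ => (hR j c).mul (hR j c')).add measurable_const
  have h1 : ∀ c, Measurable[M.sigmaF k] fun ω => (M.penInv k ω *ᵥ a ω) c := fun c => by
    change Measurable[M.sigmaF k] fun ω => ∑ c', M.penInv k ω c c' * a ω c'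
    exact Finset.measurable_sum _ fun c' _ => (hI c c').mul (ha c')
  refine Measurable.mul ?_ (measurable_gTS hF hA i)
  change Measurable[M.sigmaF k] fun ω => ∑ c, M.RegHat k ω i c * (M.penInv k ω *ᵥ a ω) c
  exact Finset.measurable_sum _ fun c _ => (hR i c).mul (h1 c)

/-- Deterministic control of the components of the estimation error. -/
structure Controlled (M : Setup dx dz d Ω) (s : ∀ k, Fin (M.n k) → Ω k → ℝ) (B : ℝ) (k : ℕ)
    (ω : Ω k) : Prop where
  lam : ∀ p ∈ unitSq, |M.PUVhat k ω p.1 p.2 ⬝ᵥ M.thLam k - M.lam p.1 p.2| ≤ B * M.bias k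
  lam_bdd : ∀ p ∈ unitSq, |M.PUVhat k ω p.1 p.2 ⬝ᵥ M.thLam k| ≤ B
  ctr : eucl (M.ctr k ω) ≤ 1
  biasPart : eucl (M.thetaHat k ω - M.thetaStar k - M.dev k ω) ≤ B * M.bias k
  dev : eucl (M.dev k ω) ≤ B * (M.kap k / √(M.n k : ℝ))
  quad : ∀ a, ∑ i, M.devWt k ω a i ^ 2 * (M.err k i ω ^ 2 + 2 * s k i ω) ≤
    B / M.n k * eucl a ^ 2

/-- Since `H` is invertible, `θ* = H⁻¹(AᵀAθ* + τ n Dθ*)`. Subtracting this from `H⁻¹AᵀY` leaves the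
residual and the penalty. -/
lemma thetaHat_sub (hF : M.Framework) {k : ℕ} {ω : Ω k} {c : ℝ} (hc : 0 < c)
    (h : ∀ x : M.Idx k → ℝ, c * eucl x ^ 2 ≤ eucl (M.RegHat k ω *ᵥ x) ^ 2) :
    M.thetaHat k ω - M.thetaStar k - M.dev k ω =
      M.penInv k ω *ᵥ ((M.RegHat k ω)ᵀ *ᵥ M.resid k ω) - M.penInv k ω *ᵥ
        ((M.tau k * (M.n k : ℝ)) • ((M.D k : Matrix (M.Idx k) (M.Idx k) ℝ) *ᵥ M.thetaStar k)) := by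
  have hρ : 0 ≤ M.tau k * (M.n k : ℝ) := mul_nonneg (hF.tau_nonneg k) (by positivity)
  have hY : (fun i => M.Y k i ω) = M.RegHat k ω *ᵥ M.thetaStar k + M.resid k ω +
      fun i => M.gTS k ω i * M.err k i ω := by
    ext i
    simp only [Pi.add_apply, resid]; ring
  have hθ := inv_mulVec_penMat (hF.D_psd k) hρ hc h (M.thetaStar k)
  have hpen : penMat (M.RegHat k ω) (M.tau k * (M.n k : ℝ))
      (M.D k : Matrix (M.Idx k) (M.Idx k) ℝ) *ᵥ M.thetaStar k =
      (M.RegHat k ω)ᵀ *ᵥ (M.RegHat k ω *ᵥ M.thetaStar k) +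
      (M.tau k * (M.n k : ℝ)) • ((M.D k : Matrix (M.Idx k) (M.Idx k) ℝ) *ᵥ M.thetaStar k) := by
    rw [penMat, Matrix.add_mulVec, Matrix.smul_mulVec, Matrix.mulVec_mulVec]
  have e1 : M.thetaHat k ω = M.penInv k ω *ᵥ ((M.RegHat k ω)ᵀ *ᵥ fun i => M.Y k i ω) := rfl
  change M.penInv k ω *ᵥ _ = _ at hθ
  rw [hpen, Matrix.mulVec_add] at hθ
  rw [e1, hY, Matrix.mulVec_add, Matrix.mulVec_add, Matrix.mulVec_add, Matrix.mulVec_add, Setup.dev,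
    noise]
  nth_rewrite 2 [← hθ]
  abel

/-- On the good event everything is deterministic: the lower bound `AᵀA ≥ c' n` with `c' = c/8`
turns the bounds on the score, the residuals and the penalty into bounds on coefficients. -/
theorem exists_controlled (hF : M.Framework) (hB : M.BasisCond)
    (hA : M.ApproxCond) (hCo : M.ControlCond) (hG : M.GrowthCond)
    {s : ∀ k, Fin (M.n k) → Ω k → ℝ} {C c K : ℝ} (hs : ∀ k i ω, 0 ≤ s k i ω ∧ s k i ω ≤ C)
    (hK : 1 ≤ K) (hc : 0 < c) (hgram : ∀ᶠ k in atTop, spectrum ℝ (M.gram k) ⊆ Ici c) :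
    ∃ B : ℝ, 1 ≤ B ∧ ∀ᶠ k in atTop, ∀ ω, M.Good s c K k ω → M.Controlled s B k ω := by
  obtain ⟨B₁, hB₁, h1⟩ := exists_lam_approx (s := s) (c := c) hF hA hK
  obtain ⟨B₂, hB₂, h2⟩ := exists_resid_bound (s := s) (c := c) hF hA hCo hK
  obtain ⟨Gb, hG1, hG'⟩ := exists_g_bound hA
  obtain ⟨Lb, hLb1, hLb⟩ := exists_lam_bound hA
  obtain ⟨CD, hCD⟩ := hF.D_bdd
  obtain ⟨e, he, hsize⟩ := exists_size hF
  set c' := c / 8 with hc'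
  have hc0 : 0 < c' := by positivity
  have hC0 : 0 ≤ |C| := abs_nonneg _
  set D := max CD 0 with hD
  have hD0 : 0 ≤ D := le_max_right _ _
  refine ⟨(Lb + B₁ * 4) + (B₂ / √c' + √D / c') + K / c' + (1 / c' ^ 2 + 3 * Gb ^ 2 * |C| / c'), ?_, ?_⟩
  · have : 0 ≤ (B₂ / √c' + √D / c') + K / c' + (1 / c' ^ 2 + 3 * Gb ^ 2 * |C| / c') := by positivity
    linarith
  filter_upwards [h1, h2, eventually_bmu_add_nNu_le hF hA hCo, hCD, hsize,
    eventually_RegHat_lower (s := s) hF hB hG hK hc hgram,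
    eventually_ctr (s := s) (c := c) hF hB hG hK one_pos] with k h1 h2 h4 hCD hsz hlow hctr ω g
  obtain ⟨hn, hk, -⟩ := hsz
  have hn' : (0 : ℝ) < M.n k := by exact_mod_cast hn
  have hlow := hlow ω g
  have hcn : 0 < c' * M.n k := by positivity
  have hρ : 0 ≤ M.tau k * (M.n k : ℝ) := mul_nonneg (hF.tau_nonneg k) (by positivity)
  have hpsd := hF.D_psd k
  have hτ := tauStar_nonneg hF k
  have hb0 := bmu_nonneg (M := M) k
  have hn0 := nNu_nonneg (M := M) k
  have hbias : M.bmu k + M.nNu k ≤ M.bias k := by unfold bias; linarith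
  have hbias' : M.tauStar k ≤ M.bias k := by unfold bias; linarith
  have hbias0 := bias_nonneg hF k
  have p1 : 0 ≤ B₂ / √c' + √D / c' := by positivity
  have p2 : 0 ≤ K / c' := by positivity
  have p3 : 0 ≤ 1 / c' ^ 2 + 3 * Gb ^ 2 * |C| / c' := by positivity
  have p4 : 0 ≤ Lb + B₁ * 4 := by positivity
  have inv_le := fun y => eucl_inv_penMat_le (ρ := M.tau k * (M.n k : ℝ)) hpsd hρ hcn hlow y
  refine ⟨?_, ?_, ?_, ?_, ?_, ?_⟩
  · intro p hp
    refine (h1 ω g p hp).trans ((mul_le_mul_of_nonneg_left hbias (by linarith)).trans ?_)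
    exact mul_le_mul_of_nonneg_right (by linarith) hbias0
  · intro p hp
    have a1 := h1 ω g p hp
    have a2 := hLb p hp
    have a3 := abs_sub_abs_le_abs_sub (M.PUVhat k ω p.1 p.2 ⬝ᵥ M.thLam k) (M.lam p.1 p.2)
    have a4 : B₁ * (M.bmu k + M.nNu k) ≤ B₁ * 4 := by gcongr
    linarith
  · have h5 := hctr ω g
    have h6 : (1 : ℝ) ≤ √(M.kap k) := Real.one_le_sqrt.2 hk
    nlinarith [eucl_nonneg (M.ctr k ω)]
  · rw [thetaHat_sub hF hcn hlow]
    refine (eucl_sub_le _ _).trans ?_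
    -- The residual vector has norm `O(√n (b_μ + n^{-ν}))` and `H⁻¹Aᵀ` has norm at most
    -- `(c'n)^{-1/2}`, so the sample size cancels.
    have a1 : eucl (M.penInv k ω *ᵥ ((M.RegHat k ω)ᵀ *ᵥ M.resid k ω)) ≤ B₂ / √c' * M.bias k := by
      have b1 := eucl_inv_penMat_transpose_sq_le (ρ := M.tau k * (M.n k : ℝ)) hpsd hρ hcn hlow
        (M.resid k ω)
      have b2 := eucl_le_sqrt_card_mul (by positivity) (h2 ω g)
      rw [Fintype.card_fin] at b2
      refine (abs_le_of_sq_le_sq' (?_ : _ ≤ _) (by positivity)).2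
      rw [mul_pow, div_pow, Real.sq_sqrt hc0.le, div_mul_eq_mul_div, le_div_iff₀ hc0]
      have b3 : M.n k * (c' * eucl (M.penInv k ω *ᵥ ((M.RegHat k ω)ᵀ *ᵥ M.resid k ω)) ^ 2) ≤
          M.n k * (B₂ ^ 2 * (M.bmu k + M.nNu k) ^ 2) := by
        rw [← mul_pow]
        refine le_trans (le_of_eq ?_) (b1.trans b2)
        rw [penInv]; ring
      have b4 := le_of_mul_le_mul_left b3 hn'
      rw [mul_comm]
      exact b4.trans (by gcongr)
    -- The factor `n` of the penalty cancels against `H⁻¹`, and `‖Dθ*‖ ≤ √ρ_max(D) · √(θ*ᵀDθ*)`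
    -- leaves `τ*`.
    have a2 : eucl (M.penInv k ω *ᵥ ((M.tau k * (M.n k : ℝ)) •
        ((M.D k : Matrix (M.Idx k) (M.Idx k) ℝ) *ᵥ M.thetaStar k))) ≤ √D / c' * M.bias k := by
      refine (inv_le _).trans ?_
      rw [div_le_iff₀ hcn, eucl_smul, abs_of_nonneg hρ]
      have b1 := Real.le_sqrt_of_sq_le (eucl_mulVec_sq_le hpsd hD0 (hCD.trans
        (Iic_subset_Iic.2 (le_max_left _ _))) (M.thetaStar k))
      rw [Real.sqrt_mul hD0] at b1
      calc M.tau k * M.n k * eucl ((M.D k : Matrix (M.Idx k) (M.Idx k) ℝ) *ᵥ M.thetaStar k)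
          ≤ M.tau k * M.n k * (√D * √(M.thetaStar k ⬝ᵥ
            ((M.D k : Matrix (M.Idx k) (M.Idx k) ℝ) *ᵥ M.thetaStar k))) := by gcongr
        _ = √D * M.tauStar k * M.n k := by rw [tauStar]; ring
        _ ≤ √D * M.bias k * M.n k := by gcongr
        _ = _ := by field_simp
    refine (add_le_add a1 a2).trans ?_
    rw [← add_mul]
    exact mul_le_mul_of_nonneg_right (by linarith) hbias0
  · refine (inv_le _).trans ?_
    rw [div_le_iff₀ hcn]
    refine g.noise.trans ?_
    have e1 : K * (M.kap k * √(M.n k : ℝ)) = K / c' * (M.kap k / √(M.n k : ℝ)) * (c' * M.n k) := by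
      have : (M.n k : ℝ) = √(M.n k : ℝ) * √(M.n k : ℝ) := (Real.mul_self_sqrt hn'.le).symm
      have h0 : √(M.n k : ℝ) ≠ 0 := by positivity
      field_simp
      rw [sq, ← this]
    rw [e1]
    gcongr
    linarith
  · intro a
    set y := M.penInv k ω *ᵥ a with hy
    have b1 : eucl y ≤ eucl a / (c' * M.n k) := inv_le a
    have b2 : eucl (M.RegHat k ω *ᵥ y) ^ 2 ≤ eucl a ^ 2 / (c' * M.n k) :=
      eucl_mulVec_inv_sq_le hpsd hρ hcn hlow a
    have b3 := (abs_le.1 (abs_quadForm_le _ hn'.le g.nvar y)).2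
    -- The centred part of the variance is a quadratic form in `y = H⁻¹a`. Its matrix has Frobenius
    -- norm at most `n`, so the bound holds for all `a` simultaneously and no union over functionals
    -- is needed.
    have e1 : y ⬝ᵥ (M.noiseVar s k ω *ᵥ y) = ∑ i, M.devWt k ω a i ^ 2 *
        (M.err k i ω ^ 2 - s k i ω) := by
      have : ∀ i, M.devWt k ω a i ^ 2 = ∑ b, ∑ b', y b * y b' * (M.RegHat k ω i b *
          M.RegHat k ω i b' * M.gTS k ω i ^ 2) := by
        intro i
        rw [devWt, ← hy, mul_pow, Matrix.mulVec, dotProduct, sq (∑ b, _), Finset.sum_mul_sum,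
          Finset.sum_mul]
        refine Finset.sum_congr rfl fun b _ => ?_
        rw [Finset.sum_mul]
        exact Finset.sum_congr rfl fun b' _ => by ring
      simp_rw [this, Finset.sum_mul]
      rw [Finset.sum_comm]
      simp only [dotProduct, Matrix.mulVec, noiseVar, Matrix.of_apply]
      refine Finset.sum_congr rfl fun b _ => ?_
      rw [Finset.sum_comm, Finset.mul_sum]
      refine Finset.sum_congr rfl fun b' _ => ?_
      rw [Finset.sum_mul, Finset.mul_sum]
      exact Finset.sum_congr rfl fun i _ => by ring
    have b4 : ∑ i, M.devWt k ω a i ^ 2 * (3 * s k i ω) ≤ 3 * Gb ^ 2 * |C| *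
        eucl (M.RegHat k ω *ᵥ y) ^ 2 := by
      rw [eucl_sq, Finset.mul_sum]
      refine Finset.sum_le_sum fun i _ => ?_
      rw [devWt, ← hy, mul_pow]
      have c1 : M.gTS k ω i ^ 2 ≤ Gb ^ 2 := by
        rw [← sq_abs]; exact pow_le_pow_left₀ (abs_nonneg _) (hG' _ (TS_mem hF k i ω)) 2
      have c2 : s k i ω ≤ |C| := (hs k i ω).2.trans (le_abs_self _)
      have c3 := (hs k i ω).1
      calc (M.RegHat k ω *ᵥ y) i ^ 2 * M.gTS k ω i ^ 2 * (3 * s k i ω)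
          ≤ (M.RegHat k ω *ᵥ y) i ^ 2 * Gb ^ 2 * (3 * |C|) := by gcongr
        _ = _ := by ring
    -- Splitting `e² + 2s = (e² - s) + 3s`: the first part is the quadratic form just identified,
    -- the second is bounded by the squared norm of `AH⁻¹a`.
    have e2 : ∑ i, M.devWt k ω a i ^ 2 * (M.err k i ω ^ 2 + 2 * s k i ω) =
        ∑ i, M.devWt k ω a i ^ 2 * (M.err k i ω ^ 2 - s k i ω) +
        ∑ i, M.devWt k ω a i ^ 2 * (3 * s k i ω) := by
      rw [← Finset.sum_add_distrib]
      exact Finset.sum_congr rfl fun i _ => by ring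
    rw [e2, ← e1]
    have b5 : M.n k * eucl y ^ 2 ≤ M.n k * (eucl a / (c' * M.n k)) ^ 2 := by
      have := eucl_nonneg y
      gcongr
    have b6 := mul_le_mul_of_nonneg_left b2 (by positivity : 0 ≤ 3 * Gb ^ 2 * |C|)
    calc _ ≤ M.n k * (eucl a / (c' * M.n k)) ^ 2 + 3 * Gb ^ 2 * |C| *
          (eucl a ^ 2 / (c' * M.n k)) := by linarith
      _ = (1 / c' ^ 2 + 3 * Gb ^ 2 * |C| / c') / M.n k * eucl a ^ 2 := by field_simp
      _ ≤ _ := mul_le_mul_of_nonneg_right (div_le_div_of_nonneg_right (by linarith) hn'.le)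
          (sq_nonneg _)

end Setup

end Spillover

/-! ### Uniform bounds for linear functionals of the noise part. -/

namespace Spillover

set_option linter.unusedSectionVars false

/-- The regular grid of `(N + 1) ^ 2` points in the unit square. -/
noncomputable def gridPt (N : ℕ) (j : Fin (N + 1) × Fin (N + 1)) : ℝ × ℝ := (j.1 / N, j.2 / N)

lemma gridPt_mem {N : ℕ} (hN : 0 < N) (j : Fin (N + 1) × Fin (N + 1)) : gridPt N j ∈ unitSq := by
  have hN' : (0 : ℝ) < N := by exact_mod_cast hN
  have h : ∀ i : Fin (N + 1), (i / N : ℝ) ∈ Icc (0 : ℝ) 1 := fun i => by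
    refine ⟨by positivity, ?_⟩
    rw [div_le_one hN']
    exact_mod_cast Nat.lt_succ_iff.1 i.2
  exact ⟨h _, h _⟩

lemma exists_gridPt {N : ℕ} (hN : 0 < N) {p : ℝ × ℝ} (hp : p ∈ unitSq) :
    ∃ j, |p.1 - (gridPt N j).1| ≤ 1 / N ∧ |p.2 - (gridPt N j).2| ≤ 1 / N := by
  have hN' : (0 : ℝ) < N := by exact_mod_cast hN
  have h : ∀ x ∈ Icc (0 : ℝ) 1, ∃ i : Fin (N + 1), |x - i / N| ≤ 1 / N := by
    intro x hx
    have h0 : 0 ≤ x * N := mul_nonneg hx.1 hN'.le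
    refine ⟨⟨⌊x * N⌋₊, ?_⟩, ?_⟩
    · rw [Nat.lt_succ_iff]
      refine Nat.floor_le_of_le ?_
      nlinarith [hx.2]
    · have h1 := Nat.floor_le h0
      have h2 := (Nat.lt_floor_add_one (x * N)).le
      have e : x - (⌊x * N⌋₊ : ℝ) / N = (x * N - ⌊x * N⌋₊) / N := by field_simp
      simp only
      rw [e, abs_div, abs_of_pos hN']
      gcongr
      rw [abs_le]; constructor <;> linarith
  obtain ⟨i, hi⟩ := h _ hp.1
  obtain ⟨j, hj⟩ := h _ hp.2
  exact ⟨(i, j), hi, hj⟩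

namespace Setup

variable {dx dz d : ℕ} {Ω : ℕ → Type*} [∀ k, MeasurableSpace (Ω k)] {M : Setup dx dz d Ω}

/-- The stochastic order `√(κ ln κ / n)`. -/
noncomputable def stoch (M : Setup dx dz d Ω) (k : ℕ) : ℝ :=
  √(M.kap k * Real.log (M.kap k) / (M.n k : ℝ))

/-- Simultaneous bound for polynomially many linear functionals of the noise part. -/
theorem whp_dotProduct_dev_finite (hF : M.Framework) (hB : M.BasisCond) (hA : M.ApproxCond)
    {s : ∀ k, Fin (M.n k) → Ω k → ℝ} (hs : ∀ k i, Measurable[M.sigmaF k] (s k i))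
    (hexp : ∀ k, ∀ w : Fin (M.n k) → Ω k → ℝ, (∀ i, Measurable[M.sigmaF k] (w i)) →
        ∫⁻ ω, ENNReal.ofReal (Real.exp (∑ i, (w i ω * M.err k i ω -
          w i ω ^ 2 / 6 * (M.err k i ω ^ 2 + 2 * s k i ω)))) ∂M.P k ≤ 1)
    {J : ℕ → Type*} [∀ k, Fintype (J k)] {q L : ℝ} (hq : 0 ≤ q)
    (hJ : ∀ᶠ k in atTop, (Fintype.card (J k) : ℝ) ≤ L * M.kap k ^ q)
    {a : ∀ k, J k → Ω k → M.Idx k → ℝ}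
    (ha : ∀ k j c, Measurable[M.sigmaF k] fun ω => a k j ω c)
    {A B δ : ℝ} (hA0 : 0 < A) (hB0 : 0 < B) (hδ : 0 < δ) :
    ∃ R : ℝ, 0 < R ∧ Whp M.P δ fun k ω => M.Controlled s B k ω →
      ∀ j, eucl (a k j ω) ≤ A * √(M.kap k) → |a k j ω ⬝ᵥ M.dev k ω| ≤ R * M.stoch k := by
  obtain ⟨e, he, hsize⟩ := exists_size hF
  -- Chosen so that the exponent of the tail bound equals `(q + 1) log κ`. Each functional then
  -- fails with probability at most `2κ^{-(q+1)}`, and `Lκ^q` of them together with probability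
  -- `O(1/κ)`.
  set R := √(2 / 3 * (B * A ^ 2) * (q + 1)) with hR
  have hR0 : 0 < R := Real.sqrt_pos.2 (by positivity)
  refine ⟨R, hR0, ?_⟩
  have hlim : Tendsto (fun k => 2 * L * (M.kap k)⁻¹) atTop (𝓝 0) := by
    simpa using (tendsto_inv_atTop_zero.comp hF.kap_tendsto).const_mul (2 * L)
  filter_upwards [hsize, hJ, hlim.eventually_le_const hδ] with k hsz hJ hl
  obtain ⟨hn, hk, hlog, -⟩ := hsz
  have hn' : (0 : ℝ) < M.n k := by exact_mod_cast hn
  have hk0 : 0 < M.kap k := by linarith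
  have hst : 0 < M.stoch k := Real.sqrt_pos.2 (by positivity)
  have hv : 0 < B * A ^ 2 * M.kap k / M.n k := by positivity
  have h := selfNormalized_tail_finite (sigmaF_le hF k) (measurable_err hF hA (k := k))
    (fun i => (hs k i).mono (sigmaF_le hF k) le_rfl) (hexp k) (J := J k)
    (w := fun j i ω => M.devWt k ω (a k j ω) i)
    (fun j i => measurable_devWt hF hB hA k (ha k j) i) (x := R * M.stoch k) (mul_pos hR0 hst) hv
  refine (measure_mono ?_).trans (h.trans (ENNReal.ofReal_le_ofReal ?_))
  · intro ω hω hc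
    refine hω fun hC j hj => ?_
    rw [dotProduct_dev hF]
    refine hc j ((hC.quad (a k j ω)).trans ?_)
    have h2 : eucl (a k j ω) ^ 2 ≤ A ^ 2 * M.kap k := by
      have := pow_le_pow_left₀ (eucl_nonneg _) hj 2
      rwa [mul_pow, Real.sq_sqrt hk0.le] at this
    calc B / M.n k * eucl (a k j ω) ^ 2 ≤ B / M.n k * (A ^ 2 * M.kap k) := by gcongr
      _ = _ := by ring
  · have e1 : 3 * (R * M.stoch k) ^ 2 / (2 * (B * A ^ 2 * M.kap k / M.n k)) =
        Real.log (M.kap k) * (q + 1) := by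
      rw [mul_pow, stoch, hR, Real.sq_sqrt (by positivity), Real.sq_sqrt (by positivity)]
      field_simp
    rw [e1, ← mul_neg, ← Real.rpow_def_of_pos hk0]
    calc (Fintype.card (J k) : ℝ) * (2 * M.kap k ^ (-(q + 1)))
        ≤ L * M.kap k ^ q * (2 * M.kap k ^ (-(q + 1))) := by gcongr
      _ = 2 * L * (M.kap k ^ q * M.kap k ^ (-(q + 1))) := by ring
      _ = 2 * L * (M.kap k)⁻¹ := by
          rw [← Real.rpow_add hk0, ← Real.rpow_neg_one]; congr 2; ring
      _ ≤ δ := hl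

/-- Uniform bound for a Lipschitz family of linear functionals of the noise part. -/
theorem whp_dotProduct_dev_unitSq (hF : M.Framework) (hB : M.BasisCond) (hA : M.ApproxCond)
    {s : ∀ k, Fin (M.n k) → Ω k → ℝ} (hs : ∀ k i, Measurable[M.sigmaF k] (s k i))
    (hexp : ∀ k, ∀ w : Fin (M.n k) → Ω k → ℝ, (∀ i, Measurable[M.sigmaF k] (w i)) →
        ∫⁻ ω, ENNReal.ofReal (Real.exp (∑ i, (w i ω * M.err k i ω -
          w i ω ^ 2 / 6 * (M.err k i ω ^ 2 + 2 * s k i ω)))) ∂M.P k ≤ 1)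
    {a : ∀ k, ℝ × ℝ → Ω k → M.Idx k → ℝ}
    (ha : ∀ k p c, Measurable[M.sigmaF k] fun ω => a k p ω c)
    {A B L ξ δ : ℝ} (hA0 : 0 < A) (hB0 : 0 < B) (hL : 0 ≤ L) (hξ : 0 ≤ ξ) (hδ : 0 < δ)
    (hbd : ∀ᶠ k in atTop, ∀ ω, M.Controlled s B k ω → ∀ p ∈ unitSq,
      eucl (a k p ω) ≤ A * √(M.kap k))
    (hlip : ∀ᶠ k in atTop, ∀ ω, M.Controlled s B k ω → ∀ p ∈ unitSq, ∀ q ∈ unitSq,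
      eucl (a k p ω - a k q ω) ≤ L * M.kap k ^ ξ * (|p.1 - q.1| + |p.2 - q.2|)) :
    ∃ R : ℝ, 0 < R ∧ Whp M.P δ fun k ω => M.Controlled s B k ω →
      ∀ p ∈ unitSq, |a k p ω ⬝ᵥ M.dev k ω| ≤ R * M.stoch k := by
  obtain ⟨e, he, hsize⟩ := exists_size hF
  -- With mesh `κ^{-(ξ+1)}` the functional moves by `O(1/κ)` between a point and the grid. This
  -- offsets the crude bound `‖dev‖ = O(κ/√n)`, so discretization costs only `O(1/√n)`.
  set N : ℕ → ℕ := fun k => ⌈M.kap k ^ (ξ + 1)⌉₊ with hN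
  have hJ : ∀ᶠ k in atTop, (Fintype.card (Fin (N k + 1) × Fin (N k + 1)) : ℝ) ≤
      9 * M.kap k ^ (2 * (ξ + 1)) := by
    filter_upwards [hsize] with k hsz
    have hk := hsz.2.1
    have h1 : 1 ≤ M.kap k ^ (ξ + 1) := Real.one_le_rpow hk (by linarith)
    have h2 := (Nat.ceil_lt_add_one (zero_le_one.trans h1)).le
    have h3 : (N k : ℝ) + 1 ≤ 3 * M.kap k ^ (ξ + 1) := by linarith
    simp only [Fintype.card_prod, Fintype.card_fin, Nat.cast_mul, Nat.cast_add, Nat.cast_one]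
    calc ((N k : ℝ) + 1) * (N k + 1) ≤ 3 * M.kap k ^ (ξ + 1) * (3 * M.kap k ^ (ξ + 1)) := by gcongr
      _ = 9 * (M.kap k ^ (ξ + 1) * M.kap k ^ (ξ + 1)) := by ring
      _ = _ := by rw [← Real.rpow_add (by linarith)]; congr 2; ring
  obtain ⟨R, hR, hw⟩ := whp_dotProduct_dev_finite hF hB hA hs hexp (by positivity) hJ
    (a := fun k j ω => a k (gridPt (N k) j) ω) (fun k j c => ha k _ c) hA0 hB0 hδ
  refine ⟨R + 2 * L * B, by positivity, hw.mono ?_⟩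
  filter_upwards [hsize, hbd, hlip] with k hsz hbd hlip ω h hC p hp
  obtain ⟨hn, hk, hlog, -⟩ := hsz
  have hn' : (0 : ℝ) < M.n k := by exact_mod_cast hn
  have hk0 : 0 < M.kap k := by linarith
  have hpw : 0 < M.kap k ^ (ξ + 1) := by positivity
  have hN0 : 0 < N k := Nat.ceil_pos.2 hpw
  have hN1 : M.kap k ^ (ξ + 1) ≤ N k := Nat.le_ceil _
  obtain ⟨j, h1, h2⟩ := exists_gridPt hN0 hp
  have hq := gridPt_mem hN0 j
  have a1 := h hC j (hbd ω hC _ hq)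
  have a2 : eucl (a k p ω - a k (gridPt (N k) j) ω) ≤ 2 * L / M.kap k := by
    refine (hlip ω hC p hp _ hq).trans ?_
    have hle : (1 : ℝ) / N k ≤ 1 / M.kap k ^ (ξ + 1) := one_div_le_one_div_of_le hpw hN1
    calc _ ≤ L * M.kap k ^ ξ * (1 / M.kap k ^ (ξ + 1) + 1 / M.kap k ^ (ξ + 1)) := by
          gcongr
          · exact h1.trans hle
          · exact h2.trans hle
      _ = 2 * L / M.kap k := by
          rw [Real.rpow_add hk0, Real.rpow_one]
          have : M.kap k ^ ξ ≠ 0 := by positivity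
          field_simp; ring
  have a3 := (abs_dotProduct_le (a k p ω - a k (gridPt (N k) j) ω) (M.dev k ω)).trans
    (mul_le_mul a2 hC.dev (eucl_nonneg _) (by positivity))
  have a4 : 2 * L / M.kap k * (B * (M.kap k / √(M.n k : ℝ))) ≤ 2 * L * B * M.stoch k := by
    have : 1 / √(M.n k : ℝ) ≤ M.stoch k := by
      rw [stoch, Real.sqrt_div (by positivity)]
      gcongr
      exact Real.one_le_sqrt.2 (by nlinarith)
    calc _ = 2 * L * B * (1 / √(M.n k : ℝ)) := by field_simp
      _ ≤ _ := by gcongr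
  have e1 : a k p ω ⬝ᵥ M.dev k ω = a k (gridPt (N k) j) ω ⬝ᵥ M.dev k ω +
      (a k p ω - a k (gridPt (N k) j) ω) ⬝ᵥ M.dev k ω := by
    rw [sub_dotProduct]; ring
  rw [e1, add_mul]
  exact (abs_add_le _ _).trans (add_le_add a1 (a3.trans a4))

end Setup

end Spillover

/-! ### Uniform rate of the estimator of `λ`. -/

namespace Spillover

set_option linter.unusedSectionVars false

lemma abs_setIntegral_unitSq_le {f : ℝ × ℝ → ℝ} {C : ℝ} (h : ∀ p ∈ unitSq, |f p| ≤ C) :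
    |∫ p in unitSq, f p| ≤ C := by
  have := norm_setIntegral_le_of_norm_le_const (μ := volume) (f := f)
    isCompact_unitSq.measure_lt_top h
  rwa [volume_real_unitSq, mul_one] at this

namespace Setup

variable {dx dz d : ℕ} {Ω : ℕ → Type*} [∀ k, MeasurableSpace (Ω k)] {M : Setup dx dz d Ω}

/-- The coefficient vector `(0, v ⊗ w)`. -/
def tensorVec (M : Setup dx dz d Ω) (k : ℕ) (v : M.IdxTS k → ℝ) (w : M.IdxUV k → ℝ) :
    M.Idx k → ℝ :=
  Sum.elim (fun _ => 0) fun c => v c.1 * w c.2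

lemma eucl_tensorVec (k : ℕ) (v : M.IdxTS k → ℝ) (w : M.IdxUV k → ℝ) :
    eucl (M.tensorVec k v w) = eucl v * eucl w :=
  (eucl_sumElim_zero (ι := Fin dx × M.IdxTS k) _).trans (eucl_tensor v w)

lemma tensorVec_sub_right (k : ℕ) (v : M.IdxTS k → ℝ) (w w' : M.IdxUV k → ℝ) :
    M.tensorVec k v w - M.tensorVec k v w' = M.tensorVec k v (w - w') := by
  funext c
  rcases c with c | c <;> simp [tensorVec, mul_sub]

lemma tensorVec_sub_left (k : ℕ) (v v' : M.IdxTS k → ℝ) (w : M.IdxUV k → ℝ) :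
    M.tensorVec k v w - M.tensorVec k v' w = M.tensorVec k (v - v') w := by
  funext c
  rcases c with c | c <;> simp [tensorVec, sub_mul]

lemma tensorVec_dotProduct (k : ℕ) (v : M.IdxTS k → ℝ) (w : M.IdxUV k → ℝ) (x : M.Idx k → ℝ) :
    M.tensorVec k v w ⬝ᵥ x = ∑ a, ∑ b, v a * w b * x (Sum.inr (a, b)) := by
  simp only [dotProduct, Fintype.sum_sum_type, tensorVec, Sum.elim_inl, Sum.elim_inr, zero_mul,
    Finset.sum_const_zero, zero_add, Fintype.sum_prod_type]

lemma tensorVec_dotProduct_thetaStar (k : ℕ) (v : M.IdxTS k → ℝ) (w : M.IdxUV k → ℝ) :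
    M.tensorVec k v w ⬝ᵥ M.thetaStar k = (v ⬝ᵥ M.thG k) * (w ⬝ᵥ M.thLam k) := by
  rw [tensorVec_dotProduct]
  simp only [thetaStar, Sum.elim_inr, dotProduct, Finset.sum_mul_sum]
  exact Finset.sum_congr rfl fun a _ => Finset.sum_congr rfl fun b _ => by ring

lemma glHat_eq (k : ℕ) (ω : Ω k) (t s u v : ℝ) :
    M.glHat k ω t s u v = M.tensorVec k (M.PTS k t s) (M.PUVhat k ω u v) ⬝ᵥ M.thetaHat k ω := by
  rw [tensorVec_dotProduct, glHat]

lemma integrableOn_PTS (hB : M.BasisCond) (k : ℕ) (a : M.IdxTS k) :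
    IntegrableOn (fun p : ℝ × ℝ => M.PTS k p.1 p.2 a) M.rect :=
  (continuousOn_PTS hB k a).integrableOn_compact isCompact_rect

/-- Marginal integration acts on `P_TS` alone and replaces a vector of norm `O(√κ)` by one of
bounded norm; this is the gain over the first stage. -/
lemma lamHat_eq (hB : M.BasisCond) (k : ℕ) (ω : Ω k) (u v : ℝ) :
    M.lamHat k ω u v = M.tensorVec k (M.PTSstar k) (M.PUVhat k ω u v) ⬝ᵥ M.thetaHat k ω := by
  have hint : ∀ a b, Integrable (fun p : ℝ × ℝ => M.PTS k p.1 p.2 a * M.PUVhat k ω u v b *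
      M.thetaHat k ω (Sum.inr (a, b))) (volume.restrict M.rect) := fun a b =>
    ((integrableOn_PTS hB k a).mul_const _).mul_const _
  rw [tensorVec_dotProduct, lamHat]
  simp only [glHat]
  rw [integral_finsetSum _ fun a _ => integrable_finsetSum _ fun b _ => hint a b]
  refine Finset.sum_congr rfl fun a _ => ?_
  rw [integral_finsetSum _ fun b _ => hint a b]
  refine Finset.sum_congr rfl fun b _ => ?_
  rw [integral_mul_const, integral_mul_const, PTSstar]

lemma continuousOn_tensorVec_PUVhat (hB : M.BasisCond) (k : ℕ) (ω : Ω k) (v : M.IdxTS k → ℝ)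
    (x : M.Idx k → ℝ) : ContinuousOn
      (fun p : ℝ × ℝ => M.tensorVec k v (M.PUVhat k ω p.1 p.2) ⬝ᵥ x) unitSq := by
  simp only [tensorVec_dotProduct]
  exact continuousOn_finsetSum _ fun a _ => continuousOn_finsetSum _ fun b _ =>
    (continuousOn_const.mul (continuousOn_PUVhat hB k ω b)).mul continuousOn_const

lemma continuousOn_lamHat (hB : M.BasisCond) (k : ℕ) (ω : Ω k) :
    ContinuousOn (fun p : ℝ × ℝ => M.lamHat k ω p.1 p.2) unitSq := by
  simp only [lamHat_eq hB]
  exact continuousOn_tensorVec_PUVhat hB k ω _ _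

lemma eucl_PUVhat_le (hF : M.Framework) {k : ℕ} {C e : ℝ} (hC : 0 ≤ C) (he : 1 ≤ e)
    (hU : ∀ p ∈ unitSq, ∀ b, |M.PUV k p.1 p.2 b| ≤ C) (hK : (M.KUV k : ℝ) ≤ e * M.kap k) (ω : Ω k)
    {p : ℝ × ℝ} (hp : p ∈ unitSq) : eucl (M.PUVhat k ω p.1 p.2) ≤ 2 * C * e * √(M.kap k) := by
  have h := eucl_le_of_abs_le (by positivity) fun b => abs_PUVhat_le hF hC hU ω hp b
  have hc : (Fintype.card (M.IdxUV k) : ℝ) = M.KUV k := by simp [IdxUV, KUV]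
  rw [hc] at h
  have h2 : √(M.KUV k : ℝ) ≤ e * √(M.kap k) := by
    refine (Real.sqrt_le_sqrt hK).trans ?_
    rw [Real.sqrt_mul (by linarith)]
    gcongr
    rw [Real.sqrt_le_left (by linarith)]
    nlinarith
  calc _ ≤ _ := h
    _ ≤ 2 * C * (e * √(M.kap k)) := by gcongr
    _ = _ := by ring

lemma sqrt_sq_add_sq_le (x y : ℝ) : √(x ^ 2 + y ^ 2) ≤ |x| + |y| := by
  rw [Real.sqrt_le_left (by positivity), ← sq_abs x, ← sq_abs y]
  nlinarith [abs_nonneg x, abs_nonneg y, mul_nonneg (abs_nonneg x) (abs_nonneg y)]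

lemma rpow_card_le {m : ℕ} {e κ ξ : ℝ} (he : 1 ≤ e) (hκ : 0 ≤ κ) (hξ : 0 ≤ ξ)
    (h : (m : ℝ) ≤ e * κ) : (m : ℝ) ^ ξ ≤ e ^ ξ * κ ^ ξ := by
  rw [← Real.mul_rpow (by linarith) hκ]
  exact Real.rpow_le_rpow (by positivity) h hξ

/-- The normalization `∫g = 1` enters here: the series approximation of `g` integrates to `1` up to
its uniform error times the area. -/
lemma PTSstar_dotProduct_sub (hF : M.Framework) (hB : M.BasisCond) (hA : M.ApproxCond) {k : ℕ}
    {b : ℝ} (h : ∀ p ∈ M.rect, |M.g p.1 p.2 - M.PTS k p.1 p.2 ⬝ᵥ M.thG k| ≤ b) :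
    |M.PTSstar k ⬝ᵥ M.thG k - 1| ≤ b * volume.real M.rect := by
  have hint : ∀ a, Integrable (fun p : ℝ × ℝ => M.PTS k p.1 p.2 a * M.thG k a)
      (volume.restrict M.rect) := fun a => (integrableOn_PTS hB k a).mul_const _
  have e1 : M.PTSstar k ⬝ᵥ M.thG k = ∫ p in M.rect, M.PTS k p.1 p.2 ⬝ᵥ M.thG k := by
    simp only [dotProduct, PTSstar]
    rw [integral_finsetSum _ fun a _ => hint a]
    exact Finset.sum_congr rfl fun a _ => (integral_mul_const _ _).symm
  have hg : IntegrableOn (fun p : ℝ × ℝ => M.g p.1 p.2) M.rect :=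
    hA.g_smooth.continuousOn.integrableOn_compact isCompact_rect
  rw [abs_sub_comm, ← hF.g_norm, e1, ← integral_sub hg]
  · exact norm_setIntegral_le_of_norm_le_const (μ := volume) (s := M.rect)
      (f := fun p : ℝ × ℝ => M.g p.1 p.2 - M.PTS k p.1 p.2 ⬝ᵥ M.thG k)
      isCompact_rect.measure_lt_top h
  · simp only [dotProduct]
    exact integrable_finsetSum _ fun a _ => hint a

lemma rate_eq (k : ℕ) : M.rate k = M.stoch k + √(M.kap k) * M.bias k := rfl

/-- All stochastic conditions used for the second-stage estimators hold with high probability. -/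
theorem exists_whp_controlled (hF : M.Framework) (hS : M.SpaceCond) (hM : M.MixingCond)
    (hB : M.BasisCond) (hE : M.EigenCond) (hA : M.ApproxCond) (hCo : M.ControlCond)
    (hG : M.GrowthCond) {C : ℝ} {s : ∀ k, Fin (M.n k) → Ω k → ℝ} (hC : 1 ≤ C)
    (hs : ∀ k i, Measurable[M.sigmaF k] (s k i)) (hs' : ∀ k i ω, 0 ≤ s k i ω ∧ s k i ω ≤ C)
    (h1 : ∀ k, ∀ c : Fin (M.n k) → Ω k → ℝ, (∀ i, Measurable[M.sigmaF k] (c i)) →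
        ∫⁻ ω, ENNReal.ofReal ((∑ i, c i ω * M.err k i ω) ^ 2) ∂M.P k ≤
          ∫⁻ ω, ENNReal.ofReal (C * ∑ i, c i ω ^ 2) ∂M.P k)
    (h2 : ∀ k, ∀ c : Fin (M.n k) → Ω k → ℝ, (∀ i, Measurable[M.sigmaF k] (c i)) →
        ∫⁻ ω, ENNReal.ofReal ((∑ i, c i ω * (M.err k i ω ^ 2 - s k i ω)) ^ 2) ∂M.P k ≤
          ∫⁻ ω, ENNReal.ofReal (C * ∑ i, c i ω ^ 2) ∂M.P k) {δ : ℝ} (hδ : 0 < δ) :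
    ∃ B : ℝ, 1 ≤ B ∧ Whp M.P δ (M.Controlled s B) := by
  obtain ⟨c, c₂, hc, hgram⟩ := hE
  obtain ⟨K, hK, hW⟩ := exists_good hF hS hM hB hA hCo hG hC hs h1 h2 hc hδ
  obtain ⟨B, hB1, hB2⟩ := exists_controlled (s := s) hF hB hA hCo hG hs' hK hc
    (hgram.mono fun k h => h.trans fun x hx => hx.1.le)
  exact ⟨B, hB1, hW.mono hB2⟩

/-- Uniform rate of the estimator of `λ`. -/
theorem whp_lamHat (hF : M.Framework) (hB : M.BasisCond) (hA : M.ApproxCond)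
    {s : ∀ k, Fin (M.n k) → Ω k → ℝ} (hs : ∀ k i, Measurable[M.sigmaF k] (s k i))
    (hexp : ∀ k, ∀ w : Fin (M.n k) → Ω k → ℝ, (∀ i, Measurable[M.sigmaF k] (w i)) →
        ∫⁻ ω, ENNReal.ofReal (Real.exp (∑ i, (w i ω * M.err k i ω -
          w i ω ^ 2 / 6 * (M.err k i ω ^ 2 + 2 * s k i ω)))) ∂M.P k ≤ 1)
    {B δ : ℝ} (hB1 : 1 ≤ B) (hδ : 0 < δ) :
    ∃ R : ℝ, 0 < R ∧ Whp M.P δ fun k ω => M.Controlled s B k ω →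
      ∀ p ∈ unitSq, |M.lamHat k ω p.1 p.2 - M.lam p.1 p.2| ≤ R * M.rate k := by
  obtain ⟨D, hD1, hT, hU, -⟩ := exists_basis_bound hB
  obtain ⟨e, he, hsize⟩ := exists_size hF
  obtain ⟨C', hC'⟩ := hB.PTSstar_bdd
  obtain ⟨cL, ξ, hcL, hξ, hlip⟩ := hB.lip_UV
  obtain ⟨Cg, hCg⟩ := hA.g_approx
  set C := |C'| + 1 with hC
  have hC0 : 0 < C := by positivity
  have hPs : ∀ᶠ k in atTop, eucl (M.PTSstar k) ≤ C := hC'.mono fun k h =>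
    h.trans ((le_abs_self _).trans (by linarith))
  have hbd : ∀ᶠ k in atTop, ∀ ω, ∀ p ∈ unitSq,
      eucl (M.tensorVec k (M.PTSstar k) (M.PUVhat k ω p.1 p.2)) ≤ C * (2 * D * e) * √(M.kap k) := by
    filter_upwards [hPs, hsize] with k h hsz ω p hp
    rw [eucl_tensorVec, mul_assoc]
    exact mul_le_mul h (eucl_PUVhat_le hF (by linarith) he (hU k) hsz.2.2.2.2.2.2.1 ω hp)
      (eucl_nonneg _) hC0.le
  have hlp : ∀ᶠ k in atTop, ∀ ω, M.Controlled s B k ω → ∀ p ∈ unitSq, ∀ q ∈ unitSq,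
      eucl (M.tensorVec k (M.PTSstar k) (M.PUVhat k ω p.1 p.2) -
        M.tensorVec k (M.PTSstar k) (M.PUVhat k ω q.1 q.2)) ≤
        C * (cL * e ^ ξ) * M.kap k ^ ξ * (|p.1 - q.1| + |p.2 - q.2|) := by
    filter_upwards [hPs, hsize] with k h hsz ω _ p hp q hq
    have hk0 : 0 ≤ M.kap k := zero_le_one.trans hsz.2.1
    -- The random centring cancels in differences, so the Lipschitz constant of `P_UV` applies.
    have e1 : M.PUVhat k ω p.1 p.2 - M.PUVhat k ω q.1 q.2 =
        M.PUV k p.1 p.2 - M.PUV k q.1 q.2 := by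
      funext b; simp only [PUVhat, Pi.sub_apply]; ring
    rw [tensorVec_sub_right, eucl_tensorVec, e1]
    have h3 := hlip k p hp q hq
    have h4 : cL * (M.KUV k : ℝ) ^ ξ * √((p.1 - q.1) ^ 2 + (p.2 - q.2) ^ 2) ≤
        cL * (e ^ ξ * M.kap k ^ ξ) * (|p.1 - q.1| + |p.2 - q.2|) := by
      have := rpow_card_le he hk0 hξ.le hsz.2.2.2.2.2.2.1
      have := sqrt_sq_add_sq_le (p.1 - q.1) (p.2 - q.2)
      gcongr
    calc _ ≤ C * (cL * (e ^ ξ * M.kap k ^ ξ) * (|p.1 - q.1| + |p.2 - q.2|)) :=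
          mul_le_mul h (h3.trans h4) (eucl_nonneg _) hC0.le
      _ = _ := by ring
  obtain ⟨R, hR, hw⟩ := whp_dotProduct_dev_unitSq hF hB hA hs hexp
    (a := fun k p ω => M.tensorVec k (M.PTSstar k) (M.PUVhat k ω p.1 p.2)) (fun k p c => by
      rcases c with c | c
      · exact measurable_const
      · exact (measurable_PUVhat_apply hF hB k _ _ _).const_mul _)
    (A := C * (2 * D * e)) (B := B) (by positivity) (by linarith) (by positivity) hξ.le hδ
    (hbd.mono fun k h ω _ => h ω) hlp
  set V := volume.real M.rect with hV
  have hV0 : 0 ≤ V := measureReal_nonneg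
  refine ⟨R + (C * (2 * D * e) * B + |Cg| * V * B + B), by positivity, hw.mono ?_⟩
  filter_upwards [hbd, hsize, hCg] with k hbd hsz hCg ω h hCt p hp
  have h1 := h hCt p hp
  have h2 := (abs_dotProduct_le (M.tensorVec k (M.PTSstar k) (M.PUVhat k ω p.1 p.2))
    (M.thetaHat k ω - M.thetaStar k - M.dev k ω)).trans
    (mul_le_mul (hbd ω p hp) hCt.biasPart (eucl_nonneg _) (by positivity))
  have hb0 := bias_nonneg hF k
  have hg0 : 0 ≤ (M.KTS k : ℝ) ^ (-M.muG) := by positivity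
  have hg1 : (M.KTS k : ℝ) ^ (-M.muG) ≤ M.bias k := by
    have := tauStar_nonneg hF k
    have := nNu_nonneg (M := M) k
    have : (0 : ℝ) ≤ (M.KTS k : ℝ) ^ (-M.muBeta) := by positivity
    have : (0 : ℝ) ≤ (M.KUV k : ℝ) ^ (-M.muLam) := by positivity
    unfold bias bmu; linarith
  have h3 := PTSstar_dotProduct_sub hF hB hA (b := |Cg| * M.bias k) fun p hp => (hCg p hp).trans
    (mul_le_mul (le_abs_self _) hg1 hg0 (abs_nonneg _))
  have h4 := hCt.lam p hp
  have h5 := hCt.lam_bdd p hp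
  have hs1 : 1 ≤ √(M.kap k) := Real.one_le_sqrt.2 hsz.2.1
  have hst : 0 ≤ M.stoch k := Real.sqrt_nonneg _
  have hsb : M.bias k ≤ √(M.kap k) * M.bias k := le_mul_of_one_le_left hb0 hs1
  rw [lamHat_eq hB]
  -- Noise, coefficient bias, failure of the approximated `g` to integrate to one, and approximation
  -- error of `λ`. Only the coefficient bias carries the factor `√κ`.
  have e1 : M.tensorVec k (M.PTSstar k) (M.PUVhat k ω p.1 p.2) ⬝ᵥ M.thetaHat k ω - M.lam p.1 p.2 =
      M.tensorVec k (M.PTSstar k) (M.PUVhat k ω p.1 p.2) ⬝ᵥ M.dev k ω +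
      M.tensorVec k (M.PTSstar k) (M.PUVhat k ω p.1 p.2) ⬝ᵥ
        (M.thetaHat k ω - M.thetaStar k - M.dev k ω) +
      (M.PTSstar k ⬝ᵥ M.thG k - 1) * (M.PUVhat k ω p.1 p.2 ⬝ᵥ M.thLam k) +
      (M.PUVhat k ω p.1 p.2 ⬝ᵥ M.thLam k - M.lam p.1 p.2) := by
    rw [dotProduct_sub, dotProduct_sub, tensorVec_dotProduct_thetaStar]; ring
  have h6 : |(M.PTSstar k ⬝ᵥ M.thG k - 1) * (M.PUVhat k ω p.1 p.2 ⬝ᵥ M.thLam k)| ≤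
      |Cg| * M.bias k * V * B := by
    rw [abs_mul]; exact mul_le_mul h3 h5 (abs_nonneg _) (by positivity)
  rw [e1, rate_eq]
  refine (abs_add_le _ _).trans ((add_le_add ((abs_add_le _ _).trans (add_le_add
    ((abs_add_le _ _).trans (add_le_add h1 h2)) h6)) h4).trans ?_)
  have q1 : 0 ≤ |Cg| * V * B + B := by positivity
  have q2 : 0 ≤ C * (2 * D * e) * B + |Cg| * V * B + B := by positivity
  have q3 := mul_le_mul_of_nonneg_left hsb q1
  have q4 := mul_nonneg q2 hst
  have q5 := mul_nonneg hR.le (hb0.trans hsb)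
  nlinarith

end Setup

end Spillover

/-! ### Uniform rate of the estimator of `g`. -/

namespace Spillover

set_option linter.unusedSectionVars false

/-- Perturbation of the normalized weight `f / ∫ f²`. -/
lemma abs_normalized_sub_le {f h : ℝ × ℝ → ℝ} (hf : ContinuousOn f unitSq)
    (hh : ContinuousOn h unitSq) {L I r : ℝ} (hL : 0 ≤ L) (hI0 : 0 < I)
    (hI : I = ∫ p in unitSq, f p ^ 2) (hfL : ∀ p ∈ unitSq, |f p| ≤ L)
    (hr : ∀ p ∈ unitSq, |h p - f p| ≤ r) (hr1 : r ≤ 1) (hrI : r * (2 * L + 1) ≤ I / 2)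
    {p : ℝ × ℝ} (hp : p ∈ unitSq) :
    |h p / (∫ p in unitSq, h p ^ 2) - f p / I| ≤ (2 / I + 2 * L * (2 * L + 1) / I ^ 2) * r := by
  have hr0 : 0 ≤ r := (abs_nonneg _).trans (hr p hp)
  set J := ∫ p in unitSq, h p ^ 2 with hJ
  have ih : IntegrableOn (fun p => h p ^ 2) unitSq :=
    (hh.pow 2).integrableOn_compact isCompact_unitSq
  have i_f : IntegrableOn (fun p => f p ^ 2) unitSq :=
    (hf.pow 2).integrableOn_compact isCompact_unitSq
  have hIJ : |J - I| ≤ r * (2 * L + 1) := by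
    rw [hI, hJ, ← integral_sub ih i_f]
    refine abs_setIntegral_unitSq_le fun q hq => ?_
    have e : h q ^ 2 - f q ^ 2 = (h q - f q) * (2 * f q + (h q - f q)) := by ring
    rw [e, abs_mul]
    have h1 := hr q hq
    have h2 := hfL q hq
    refine mul_le_mul h1 ((abs_add_le _ _).trans ?_) (abs_nonneg _) hr0
    rw [abs_mul, abs_two]
    linarith
  -- The smallness condition on `r` keeps the estimated denominator at least half the true one.
  have hJ0 : I / 2 ≤ J := by have := (abs_le.1 hIJ).1; linarith
  have hJp : 0 < J := by linarith
  have e : h p / J - f p / I = (h p - f p) / J + f p * (I - J) / (J * I) := by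
    field_simp; ring
  have h1 : |(h p - f p) / J| ≤ 2 / I * r := by
    rw [abs_div, abs_of_pos hJp, div_le_iff₀ hJp]
    refine (hr p hp).trans ?_
    calc r = 2 / I * r * (I / 2) := by field_simp
      _ ≤ 2 / I * r * J := by gcongr
  have h2 : |f p * (I - J) / (J * I)| ≤ 2 * L * (2 * L + 1) / I ^ 2 * r := by
    rw [abs_div, abs_of_pos (by positivity : 0 < J * I), div_le_iff₀ (by positivity), abs_mul,
      abs_sub_comm]
    refine (mul_le_mul (hfL p hp) hIJ (abs_nonneg _) hL).trans ?_
    calc L * (r * (2 * L + 1)) = 2 * L * (2 * L + 1) / I ^ 2 * r * (I / 2 * I) := by field_simp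
      _ ≤ 2 * L * (2 * L + 1) / I ^ 2 * r * (J * I) := by gcongr
  rw [e, add_mul]
  exact (abs_add_le _ _).trans (add_le_add h1 h2)

namespace Setup

variable {dx dz d : ℕ} {Ω : ℕ → Type*} [∀ k, MeasurableSpace (Ω k)] {M : Setup dx dz d Ω}

lemma continuousOn_omega (hA : M.ApproxCond) :
    ContinuousOn (fun p : ℝ × ℝ => M.omega p.1 p.2) unitSq :=
  hA.lam_smooth.continuousOn.div_const _

lemma exists_omega_bound (hA : M.ApproxCond) : ∃ C : ℝ, 1 ≤ C ∧ ∀ p ∈ unitSq,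
    |M.omega p.1 p.2| ≤ C := by
  obtain ⟨C, hC⟩ := isCompact_unitSq.exists_bound_of_continuousOn (continuousOn_omega hA)
  exact ⟨max C 1, le_max_right _ _, fun p hp => (hC p hp).trans (le_max_left _ _)⟩

lemma integral_lam_omega (hB : M.BasisCond) :
    ∫ p in unitSq, M.lam p.1 p.2 * M.omega p.1 p.2 = 1 := by
  have e : ∀ p : ℝ × ℝ, M.lam p.1 p.2 * M.omega p.1 p.2 =
      M.lam p.1 p.2 ^ 2 / ∫ p in unitSq, M.lam p.1 p.2 ^ 2 := fun p => by rw [omega]; ring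
  simp only [e]
  rw [integral_div, div_self hB.lam_ne.ne']

/-- The integral of the feasibly centred basis against the weight `ω`. -/
noncomputable def PUVhatStar (M : Setup dx dz d Ω) (k : ℕ) (ω : Ω k) : M.IdxUV k → ℝ :=
  M.PUVbarStar k - (∫ p in unitSq, M.omega p.1 p.2) • M.ctr k ω

lemma PUVhatStar_apply (hB : M.BasisCond) (hA : M.ApproxCond) (k : ℕ) (ω : Ω k) (b : M.IdxUV k) :
    M.PUVhatStar k ω b = ∫ p in unitSq, M.PUVhat k ω p.1 p.2 b * M.omega p.1 p.2 := by
  have h1 : IntegrableOn (fun p : ℝ × ℝ => M.PUVbar k p.1 p.2 b * M.omega p.1 p.2) unitSq :=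
    ((continuousOn_PUVbar hB k b).mul (continuousOn_omega hA)).integrableOn_compact isCompact_unitSq
  have h2 : IntegrableOn (fun p : ℝ × ℝ => M.ctr k ω b * M.omega p.1 p.2) unitSq :=
    (continuousOn_const.mul (continuousOn_omega hA)).integrableOn_compact isCompact_unitSq
  simp only [PUVhat_eq, Pi.sub_apply, sub_mul]
  rw [integral_sub h1 h2, integral_const_mul]
  simp [PUVhatStar, PUVbarStar, mul_comm]

lemma measurable_PUVhatStar (hF : M.Framework) (hB : M.BasisCond) (k : ℕ) (b : M.IdxUV k) :
    Measurable[M.sigmaF k] fun ω => M.PUVhatStar k ω b :=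
  measurable_const.sub ((measurable_ctr hF hB k b).const_mul _)

/-- Integration against the true weight turns the `UV` factor into a single vector, independent of
the evaluation point and of bounded norm on the controlled event, so the functional has norm `O(√κ)`
instead of `O(κ)`. -/
lemma integral_tensorVec_omega (hB : M.BasisCond) (hA : M.ApproxCond) (k : ℕ) (ω : Ω k)
    (v : M.IdxTS k → ℝ) (x : M.Idx k → ℝ) :
    ∫ p in unitSq, M.tensorVec k v (M.PUVhat k ω p.1 p.2) ⬝ᵥ x * M.omega p.1 p.2 =
      M.tensorVec k v (M.PUVhatStar k ω) ⬝ᵥ x := by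
  have hint : ∀ a b, IntegrableOn (fun p : ℝ × ℝ =>
      v a * x (Sum.inr (a, b)) * (M.PUVhat k ω p.1 p.2 b * M.omega p.1 p.2)) unitSq := fun a b =>
    (continuousOn_const.mul ((continuousOn_PUVhat hB k ω b).mul
      (continuousOn_omega hA))).integrableOn_compact isCompact_unitSq
  have e : ∀ p : ℝ × ℝ, M.tensorVec k v (M.PUVhat k ω p.1 p.2) ⬝ᵥ x * M.omega p.1 p.2 =
      ∑ a, ∑ b, v a * x (Sum.inr (a, b)) * (M.PUVhat k ω p.1 p.2 b * M.omega p.1 p.2) := fun p => by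
    simp only [tensorVec_dotProduct, Finset.sum_mul]
    exact Finset.sum_congr rfl fun a _ => Finset.sum_congr rfl fun b _ => by ring
  simp only [e]
  rw [integral_finsetSum _ fun a _ => integrable_finsetSum _ fun b _ => hint a b,
    tensorVec_dotProduct]
  refine Finset.sum_congr rfl fun a _ => ?_
  rw [integral_finsetSum _ fun b _ => hint a b]
  refine Finset.sum_congr rfl fun b _ => ?_
  rw [integral_const_mul, ← PUVhatStar_apply hB hA]
  ring

/-- The affine map of the unit square onto the rectangle `𝒯𝒮`. -/
noncomputable def toRect (M : Setup dx dz d Ω) (p : ℝ × ℝ) : ℝ × ℝ :=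
  (M.tlo + (M.thi - M.tlo) * p.1, M.slo + (M.shi - M.slo) * p.2)

/-- A rectangle of measure zero is incompatible with `∫g = 1`. -/
lemma tlo_lt_thi_and_slo_lt_shi (hF : M.Framework) : M.tlo < M.thi ∧ M.slo < M.shi := by
  have h : volume M.rect ≠ 0 := fun h => by
    have := hF.g_norm
    rw [Measure.restrict_eq_zero.2 h] at this
    simp at this
  rw [rect, Measure.volume_eq_prod, Measure.prod_prod, Real.volume_Icc, Real.volume_Icc] at h
  have h1 := left_ne_zero_of_mul h
  have h2 := right_ne_zero_of_mul h
  simp only [ne_eq, ENNReal.ofReal_eq_zero, not_le] at h1 h2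
  exact ⟨by linarith, by linarith⟩

lemma toRect_mem (hF : M.Framework) {p : ℝ × ℝ} (hp : p ∈ unitSq) : M.toRect p ∈ M.rect := by
  obtain ⟨h1, h2⟩ := tlo_lt_thi_and_slo_lt_shi hF
  obtain ⟨⟨a, b⟩, ⟨c, e⟩⟩ := hp
  refine ⟨⟨?_, ?_⟩, ⟨?_, ?_⟩⟩ <;> simp only [toRect] <;> nlinarith

lemma exists_toRect (hF : M.Framework) {p : ℝ × ℝ} (hp : p ∈ M.rect) :
    ∃ q ∈ unitSq, M.toRect q = p := by
  obtain ⟨h1, h2⟩ := tlo_lt_thi_and_slo_lt_shi hF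
  obtain ⟨⟨a, b⟩, ⟨c, e⟩⟩ := hp
  have h1' : 0 < M.thi - M.tlo := by linarith
  have h2' : 0 < M.shi - M.slo := by linarith
  refine ⟨((p.1 - M.tlo) / (M.thi - M.tlo), (p.2 - M.slo) / (M.shi - M.slo)), ⟨⟨?_, ?_⟩, ⟨?_, ?_⟩⟩, ?_⟩
  · exact div_nonneg (by linarith) h1'.le
  · exact (div_le_one h1').2 (by linarith)
  · exact div_nonneg (by linarith) h2'.le
  · exact (div_le_one h2').2 (by linarith)
  · ext
    · simp only [toRect]; field_simp; ring
    · simp only [toRect]; field_simp; ring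

/-- As `∫λω = 1`, the first term is pure weight and approximation error and the second is the
approximation error of `g`. The third is linear in `θ̂ - θ*` with the true weight, and the fourth is
the product of the first-stage error and the weight error. -/
lemma gHat_sub_eq (hB : M.BasisCond) (hA : M.ApproxCond) (k : ℕ) (ω : Ω k) (t s : ℝ) :
    M.gHat k ω t s - M.g t s =
      (M.PTS k t s ⬝ᵥ M.thG k) * (∫ p in unitSq,
        ((M.PUVhat k ω p.1 p.2 ⬝ᵥ M.thLam k) * M.omegaHat k ω p.1 p.2 -
          M.lam p.1 p.2 * M.omega p.1 p.2)) +
      (M.PTS k t s ⬝ᵥ M.thG k - M.g t s) +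
      M.tensorVec k (M.PTS k t s) (M.PUVhatStar k ω) ⬝ᵥ (M.thetaHat k ω - M.thetaStar k) +
      ∫ p in unitSq, M.tensorVec k (M.PTS k t s) (M.PUVhat k ω p.1 p.2) ⬝ᵥ
        (M.thetaHat k ω - M.thetaStar k) * (M.omegaHat k ω p.1 p.2 - M.omega p.1 p.2) := by
  have cL : ContinuousOn (fun p : ℝ × ℝ => M.PUVhat k ω p.1 p.2 ⬝ᵥ M.thLam k) unitSq := by
    simp only [dotProduct]
    exact continuousOn_finsetSum _ fun b _ => (continuousOn_PUVhat hB k ω b).mul continuousOn_const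
  have cW : ContinuousOn (fun p : ℝ × ℝ => M.omegaHat k ω p.1 p.2) unitSq :=
    (continuousOn_lamHat hB k ω).div_const _
  have cw := continuousOn_omega hA
  have cl : ContinuousOn (fun p : ℝ × ℝ => M.lam p.1 p.2) unitSq := hA.lam_smooth.continuousOn
  have cT := continuousOn_tensorVec_PUVhat hB k ω (M.PTS k t s) (M.thetaHat k ω - M.thetaStar k)
  have i1 : IntegrableOn (fun p : ℝ × ℝ =>
      (M.PUVhat k ω p.1 p.2 ⬝ᵥ M.thLam k) * M.omegaHat k ω p.1 p.2) unitSq :=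
    (cL.mul cW).integrableOn_compact isCompact_unitSq
  have i2 : IntegrableOn (fun p : ℝ × ℝ => M.lam p.1 p.2 * M.omega p.1 p.2) unitSq :=
    (cl.mul cw).integrableOn_compact isCompact_unitSq
  have i3 : IntegrableOn (fun p : ℝ × ℝ => M.tensorVec k (M.PTS k t s) (M.PUVhat k ω p.1 p.2) ⬝ᵥ
      (M.thetaHat k ω - M.thetaStar k) * M.omega p.1 p.2) unitSq :=
    (cT.mul cw).integrableOn_compact isCompact_unitSq
  have i4 : IntegrableOn (fun p : ℝ × ℝ => M.tensorVec k (M.PTS k t s) (M.PUVhat k ω p.1 p.2) ⬝ᵥ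
      (M.thetaHat k ω - M.thetaStar k) * (M.omegaHat k ω p.1 p.2 - M.omega p.1 p.2)) unitSq :=
    (cT.mul (cW.sub cw)).integrableOn_compact isCompact_unitSq
  have i5 : IntegrableOn (fun p : ℝ × ℝ => M.tensorVec k (M.PTS k t s) (M.PUVhat k ω p.1 p.2) ⬝ᵥ
      (M.thetaHat k ω - M.thetaStar k) * M.omega p.1 p.2 +
      M.tensorVec k (M.PTS k t s) (M.PUVhat k ω p.1 p.2) ⬝ᵥ
      (M.thetaHat k ω - M.thetaStar k) * (M.omegaHat k ω p.1 p.2 - M.omega p.1 p.2)) unitSq :=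
    i3.add i4
  rw [integral_sub i1 i2, integral_lam_omega hB, ← integral_tensorVec_omega hB hA]
  have e : M.gHat k ω t s = (M.PTS k t s ⬝ᵥ M.thG k) * (∫ p in unitSq,
      (M.PUVhat k ω p.1 p.2 ⬝ᵥ M.thLam k) * M.omegaHat k ω p.1 p.2) +
      ∫ p in unitSq, (M.tensorVec k (M.PTS k t s) (M.PUVhat k ω p.1 p.2) ⬝ᵥ
        (M.thetaHat k ω - M.thetaStar k) * M.omega p.1 p.2 +
        M.tensorVec k (M.PTS k t s) (M.PUVhat k ω p.1 p.2) ⬝ᵥ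
        (M.thetaHat k ω - M.thetaStar k) * (M.omegaHat k ω p.1 p.2 - M.omega p.1 p.2)) := by
    rw [gHat, ← integral_const_mul, ← integral_add (i1.const_mul _) i5]
    congr 1
    funext p
    rw [glHat_eq, dotProduct_sub, tensorVec_dotProduct_thetaStar]
    ring
  rw [e, integral_add i3 i4]
  ring

/-- The stochastic part is dominated by `√(κ⁴ ln κ / n)`; the bias part is `O(1/κ)` because
`κ^{3/2}` times the bias is bounded. Convergence to zero is needed to keep the denominator of the
estimated weight away from zero. -/
lemma tendsto_rate (hF : M.Framework) (hG : M.GrowthCond) (hX : M.ExtraCond) :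
    Tendsto M.rate atTop (𝓝 0) := by
  obtain ⟨e, he, hsize⟩ := exists_size hF
  obtain ⟨C, hC⟩ := hX.bias.bound
  have h1 : Tendsto M.stoch atTop (𝓝 0) := by
    have h : Tendsto (fun k => M.kap k * Real.log (M.kap k) / (M.n k : ℝ)) atTop (𝓝 0) := by
      refine squeeze_zero' ?_ ?_ hG.kap4_log
      · filter_upwards [hsize] with k hs
        have := hs.2.1
        have := hs.2.2.1
        positivity
      · filter_upwards [hsize] with k hs
        have h1 := hs.2.1
        have h2 := hs.2.2.1
        have : M.kap k ≤ M.kap k ^ 4 := le_self_pow₀ h1 (by norm_num)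
        gcongr
    rw [← Real.sqrt_zero]
    exact (Real.continuous_sqrt.tendsto 0).comp h
  have h2 : Tendsto (fun k => √(M.kap k) * M.bias k) atTop (𝓝 0) := by
    have hlim : Tendsto (fun k => C * (M.kap k)⁻¹) atTop (𝓝 0) := by
      simpa using (tendsto_inv_atTop_zero.comp hF.kap_tendsto).const_mul C
    refine squeeze_zero' (Eventually.of_forall fun k =>
      mul_nonneg (Real.sqrt_nonneg _) (bias_nonneg hF k)) ?_ hlim
    filter_upwards [hsize, hC] with k hs hC
    have hk0 : 0 < M.kap k := zero_lt_one.trans_le hs.2.1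
    rw [Real.norm_eq_abs, norm_one, mul_one] at hC
    have h3 := (le_abs_self _).trans hC
    rw [← div_eq_mul_inv, le_div_iff₀ hk0]
    refine le_trans (le_of_eq ?_) h3
    have : M.kap k ^ (3 / 2 : ℝ) = √(M.kap k) * M.kap k := by
      rw [Real.sqrt_eq_rpow, ← Real.rpow_add_one hk0.ne']; norm_num
    rw [this, bias]; ring
  rw [← add_zero (0 : ℝ)]
  exact h1.add h2

/-- The first-stage estimation error, scaled by `κ`, is bounded. -/
lemma exists_kap_mul_le (hF : M.Framework) (hG : M.GrowthCond) (hX : M.ExtraCond) :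
    ∃ C : ℝ, 0 ≤ C ∧ ∀ᶠ k in atTop,
      M.kap k * (M.kap k / √(M.n k : ℝ)) ≤ C ∧ M.kap k * M.bias k ≤ C := by
  obtain ⟨e, he, hsize⟩ := exists_size hF
  obtain ⟨C, hC⟩ := hX.bias.bound
  refine ⟨max C 1, le_max_of_le_right zero_le_one, ?_⟩
  filter_upwards [hsize, hC, hG.kap4.eventually_le_const one_pos] with k hs hC h1
  obtain ⟨hn, hk, -⟩ := hs
  have hn' : (0 : ℝ) < M.n k := by exact_mod_cast hn
  have hk0 : 0 < M.kap k := by linarith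
  rw [Real.norm_eq_abs, norm_one, mul_one] at hC
  constructor
  · refine le_trans ?_ (le_max_right _ _)
    rw [← mul_div_assoc, div_le_one (by positivity)]
    rw [div_le_one hn'] at h1
    refine Real.le_sqrt_of_sq_le (le_trans (le_of_eq (by ring)) h1)
  · refine le_trans ?_ (le_max_left _ _)
    refine le_trans ?_ ((le_abs_self _).trans hC)
    refine mul_le_mul_of_nonneg_right ?_ (bias_nonneg hF k)
    nth_rewrite 1 [← Real.rpow_one (M.kap k)]
    exact Real.rpow_le_rpow_of_exponent_le hk (by norm_num)

/-- Uniform rate of the estimator of `g`. -/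
theorem whp_gHat (hF : M.Framework) (hB : M.BasisCond) (hA : M.ApproxCond)
    (hG : M.GrowthCond) (hX : M.ExtraCond)
    {s : ∀ k, Fin (M.n k) → Ω k → ℝ} (hs : ∀ k i, Measurable[M.sigmaF k] (s k i))
    (hexp : ∀ k, ∀ w : Fin (M.n k) → Ω k → ℝ, (∀ i, Measurable[M.sigmaF k] (w i)) →
        ∫⁻ ω, ENNReal.ofReal (Real.exp (∑ i, (w i ω * M.err k i ω -
          w i ω ^ 2 / 6 * (M.err k i ω ^ 2 + 2 * s k i ω)))) ∂M.P k ≤ 1)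
    {B Rl δ : ℝ} (hB1 : 1 ≤ B) (hRl : 0 < Rl) (hδ : 0 < δ) :
    ∃ R : ℝ, 0 < R ∧ Whp M.P δ fun k ω => M.Controlled s B k ω →
      (∀ p ∈ unitSq, |M.lamHat k ω p.1 p.2 - M.lam p.1 p.2| ≤ Rl * M.rate k) →
      ∀ p ∈ M.rect, |M.gHat k ω p.1 p.2 - M.g p.1 p.2| ≤ R * M.rate k := by
  obtain ⟨D, hD1, hT, hU, -⟩ := exists_basis_bound hB
  obtain ⟨e, he, hsize⟩ := exists_size hF
  obtain ⟨C', hC'⟩ := hB.PUVbarStar_bdd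
  obtain ⟨cL, ξ, hcL, hξ, hlip⟩ := hB.lip_TS
  obtain ⟨Cg, hCg⟩ := hA.g_approx
  obtain ⟨Gb, hG1, hGb⟩ := exists_g_bound hA
  obtain ⟨Lb, hL1, hLb⟩ := exists_lam_bound hA
  obtain ⟨W, hW1, hW⟩ := exists_omega_bound hA
  obtain ⟨CK, hCK0, hCK⟩ := exists_kap_mul_le hF hG hX
  obtain ⟨ht, hu⟩ := tlo_lt_thi_and_slo_lt_shi hF
  set C := |C'| + W with hC
  have hC0 : 0 < C := by positivity
  -- The infeasible integral is bounded by assumption, and the centring correction by the bound on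
  -- `ω` because the controlled event gives a centring error of norm at most one.
  have hPs : ∀ᶠ k in atTop, ∀ ω, M.Controlled s B k ω → eucl (M.PUVhatStar k ω) ≤ C := by
    filter_upwards [hC'] with k h ω hCt
    have h1 : |∫ p in unitSq, M.omega p.1 p.2| ≤ W := abs_setIntegral_unitSq_le hW
    refine (eucl_sub_le _ _).trans (add_le_add (h.trans (le_abs_self _)) ?_)
    rw [eucl_smul]
    calc _ ≤ W * 1 := mul_le_mul h1 hCt.ctr (eucl_nonneg _) (by linarith)
      _ = W := mul_one W
  have hPT : ∀ᶠ k in atTop, ∀ p ∈ M.rect, eucl (M.PTS k p.1 p.2) ≤ D * e * √(M.kap k) := by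
    filter_upwards [hsize] with k hsz p hp
    exact eucl_PTS_le (by linarith) he (hT k) hsz.2.2.2.2.1 hp
  have hbd : ∀ᶠ k in atTop, ∀ ω, M.Controlled s B k ω → ∀ p ∈ M.rect,
      eucl (M.tensorVec k (M.PTS k p.1 p.2) (M.PUVhatStar k ω)) ≤ D * e * C * √(M.kap k) := by
    filter_upwards [hPs, hPT] with k h hPT ω hCt p hp
    rw [eucl_tensorVec]
    calc _ ≤ D * e * √(M.kap k) * C :=
          mul_le_mul (hPT p hp) (h ω hCt) (eucl_nonneg _) (by positivity)
      _ = _ := by ring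
  set E := (M.thi - M.tlo) + (M.shi - M.slo) with hE
  have hE0 : 0 < E := by linarith
  have hlp : ∀ᶠ k in atTop, ∀ ω, M.Controlled s B k ω → ∀ p ∈ unitSq, ∀ q ∈ unitSq,
      eucl (M.tensorVec k (M.PTS k (M.toRect p).1 (M.toRect p).2) (M.PUVhatStar k ω) -
        M.tensorVec k (M.PTS k (M.toRect q).1 (M.toRect q).2) (M.PUVhatStar k ω)) ≤
        cL * e ^ ξ * E * C * M.kap k ^ ξ * (|p.1 - q.1| + |p.2 - q.2|) := by
    filter_upwards [hPs, hsize] with k h hsz ω hCt p hp q hq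
    have hk0 : 0 ≤ M.kap k := zero_le_one.trans hsz.2.1
    rw [tensorVec_sub_left, eucl_tensorVec]
    have h3 := hlip k _ (toRect_mem hF hp) _ (toRect_mem hF hq)
    have h5 : √(((M.toRect p).1 - (M.toRect q).1) ^ 2 + ((M.toRect p).2 - (M.toRect q).2) ^ 2) ≤
        E * (|p.1 - q.1| + |p.2 - q.2|) := by
      refine (sqrt_sq_add_sq_le _ _).trans ?_
      have e1 : (M.toRect p).1 - (M.toRect q).1 = (M.thi - M.tlo) * (p.1 - q.1) := by
        simp only [toRect]; ring
      have e2 : (M.toRect p).2 - (M.toRect q).2 = (M.shi - M.slo) * (p.2 - q.2) := by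
        simp only [toRect]; ring
      rw [e1, e2, abs_mul, abs_mul, abs_of_pos (by linarith : 0 < M.thi - M.tlo),
        abs_of_pos (by linarith : 0 < M.shi - M.slo), mul_add]
      gcongr <;> linarith
    have h4 : cL * (M.KTS k : ℝ) ^ ξ *
        √(((M.toRect p).1 - (M.toRect q).1) ^ 2 + ((M.toRect p).2 - (M.toRect q).2) ^ 2) ≤
        cL * (e ^ ξ * M.kap k ^ ξ) * (E * (|p.1 - q.1| + |p.2 - q.2|)) := by
      have := rpow_card_le he hk0 hξ.le hsz.2.2.2.2.1
      gcongr
    calc _ ≤ cL * (e ^ ξ * M.kap k ^ ξ) * (E * (|p.1 - q.1| + |p.2 - q.2|)) * C :=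
          mul_le_mul (h3.trans h4) (h ω hCt) (eucl_nonneg _) (by positivity)
      _ = _ := by ring
  -- The uniform bound is available on the unit square, so the evaluation point is parametrized by
  -- the affine map onto the rectangle.
  obtain ⟨R, hR, hw⟩ := whp_dotProduct_dev_unitSq hF hB hA hs hexp
    (a := fun k p ω => M.tensorVec k (M.PTS k (M.toRect p).1 (M.toRect p).2) (M.PUVhatStar k ω))
    (fun k p c => by
      rcases c with c | c
      · exact measurable_const
      · exact (measurable_PUVhatStar hF hB k _).const_mul _)
    (A := D * e * C) (B := B) (by positivity) (by linarith) (by positivity) hξ.le hδ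
    (hbd.mono fun k h ω hCt p hp => h ω hCt _ (toRect_mem hF hp)) hlp
  set I := ∫ p in unitSq, M.lam p.1 p.2 ^ 2 with hI
  have hI0 : 0 < I := hB.lam_ne
  set Q := (2 / I + 2 * Lb * (2 * Lb + 1) / I ^ 2) * Rl with hQ
  have hQ0 : 0 ≤ Q := by positivity
  set G := Gb + |Cg| with hGdef
  have hG0 : 0 ≤ G := by positivity
  refine ⟨G * (B * (W + 1) + Lb * Q) + |Cg| + (R + D * e * C * B) +
    2 * (D * e) * (D * e) * (2 * (B * CK)) * Q, by positivity, hw.mono ?_⟩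
  have hlim : Tendsto (fun k => Rl * M.rate k) atTop (𝓝 0) := by
    simpa using (tendsto_rate hF hG hX).const_mul Rl
  have hlim2 : Tendsto (fun k => Q * M.rate k) atTop (𝓝 0) := by
    simpa using (tendsto_rate hF hG hX).const_mul Q
  have hlim3 : Tendsto (fun k => Rl * M.rate k * (2 * Lb + 1)) atTop (𝓝 0) := by
    simpa using hlim.mul_const (2 * Lb + 1)
  filter_upwards [hbd, hPT, hsize, hCg, hCK, hlim.eventually_le_const one_pos,
    hlim2.eventually_le_const one_pos, hlim3.eventually_le_const (half_pos hI0)]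
    with k hbd hPT hsz hCg hCK hl1 hl2 hl3 ω h hCt hlam p hp
  have hk1 := hsz.2.1
  have hk0 : 0 < M.kap k := by linarith
  have hb0 := bias_nonneg hF k
  have hs1 : 1 ≤ √(M.kap k) := Real.one_le_sqrt.2 hk1
  have hst : 0 ≤ M.stoch k := Real.sqrt_nonneg _
  have hsb : M.bias k ≤ √(M.kap k) * M.bias k := le_mul_of_one_le_left hb0 hs1
  have hr := rate_eq (M := M) k
  have hr0 : 0 ≤ M.rate k := by rw [hr]; positivity
  have hbr : M.bias k ≤ M.rate k := by rw [hr]; linarith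
  have hsr : √(M.kap k) * M.bias k ≤ M.rate k := by rw [hr]; linarith
  have hstr : M.stoch k ≤ M.rate k := by rw [hr]; linarith
  have hg0 : 0 ≤ (M.KTS k : ℝ) ^ (-M.muG) := by positivity
  have hg1 : (M.KTS k : ℝ) ^ (-M.muG) ≤ M.bias k := by
    have := tauStar_nonneg hF k
    have := nNu_nonneg (M := M) k
    have : (0 : ℝ) ≤ (M.KTS k : ℝ) ^ (-M.muBeta) := by positivity
    have : (0 : ℝ) ≤ (M.KUV k : ℝ) ^ (-M.muLam) := by positivity
    unfold bias bmu; linarith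
  have hom : ∀ q ∈ unitSq, |M.omegaHat k ω q.1 q.2 - M.omega q.1 q.2| ≤ Q * M.rate k := by
    intro q hq
    have h1 := abs_normalized_sub_le (f := fun p : ℝ × ℝ => M.lam p.1 p.2)
      (h := fun p : ℝ × ℝ => M.lamHat k ω p.1 p.2) hA.lam_smooth.continuousOn
      (continuousOn_lamHat hB k ω) (zero_le_one.trans hL1) hI0 hI hLb hlam hl1 hl3 hq
    rw [hQ, mul_assoc]
    exact h1
  have hoh : ∀ q ∈ unitSq, |M.omegaHat k ω q.1 q.2| ≤ W + 1 := by
    intro q hq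
    have h1 := abs_sub_abs_le_abs_sub (M.omegaHat k ω q.1 q.2) (M.omega q.1 q.2)
    have h2 := hom q hq
    have h3 := hW q hq
    linarith
  have t1 : |∫ q in unitSq, ((M.PUVhat k ω q.1 q.2 ⬝ᵥ M.thLam k) * M.omegaHat k ω q.1 q.2 -
      M.lam q.1 q.2 * M.omega q.1 q.2)| ≤ (B * (W + 1) + Lb * Q) * M.rate k := by
    refine abs_setIntegral_unitSq_le fun q hq => ?_
    have e1 : (M.PUVhat k ω q.1 q.2 ⬝ᵥ M.thLam k) * M.omegaHat k ω q.1 q.2 -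
        M.lam q.1 q.2 * M.omega q.1 q.2 =
        (M.PUVhat k ω q.1 q.2 ⬝ᵥ M.thLam k - M.lam q.1 q.2) * M.omegaHat k ω q.1 q.2 +
        M.lam q.1 q.2 * (M.omegaHat k ω q.1 q.2 - M.omega q.1 q.2) := by ring
    rw [e1]
    refine (abs_add_le _ _).trans ?_
    rw [abs_mul, abs_mul]
    calc _ ≤ B * M.bias k * (W + 1) + Lb * (Q * M.rate k) :=
          add_le_add (mul_le_mul (hCt.lam q hq) (hoh q hq) (abs_nonneg _) (by positivity))
            (mul_le_mul (hLb q hq) (hom q hq) (abs_nonneg _) (by linarith))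
      _ ≤ B * M.rate k * (W + 1) + Lb * (Q * M.rate k) := by gcongr
      _ = _ := by ring
  have t2 : |M.PTS k p.1 p.2 ⬝ᵥ M.thG k - M.g p.1 p.2| ≤ |Cg| * M.bias k := by
    rw [abs_sub_comm]
    exact (hCg p hp).trans (mul_le_mul (le_abs_self _) hg1 hg0 (abs_nonneg _))
  have t2' : |M.PTS k p.1 p.2 ⬝ᵥ M.thG k| ≤ G := by
    have h1 := hCg p hp
    have h2 := hGb p hp
    have h3 := abs_sub_abs_le_abs_sub (M.PTS k p.1 p.2 ⬝ᵥ M.thG k) (M.g p.1 p.2)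
    have h4 : (M.KTS k : ℝ) ^ (-M.muG) ≤ 1 := by
      refine Real.rpow_le_one_of_one_le_of_nonpos ?_ (by linarith [hA.muG_pos])
      have h5 := hsz.2.2.2.1
      rcases Nat.eq_zero_or_pos (M.KTS k) with h0 | h0
      · rw [h0] at h5; simp at h5; linarith
      · exact_mod_cast h0
    rw [abs_sub_comm] at h1
    have h6 : Cg * (M.KTS k : ℝ) ^ (-M.muG) ≤ |Cg| * 1 :=
      mul_le_mul (le_abs_self _) h4 hg0 (abs_nonneg _)
    linarith
  have t3 : |M.tensorVec k (M.PTS k p.1 p.2) (M.PUVhatStar k ω) ⬝ᵥ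
      (M.thetaHat k ω - M.thetaStar k)| ≤ (R + D * e * C * B) * M.rate k := by
    obtain ⟨q, hq, rfl⟩ := exists_toRect hF hp
    have h1 := h hCt q hq
    have h2 := (abs_dotProduct_le (M.tensorVec k (M.PTS k (M.toRect q).1 (M.toRect q).2)
      (M.PUVhatStar k ω)) (M.thetaHat k ω - M.thetaStar k - M.dev k ω)).trans
      (mul_le_mul (hbd ω hCt _ hp) hCt.biasPart (eucl_nonneg _) (by positivity))
    rw [← add_sub_cancel (M.dev k ω) (M.thetaHat k ω - M.thetaStar k), dotProduct_add]
    refine (abs_add_le _ _).trans ((add_le_add h1 h2).trans ?_)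
    calc R * M.stoch k + D * e * C * √(M.kap k) * (B * M.bias k) =
          R * M.stoch k + D * e * C * B * (√(M.kap k) * M.bias k) := by ring
      _ ≤ R * M.rate k + D * e * C * B * M.rate k := by gcongr
      _ = _ := by ring
  -- Of the two orders, `κ · κ/√n` is bounded because `κ⁴/n → 0`, and `κ` times the bias because
  -- even `κ^{3/2}` times it is.
  have hΔ : M.kap k * eucl (M.thetaHat k ω - M.thetaStar k) ≤ 2 * (B * CK) := by
    rw [← add_sub_cancel (M.dev k ω) (M.thetaHat k ω - M.thetaStar k)]
    calc _ ≤ M.kap k * (B * (M.kap k / √(M.n k : ℝ)) + B * M.bias k) := by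
          gcongr
          exact (eucl_add_le _ _).trans (add_le_add hCt.dev hCt.biasPart)
      _ = B * (M.kap k * (M.kap k / √(M.n k : ℝ))) + B * (M.kap k * M.bias k) := by ring
      _ ≤ B * CK + B * CK := by
          gcongr
          · exact hCK.1
          · exact hCK.2
      _ = _ := by ring
  -- Both tensor factors have norm `O(√κ)`, so the first-stage surface errs by `O(κ‖θ̂ - θ*‖) =
  -- O(1)` uniformly. Only the weight error then supplies the rate.
  have t4 : |∫ q in unitSq, M.tensorVec k (M.PTS k p.1 p.2) (M.PUVhat k ω q.1 q.2) ⬝ᵥ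
      (M.thetaHat k ω - M.thetaStar k) * (M.omegaHat k ω q.1 q.2 - M.omega q.1 q.2)| ≤
      2 * (D * e) * (D * e) * (2 * (B * CK)) * (Q * M.rate k) := by
    refine abs_setIntegral_unitSq_le fun q hq => ?_
    rw [abs_mul]
    refine mul_le_mul ((abs_dotProduct_le _ _).trans ?_) (hom q hq) (abs_nonneg _) (by positivity)
    rw [eucl_tensorVec]
    have h1 := eucl_PUVhat_le hF (by linarith) he (hU k) hsz.2.2.2.2.2.2.1 ω hq
    calc _ ≤ D * e * √(M.kap k) * (2 * D * e * √(M.kap k)) *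
          eucl (M.thetaHat k ω - M.thetaStar k) :=
          mul_le_mul_of_nonneg_right (mul_le_mul (hPT p hp) h1 (eucl_nonneg _) (by positivity))
            (eucl_nonneg _)
      _ = 2 * (D * e) * (D * e) * ((√(M.kap k) * √(M.kap k)) *
          eucl (M.thetaHat k ω - M.thetaStar k)) := by ring
      _ = 2 * (D * e) * (D * e) * (M.kap k * eucl (M.thetaHat k ω - M.thetaStar k)) := by
          rw [Real.mul_self_sqrt hk0.le]
      _ ≤ _ := by gcongr
  have t0 : |(M.PTS k p.1 p.2 ⬝ᵥ M.thG k) * (∫ q in unitSq,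
      ((M.PUVhat k ω q.1 q.2 ⬝ᵥ M.thLam k) * M.omegaHat k ω q.1 q.2 -
        M.lam q.1 q.2 * M.omega q.1 q.2))| ≤ G * ((B * (W + 1) + Lb * Q) * M.rate k) := by
    rw [abs_mul]; exact mul_le_mul t2' t1 (abs_nonneg _) hG0
  rw [gHat_sub_eq hB hA]
  refine (abs_add_le _ _).trans ((add_le_add ((abs_add_le _ _).trans (add_le_add
    ((abs_add_le _ _).trans (add_le_add t0 t2)) t3)) t4).trans ?_)
  have t5 : |Cg| * M.bias k ≤ |Cg| * M.rate k := by gcongr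
  linarith

lemma iSup_enorm_le {s : Set (ℝ × ℝ)} {f : ℝ × ℝ → ℝ} {C : ℝ} (h : ∀ p ∈ s, |f p| ≤ C) :
    ⨆ p ∈ s, ‖f p‖ₑ ≤ ENNReal.ofReal C :=
  iSup₂_le fun p hp => by
    rw [Real.enorm_eq_ofReal_abs]
    exact ENNReal.ofReal_le_ofReal (h p hp)

end Setup

end Spillover

/-! ### The two uniform rates. -/

theorem theorem3 {dx dz d : ℕ} {Ω : ℕ → Type*} [∀ k, MeasurableSpace (Ω k)]
    (M : Spillover.Setup dx dz d Ω)
    (hF : M.Framework) (hSpace : M.SpaceCond) (hMix : M.MixingCond) (hErr : M.ErrorCond)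
    (hBasis : M.BasisCond) (hEigen : M.EigenCond) (hApprox : M.ApproxCond)
    (hControl : M.ControlCond) (hGrowth : M.GrowthCond) :
    Spillover.IsBigOP M.P
      (fun k ω => ⨆ p ∈ Spillover.unitSq, ‖M.lamHat k ω p.1 p.2 - M.lam p.1 p.2‖ₑ) M.rate ∧
    (M.ExtraCond →
      Spillover.IsBigOP M.P
        (fun k ω => ⨆ p ∈ M.rect, ‖M.gHat k ω p.1 p.2 - M.g p.1 p.2‖ₑ) M.rate) := by
  open Spillover Setup in
  obtain ⟨C, s, hC, h⟩ := exists_err_bounds hF hErr hApprox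
  -- The controlled event is kept together with the bound on `λ̂`, with the same constant `B`: the
  -- argument for `ĝ` uses both at the same `ω`.
  have lam_bound : ∀ δ : ℝ, 0 < δ → ∃ B R : ℝ, 1 ≤ B ∧ 0 < R ∧ Whp M.P δ fun k ω =>
      M.Controlled s B k ω ∧
        ∀ p ∈ unitSq, |M.lamHat k ω p.1 p.2 - M.lam p.1 p.2| ≤ R * M.rate k := by
    intro δ hδ
    obtain ⟨B, hB, hw⟩ := exists_whp_controlled hF hSpace hMix hBasis hEigen hApprox hControl
      hGrowth hC (fun k => (h k).1) (fun k => (h k).2.1) (fun k => (h k).2.2.2.1)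
      (fun k => (h k).2.2.2.2) (half_pos hδ)
    obtain ⟨R, hR, hw'⟩ := whp_lamHat hF hBasis hApprox (fun k => (h k).1)
      (fun k => (h k).2.2.1) hB (half_pos hδ)
    have hand := hw.and hw' (half_pos hδ).le (half_pos hδ).le
    rw [add_halves] at hand
    exact ⟨B, R, hB, hR, hand.mono (Eventually.of_forall fun k ω hω => ⟨hω.1, hω.2 hω.1⟩)⟩
  refine ⟨isBigOP_of_whp fun δ hδ => ?_, fun hExtra => isBigOP_of_whp fun δ hδ => ?_⟩
  · obtain ⟨B, R, hB, hR, hw⟩ := lam_bound δ hδ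
    exact ⟨R, hR, hw.mono (Eventually.of_forall fun k ω hω => iSup_enorm_le hω.2)⟩
  · obtain ⟨B, Rl, hB, hRl, hw⟩ := lam_bound (δ / 2) (half_pos hδ)
    obtain ⟨R, hR, hw'⟩ := whp_gHat hF hBasis hApprox hGrowth hExtra (fun k => (h k).1)
      (fun k => (h k).2.2.1) hB hRl (half_pos hδ)
    have hand := hw.and hw' (half_pos hδ).le (half_pos hδ).le
    rw [add_halves] at hand
    exact ⟨R, hR, hand.mono (Eventually.of_forall fun k ω hω =>
      iSup_enorm_le (hω.2 hω.1.1 hω.1.2))⟩
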